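/- **Definitions.** A double category $\mathcal C=(\mathcal M,\mathcal E)$ has m-morphisms (horizontal), e-morphisms (vertical) and squares, called pseudo-commutative. Write $\mathrm{Ar}_\circlearrowleft\mathcal M$, $\mathrm{Ar}_\circlearrowleft\mathcal E$ for the categories of m-morphisms, resp. e-morphisms, with squares as maps. $\mathcal C$ has *shared isomorphisms* if there is a functorial, identity-on-objects identification of the isomorphisms of $\mathcal M$ with those of $\mathcal E$ such that a boundary two of whose parallel sides are isomorphisms has a (unique) square if and only if it commutes in $\mathcal M$, resp. $\mathcal E$. A *g-CGW category* is a double category with shared isomorphisms, with classes of good squares $\mathrm{Ar}_g\mathcal M\subseteq \mathrm{Ar}\,\mathcal M$, $\mathrm{Ar}_g\mathcal E\subseteq\mathrm{Ar}\,\mathcal E$ (wide subcategories of the arrow categories) and equivalences $k\colon \mathrm{Ar}_\circlearrowleft\mathcal E\to \mathrm{Ar}_g\mathcal M$, $c\colon \mathrm{Ar}_\circlearrowleft\mathcal M\to\mathrm{Ar}_g\mathcal E$, both strictly compatible with codomains, written $k(g)\colon \ker g\to B$ for an e-morphism $g\colon A\to B$ and $c(f)\colon B/A\to B$ for an m-morphism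 $f\colon A\to B$, such that: (Z) some object $\varnothing$ is initial in both $\mathcal M$ and $\mathcal E$; (M) all m- and e-morphisms are monic in $\mathcal M$, resp. $\mathcal E$; (G) commutative squares in $\mathcal M$ whose component on domains is an isomorphism are good, good squares are pullbacks, and likewise in $\mathcal E$; (D) $k$ sends a pseudo-commutative square to a square with invertible component on domains iff $c$ does (such squares are *distinguished*); (K) for every m-morphism $f\colon A\to B$ there is a distinguished square with top $\varnothing\to B/A$, left side $\varnothing\to A$, right side $c(f)$, bottom $f$, and for every e-morphism $g\colon A\to B$ one with top $\varnothing\to A$, left side $\varnothing\to\ker g$, right side $g$, bottom $k(g)$. A *$\star$-CGW category* is a g-CGW category such that: (GS) goodness of a square in $\mathcal M$ or $\mathcal E$ is invariant under transposition; ($\star$) for every span $C\leftarrow A\to B$ in $\mathcal M$ that can be completed to a good square, the category of such completions has an initial object $B\star_AC$, and the induced m-morphisms $B/A\to (B\star_A C)/C$ and $C/A\to (B\star_AC)/B$ are isomorphisms; dually for spans in $\mathcal E$; (PO) every span in $\mathcal M$ can be completed to a good square; (PBL) in a horizontal composite, if the outer and the right-hand squares are pseudo-commutative, so is the left-hand one,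 and similarly, for vertical composites, for the square on the e-morphisms applied first; (POL) if the left square of a commuting horizontal pasting in $\mathcal M$ (or $\mathcal E$) is a $\star$-pushout square and the outer square is good, then the right square is good. An *ECGW category* is a $\star$-CGW category with a class of *acyclic* objects containing all initial objects and such that, for each kernel-cokernel pair $A\to B\leftarrow Z$ (an m-morphism $A\to B$ and an e-morphism $Z\to B$ forming the bottom and right sides of a distinguished square with upper left corner $\varnothing$), if two of $A,B,Z$ are acyclic then so is the third. For a double category $\mathcal D$, $\mathcal C^{\mathcal D}$ is the double category of double functors $\mathcal D\to\mathcal C$, of m-natural transformations whose naturality squares at m-morphisms are good, of e-natural transformations whose naturality squares at e-morphisms are good, and of modifications. A commutative cube in $\mathcal M$ (or $\mathcal E$) from a face $A,B,C,D$ to a face $A',B',C',D'$ is *good* if all its faces are good squares and the induced square from $B\star_AC\to D$ to $B'\star_{A'}C'\to D'$ is good. $\mathcal S_n$ is the double category generated by the staircase of objects $A_{i,j}$ ($0\le i\le j\le n$), m-morphisms $A_{i,j}\to A_{i,j+1}$, e-morphisms $A_{i+1,j}\to A_{i,j}$ and the evident squares. $S_n\mathcal C$ is the full double subcategory of $\mathcal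 C^{\mathcal S_n}$ on the double functors sending each $A_{i,i}$ to an initial object and each square to a distinguished square. **Proposition.** Let $\mathcal C$ be an ECGW category and $n\ge0$. Then: 1. $\mathcal C^{\mathcal S_n}$ has a $\star$-CGW structure in which the good squares are the commuting squares of m- (resp. e-) natural transformations whose component cube at every m- (resp. e-) morphism of $\mathcal S_n$ is good, and in which $k$, $c$ and $\star$ are computed pointwise. 2. $S_n\mathcal C$ is a $\star$-CGW subcategory of $\mathcal C^{\mathcal S_n}$: it has a $\star$-CGW structure whose shared isomorphisms, good squares, $k$, $c$, $\varnothing$ and $\star$-pushouts are those of $\mathcal C^{\mathcal S_n}$. 3. With this structure, and with the staircases that are pointwise acyclic in $\mathcal C$ as its acyclic objects, $S_n\mathcal C$ is an ECGW category. In particular the same construction applies to $S_n\mathcal C$ in place of $\mathcal C$. -/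

import Mathlib

open CategoryTheory Limits

universe u v w u' v' w' u₁ v₁

namespace CGW

/-! ## Double categories -/

/-- Two categories with the same objects: the m-morphisms and the e-morphisms. -/
structure PairOfCategories where
  Ob : Type u
  catM : Category.{v} Ob
  catE : Category.{v} Ob

namespace PairOfCategories

/-- The category `ℳ`: the objects with the m-morphisms. -/
def M (C : PairOfCategories.{u, v}) : Type u := C.Ob

/-- The category `ℰ`: the objects with the e-morphisms. -/
def E (C : PairOfCategories.{u, v}) : Type u := C.Ob

instance (C : PairOfCategories.{u, v}) : Category.{v} C.M := C.catM
instance (C : PairOfCategories.{u, v}) : Category.{v} C.E := C.catE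

/-- An object, seen as an object of `ℳ`. -/
abbrev obM (C : PairOfCategories.{u, v}) (A : C.Ob) : C.M := A

/-- An object, seen as an object of `ℰ`. -/
abbrev obE (C : PairOfCategories.{u, v}) (A : C.Ob) : C.E := A

/-- m-morphisms. -/
abbrev HomM (C : PairOfCategories.{u, v}) (A B : C.Ob) : Type v := C.obM A ⟶ C.obM B

/-- e-morphisms. -/
abbrev HomE (C : PairOfCategories.{u, v}) (A B : C.Ob) : Type v := C.obE A ⟶ C.obE B

/-- Identity m-morphism. -/
abbrev idM (C : PairOfCategories.{u, v}) (A : C.Ob) : C.HomM A A := 𝟙 (C.obM A)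

/-- Identity e-morphism. -/
abbrev idE (C : PairOfCategories.{u, v}) (A : C.Ob) : C.HomE A A := 𝟙 (C.obE A)

end PairOfCategories

/-- A (strict) double category. `Sq f g g' f'` is the set of squares with top m-morphism `f`,
left e-morphism `g`, right e-morphism `g'` and bottom m-morphism `f'`. -/
structure DoubleCategory extends PairOfCategories.{u, v} where
  Sq : ∀ {A B A' B' : Ob} (_ : toPairOfCategories.HomM A B) (_ : toPairOfCategories.HomE A A')
    (_ : toPairOfCategories.HomE B B') (_ : toPairOfCategories.HomM A' B'), Type w
  /-- The square on an e-morphism that is an identity for horizontal composition. -/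
  hid : ∀ {A A' : Ob} (g : toPairOfCategories.HomE A A'),
    Sq (toPairOfCategories.idM A) g g (toPairOfCategories.idM A')
  /-- The square on an m-morphism that is an identity for vertical composition. -/
  vid : ∀ {A B : Ob} (f : toPairOfCategories.HomM A B),
    Sq f (toPairOfCategories.idE A) (toPairOfCategories.idE B) f
  /-- Horizontal composition. -/
  hcomp : ∀ {A₀ A₁ A₂ B₀ B₁ B₂ : Ob}
    {f₁ : toPairOfCategories.HomM A₀ A₁} {f₂ : toPairOfCategories.HomM A₁ A₂}
    {g₀ : toPairOfCategories.HomE A₀ B₀} {g₁ : toPairOfCategories.HomE A₁ B₁}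
    {g₂ : toPairOfCategories.HomE A₂ B₂}
    {k₁ : toPairOfCategories.HomM B₀ B₁} {k₂ : toPairOfCategories.HomM B₁ B₂},
    Sq f₁ g₀ g₁ k₁ → Sq f₂ g₁ g₂ k₂ → Sq (f₁ ≫ f₂) g₀ g₂ (k₁ ≫ k₂)
  /-- Vertical composition. -/
  vcomp : ∀ {A₀ A₁ B₀ B₁ C₀ C₁ : Ob}
    {f : toPairOfCategories.HomM A₀ A₁} {k : toPairOfCategories.HomM B₀ B₁}
    {l : toPairOfCategories.HomM C₀ C₁}
    {g₀ : toPairOfCategories.HomE A₀ B₀} {g₁ : toPairOfCategories.HomE A₁ B₁}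
    {h₀ : toPairOfCategories.HomE B₀ C₀} {h₁ : toPairOfCategories.HomE B₁ C₁},
    Sq f g₀ g₁ k → Sq k h₀ h₁ l → Sq f (g₀ ≫ h₀) (g₁ ≫ h₁) l
  hid_hcomp : ∀ {A B A' B' : Ob} {f : toPairOfCategories.HomM A B}
    {g : toPairOfCategories.HomE A A'} {g' : toPairOfCategories.HomE B B'}
    {f' : toPairOfCategories.HomM A' B'} (s : Sq f g g' f'), HEq (hcomp (hid g) s) s
  hcomp_hid : ∀ {A B A' B' : Ob} {f : toPairOfCategories.HomM A B}
    {g : toPairOfCategories.HomE A A'} {g' : toPairOfCategories.HomE B B'}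
    {f' : toPairOfCategories.HomM A' B'} (s : Sq f g g' f'), HEq (hcomp s (hid g')) s
  hcomp_assoc : ∀ {A₀ A₁ A₂ A₃ B₀ B₁ B₂ B₃ : Ob}
    {f₁ : toPairOfCategories.HomM A₀ A₁} {f₂ : toPairOfCategories.HomM A₁ A₂}
    {f₃ : toPairOfCategories.HomM A₂ A₃}
    {g₀ : toPairOfCategories.HomE A₀ B₀} {g₁ : toPairOfCategories.HomE A₁ B₁}
    {g₂ : toPairOfCategories.HomE A₂ B₂} {g₃ : toPairOfCategories.HomE A₃ B₃}
    {k₁ : toPairOfCategories.HomM B₀ B₁} {k₂ : toPairOfCategories.HomM B₁ B₂}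
    {k₃ : toPairOfCategories.HomM B₂ B₃}
    (s₁ : Sq f₁ g₀ g₁ k₁) (s₂ : Sq f₂ g₁ g₂ k₂) (s₃ : Sq f₃ g₂ g₃ k₃),
    HEq (hcomp (hcomp s₁ s₂) s₃) (hcomp s₁ (hcomp s₂ s₃))
  vid_vcomp : ∀ {A B A' B' : Ob} {f : toPairOfCategories.HomM A B}
    {g : toPairOfCategories.HomE A A'} {g' : toPairOfCategories.HomE B B'}
    {f' : toPairOfCategories.HomM A' B'} (s : Sq f g g' f'), HEq (vcomp (vid f) s) s
  vcomp_vid : ∀ {A B A' B' : Ob} {f : toPairOfCategories.HomM A B}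
    {g : toPairOfCategories.HomE A A'} {g' : toPairOfCategories.HomE B B'}
    {f' : toPairOfCategories.HomM A' B'} (s : Sq f g g' f'), HEq (vcomp s (vid f')) s
  vcomp_assoc : ∀ {A₀ A₁ B₀ B₁ C₀ C₁ D₀ D₁ : Ob}
    {f : toPairOfCategories.HomM A₀ A₁} {k : toPairOfCategories.HomM B₀ B₁}
    {l : toPairOfCategories.HomM C₀ C₁} {m : toPairOfCategories.HomM D₀ D₁}
    {g₀ : toPairOfCategories.HomE A₀ B₀} {g₁ : toPairOfCategories.HomE A₁ B₁}
    {h₀ : toPairOfCategories.HomE B₀ C₀} {h₁ : toPairOfCategories.HomE B₁ C₁}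
    {i₀ : toPairOfCategories.HomE C₀ D₀} {i₁ : toPairOfCategories.HomE C₁ D₁}
    (s₁ : Sq f g₀ g₁ k) (s₂ : Sq k h₀ h₁ l) (s₃ : Sq l i₀ i₁ m),
    HEq (vcomp (vcomp s₁ s₂) s₃) (vcomp s₁ (vcomp s₂ s₃))
  hid_id : ∀ A : Ob, hid (toPairOfCategories.idE A) = vid (toPairOfCategories.idM A)
  hid_comp : ∀ {A B C : Ob} (g : toPairOfCategories.HomE A B) (h : toPairOfCategories.HomE B C),
    hid (g ≫ h) = vcomp (hid g) (hid h)
  vid_comp : ∀ {A B C : Ob} (f : toPairOfCategories.HomM A B) (k : toPairOfCategories.HomM B C),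
    vid (f ≫ k) = hcomp (vid f) (vid k)
  interchange : ∀ {A₀ A₁ A₂ B₀ B₁ B₂ C₀ C₁ C₂ : Ob}
    {f₁ : toPairOfCategories.HomM A₀ A₁} {f₂ : toPairOfCategories.HomM A₁ A₂}
    {k₁ : toPairOfCategories.HomM B₀ B₁} {k₂ : toPairOfCategories.HomM B₁ B₂}
    {l₁ : toPairOfCategories.HomM C₀ C₁} {l₂ : toPairOfCategories.HomM C₁ C₂}
    {g₀ : toPairOfCategories.HomE A₀ B₀} {g₁ : toPairOfCategories.HomE A₁ B₁}
    {g₂ : toPairOfCategories.HomE A₂ B₂}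
    {h₀ : toPairOfCategories.HomE B₀ C₀} {h₁ : toPairOfCategories.HomE B₁ C₁}
    {h₂ : toPairOfCategories.HomE B₂ C₂}
    (a : Sq f₁ g₀ g₁ k₁) (b : Sq f₂ g₁ g₂ k₂) (c : Sq k₁ h₀ h₁ l₁) (d : Sq k₂ h₁ h₂ l₂),
    vcomp (hcomp a b) (hcomp c d) = hcomp (vcomp a c) (vcomp b d)

namespace DoubleCategory

/-- Squares with equal boundaries are (heterogeneously) equal if there is at most one square
for each boundary. -/
theorem heq_of_subsingleton {Q : PairOfCategories.{u, v}}
    {Sq : ∀ {A B A' B' : Q.Ob}, Q.HomM A B → Q.HomE A A' → Q.HomE B B' → Q.HomM A' B' → Type w}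
    (hsub : ∀ {A B A' B' : Q.Ob} (f : Q.HomM A B) (g : Q.HomE A A') (g' : Q.HomE B B')
      (f' : Q.HomM A' B'), Subsingleton (Sq f g g' f'))
    {A B A' B' : Q.Ob} {f f₁ : Q.HomM A B} {g g₁ : Q.HomE A A'} {g' g₁' : Q.HomE B B'}
    {f' f₁' : Q.HomM A' B'} (hf : f = f₁) (hg : g = g₁) (hg' : g' = g₁') (hf' : f' = f₁')
    (s : Sq f g g' f') (t : Sq f₁ g₁ g₁' f₁') : HEq s t := by
  subst hf hg hg' hf'
  exact heq_of_eq ((hsub f g g' f').elim s t)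

/-- A double category in which every boundary has at most one square: the equations between
squares hold automatically. -/
def ofSubsingleton (Q : PairOfCategories.{u, v})
    (Sq : ∀ {A B A' B' : Q.Ob}, Q.HomM A B → Q.HomE A A' → Q.HomE B B' → Q.HomM A' B' → Type w)
    (hsub : ∀ {A B A' B' : Q.Ob} (f : Q.HomM A B) (g : Q.HomE A A') (g' : Q.HomE B B')
      (f' : Q.HomM A' B'), Subsingleton (Sq f g g' f'))
    (hid : ∀ {A A' : Q.Ob} (g : Q.HomE A A'), Sq (Q.idM A) g g (Q.idM A'))
    (vid : ∀ {A B : Q.Ob} (f : Q.HomM A B), Sq f (Q.idE A) (Q.idE B) f)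
    (hcomp : ∀ {A₀ A₁ A₂ B₀ B₁ B₂ : Q.Ob} {f₁ : Q.HomM A₀ A₁} {f₂ : Q.HomM A₁ A₂}
      {g₀ : Q.HomE A₀ B₀} {g₁ : Q.HomE A₁ B₁} {g₂ : Q.HomE A₂ B₂}
      {k₁ : Q.HomM B₀ B₁} {k₂ : Q.HomM B₁ B₂},
      Sq f₁ g₀ g₁ k₁ → Sq f₂ g₁ g₂ k₂ → Sq (f₁ ≫ f₂) g₀ g₂ (k₁ ≫ k₂))
    (vcomp : ∀ {A₀ A₁ B₀ B₁ C₀ C₁ : Q.Ob}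
      {f : Q.HomM A₀ A₁} {k : Q.HomM B₀ B₁} {l : Q.HomM C₀ C₁}
      {g₀ : Q.HomE A₀ B₀} {g₁ : Q.HomE A₁ B₁} {h₀ : Q.HomE B₀ C₀} {h₁ : Q.HomE B₁ C₁},
      Sq f g₀ g₁ k → Sq k h₀ h₁ l → Sq f (g₀ ≫ h₀) (g₁ ≫ h₁) l) :
    DoubleCategory.{u, v, w} where
  toPairOfCategories := Q
  Sq := Sq
  hid := hid
  vid := vid
  hcomp := hcomp
  vcomp := vcomp
  hid_hcomp _ := heq_of_subsingleton hsub (Category.id_comp _) rfl rfl (Category.id_comp _) _ _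
  hcomp_hid _ := heq_of_subsingleton hsub (Category.comp_id _) rfl rfl (Category.comp_id _) _ _
  hcomp_assoc _ _ _ :=
    heq_of_subsingleton hsub (Category.assoc _ _ _) rfl rfl (Category.assoc _ _ _) _ _
  vid_vcomp _ := heq_of_subsingleton hsub rfl (Category.id_comp _) (Category.id_comp _) rfl _ _
  vcomp_vid _ := heq_of_subsingleton hsub rfl (Category.comp_id _) (Category.comp_id _) rfl _ _
  vcomp_assoc _ _ _ :=
    heq_of_subsingleton hsub rfl (Category.assoc _ _ _) (Category.assoc _ _ _) rfl _ _
  hid_id _ := (hsub _ _ _ _).elim _ _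
  hid_comp _ _ := (hsub _ _ _ _).elim _ _
  vid_comp _ _ := (hsub _ _ _ _).elim _ _
  interchange _ _ _ _ := (hsub _ _ _ _).elim _ _

/-- The full double subcategory on a class of objects. -/
def fullSub (C : DoubleCategory.{u, v, w}) (P : C.Ob → Prop) : DoubleCategory.{u, v, w} where
  Ob := {A : C.Ob // P A}
  catM :=
    { Hom := fun A B => C.HomM A.1 B.1
      id := fun A => C.idM A.1
      comp := fun f g => CategoryStruct.comp (obj := C.M) f g
      id_comp := fun f => Category.id_comp (obj := C.M) f
      comp_id := fun f => Category.comp_id (obj := C.M) f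
      assoc := fun f g h => Category.assoc (obj := C.M) f g h }
  catE :=
    { Hom := fun A B => C.HomE A.1 B.1
      id := fun A => C.idE A.1
      comp := fun f g => CategoryStruct.comp (obj := C.E) f g
      id_comp := fun f => Category.id_comp (obj := C.E) f
      comp_id := fun f => Category.comp_id (obj := C.E) f
      assoc := fun f g h => Category.assoc (obj := C.E) f g h }
  Sq f g g' f' := C.Sq f g g' f'
  hid g := C.hid g
  vid f := C.vid f
  hcomp s t := C.hcomp s t
  vcomp s t := C.vcomp s t
  hid_hcomp s := C.hid_hcomp s
  hcomp_hid s := C.hcomp_hid s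
  hcomp_assoc s t r := C.hcomp_assoc s t r
  vid_vcomp s := C.vid_vcomp s
  vcomp_vid s := C.vcomp_vid s
  vcomp_assoc s t r := C.vcomp_assoc s t r
  hid_id A := C.hid_id A.1
  hid_comp g h := C.hid_comp g h
  vid_comp f k := C.vid_comp f k
  interchange a b c d := C.interchange a b c d

/-- The inclusion of a full double subcategory, on m-morphisms. -/
def inclM (C : DoubleCategory.{u, v, w}) (P : C.Ob → Prop) : (C.fullSub P).M ⥤ C.M where
  obj A := Subtype.val (p := P) A
  map f := f

/-- The inclusion of a full double subcategory, on e-morphisms. -/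
def inclE (C : DoubleCategory.{u, v, w}) (P : C.Ob → Prop) : (C.fullSub P).E ⥤ C.E where
  obj A := Subtype.val (p := P) A
  map f := f

/-- Objects of `Ar_↺ ℰ`: e-morphisms. -/
structure ArE (C : DoubleCategory.{u, v, w}) where
  {src tgt : C.Ob}
  hom : C.HomE src tgt

/-- Morphisms of `Ar_↺ ℰ`: squares, composed horizontally. -/
@[ext]
structure ArE.Hom {C : DoubleCategory.{u, v, w}} (g g' : C.ArE) where
  top : C.HomM g.src g'.src
  bot : C.HomM g.tgt g'.tgt
  sq : C.Sq top g.hom g'.hom bot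

instance (C : DoubleCategory.{u, v, w}) : Category C.ArE where
  Hom := ArE.Hom
  id g := ⟨_, _, C.hid g.hom⟩
  comp s t := ⟨_, _, C.hcomp s.sq t.sq⟩
  id_comp s := ArE.Hom.ext (Category.id_comp _) (Category.id_comp _) (C.hid_hcomp s.sq)
  comp_id s := ArE.Hom.ext (Category.comp_id _) (Category.comp_id _) (C.hcomp_hid s.sq)
  assoc s t r :=
    ArE.Hom.ext (Category.assoc _ _ _) (Category.assoc _ _ _) (C.hcomp_assoc s.sq t.sq r.sq)

/-- Objects of `Ar_↺ ℳ`: m-morphisms. -/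
structure ArM (C : DoubleCategory.{u, v, w}) where
  {src tgt : C.Ob}
  hom : C.HomM src tgt

/-- Morphisms of `Ar_↺ ℳ`: squares, composed vertically. -/
@[ext]
structure ArM.Hom {C : DoubleCategory.{u, v, w}} (f f' : C.ArM) where
  left : C.HomE f.src f'.src
  right : C.HomE f.tgt f'.tgt
  sq : C.Sq f.hom left right f'.hom

instance (C : DoubleCategory.{u, v, w}) : Category C.ArM where
  Hom := ArM.Hom
  id f := ⟨_, _, C.vid f.hom⟩
  comp s t := ⟨_, _, C.vcomp s.sq t.sq⟩
  id_comp s := ArM.Hom.ext (Category.id_comp _) (Category.id_comp _) (C.vid_vcomp s.sq)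
  comp_id s := ArM.Hom.ext (Category.comp_id _) (Category.comp_id _) (C.vcomp_vid s.sq)
  assoc s t r :=
    ArM.Hom.ext (Category.assoc _ _ _) (Category.assoc _ _ _) (C.vcomp_assoc s.sq t.sq r.sq)

end DoubleCategory

/-! ## Good squares in a category -/

section Good

variable {𝒜 : Type u₁} [Category.{v₁} 𝒜]

/-- For a class `P` of morphisms of the arrow category (commuting squares), the square with
top `f`, left `g`, right `h`, bottom `k` commutes and, as a morphism from `f` to `k`, is in `P`. -/
def GoodSq (P : MorphismProperty (Arrow 𝒜)) {A B C D : 𝒜} (f : A ⟶ B) (g : A ⟶ C) (h : B ⟶ D)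
    (k : C ⟶ D) : Prop :=
  ∃ comm : g ≫ k = f ≫ h, P (Arrow.homMk (f := Arrow.mk f) (g := Arrow.mk k) g h comm)

/-- `D` with `i : B ⟶ D`, `j : C ⟶ D` is an initial object of the category of good squares
on the span `C ⟵ A ⟶ B`; that is, `D = B ⋆_A C`. -/
structure IsStarPushout (P : MorphismProperty (Arrow 𝒜)) {A B C D : 𝒜} (f : A ⟶ B) (g : A ⟶ C)
    (i : B ⟶ D) (j : C ⟶ D) : Prop where
  good : GoodSq P f g i j
  desc : ∀ {D' : 𝒜} (i' : B ⟶ D') (j' : C ⟶ D'), GoodSq P f g i' j' →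
    ∃! u : D ⟶ D', i ≫ u = i' ∧ j ≫ u = j'

/-- A good cube: the squares `(f, g, h, k)` on `A, B, C, D` and `(f', g', h', k')` on
`A', B', C', D'`, connected by `a, b, c, d`, are such that all six faces are good, and the
southern square from `v : B ⋆_A C ⟶ D` to `v' : B' ⋆_{A'} C' ⟶ D'` is good. -/
def IsGoodCube (P : MorphismProperty (Arrow 𝒜)) {A B C D A' B' C' D' : 𝒜}
    (f : A ⟶ B) (g : A ⟶ C) (h : B ⟶ D) (k : C ⟶ D)
    (f' : A' ⟶ B') (g' : A' ⟶ C') (h' : B' ⟶ D') (k' : C' ⟶ D')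
    (a : A ⟶ A') (b : B ⟶ B') (c : C ⟶ C') (d : D ⟶ D') : Prop :=
  GoodSq P f g h k ∧ GoodSq P f' g' h' k' ∧
  GoodSq P f a b f' ∧ GoodSq P g a c g' ∧ GoodSq P h b d h' ∧ GoodSq P k c d k' ∧
  ∃ (S S' : 𝒜) (i : B ⟶ S) (j : C ⟶ S) (i' : B' ⟶ S') (j' : C' ⟶ S')
    (s : S ⟶ S') (v : S ⟶ D) (v' : S' ⟶ D'),
    IsStarPushout P f g i j ∧ IsStarPushout P f' g' i' j' ∧
    (i ≫ s = b ≫ i' ∧ j ≫ s = c ≫ j') ∧ (i ≫ v = h ∧ j ≫ v = k) ∧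
    (i' ≫ v' = h' ∧ j' ≫ v' = k') ∧ GoodSq P v s d v'

theorem GoodSq.id {P : MorphismProperty (Arrow 𝒜)} (hP : P.IsMultiplicative) {A B : 𝒜}
    (f : A ⟶ B) : GoodSq P f (𝟙 A) (𝟙 B) f :=
  ⟨by simp, P.id_mem (Arrow.mk f)⟩

theorem GoodSq.comp {P : MorphismProperty (Arrow 𝒜)} (hP : P.IsMultiplicative)
    {A B C D C' D' : 𝒜} {f : A ⟶ B} {g : A ⟶ C} {h : B ⟶ D} {k : C ⟶ D}
    {g' : C ⟶ C'} {h' : D ⟶ D'} {k' : C' ⟶ D'}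
    (s : GoodSq P f g h k) (t : GoodSq P k g' h' k') : GoodSq P f (g ≫ g') (h ≫ h') k' := by
  obtain ⟨c₁, s⟩ := s
  obtain ⟨c₂, t⟩ := t
  exact ⟨by rw [Category.assoc, c₂, ← Category.assoc, c₁, Category.assoc], P.comp_mem _ _ s t⟩

end Good

/-! ## g-CGW categories -/

/-- Shared isomorphisms. A groupoid with identity-on-objects functors to `ℳ` and `ℰ` that create
isomorphisms is the same thing as a functorial identification `toE` of the isomorphisms
of `ℳ` with those of `ℰ`. -/
structure SharedIsos (C : DoubleCategory.{u, v, w}) where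
  toE : ∀ {A B : C.Ob}, (C.obM A ≅ C.obM B) ≃ (C.obE A ≅ C.obE B)
  toE_trans : ∀ {A B D : C.Ob} (f : C.obM A ≅ C.obM B) (f' : C.obM B ≅ C.obM D),
    toE (f ≪≫ f') = toE f ≪≫ toE f'
  nonempty_sq_vert_iff : ∀ {A B A' B' : C.Ob} (g : C.HomM A B) (f : C.obM A ≅ C.obM A')
    (f' : C.obM B ≅ C.obM B') (g' : C.HomM A' B'),
    Nonempty (C.Sq g (toE f).hom (toE f').hom g') ↔ g ≫ f'.hom = f.hom ≫ g'
  subsingleton_sq_vert : ∀ {A B A' B' : C.Ob} (g : C.HomM A B) (f : C.obM A ≅ C.obM A')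
    (f' : C.obM B ≅ C.obM B') (g' : C.HomM A' B'),
    Subsingleton (C.Sq g (toE f).hom (toE f').hom g')
  nonempty_sq_horiz_iff : ∀ {A B A' B' : C.Ob} (f : C.obM A ≅ C.obM B) (g : C.HomE A A')
    (g' : C.HomE B B') (f' : C.obM A' ≅ C.obM B'),
    Nonempty (C.Sq f.hom g g' f'.hom) ↔ g ≫ (toE f').hom = (toE f).hom ≫ g'
  subsingleton_sq_horiz : ∀ {A B A' B' : C.Ob} (f : C.obM A ≅ C.obM B) (g : C.HomE A A')
    (g' : C.HomE B B') (f' : C.obM A' ≅ C.obM B'),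
    Subsingleton (C.Sq f.hom g g' f'.hom)

/-- Classes of good squares, and functors `k : Ar_↺ ℰ ⥤ Ar_g ℳ`, `c : Ar_↺ ℳ ⥤ Ar_g ℰ`. The
functor `k` sends `g : A ⟶ B` to `kerι g : ker g ⟶ B` and a square with bottom side `f'` to a good
square with the same side `f'` on the codomains; dually for `c`, with `cokπ f : cok f ⟶ B` for
an m-morphism `f : A ⟶ B`. -/
structure KerCok (C : DoubleCategory.{u, v, w}) where
  goodM : MorphismProperty (Arrow C.M)
  goodE : MorphismProperty (Arrow C.E)
  mulM : goodM.IsMultiplicative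
  mulE : goodE.IsMultiplicative
  ker : ∀ {A B : C.Ob}, C.HomE A B → C.Ob
  kerι : ∀ {A B : C.Ob} (g : C.HomE A B), C.HomM (ker g) B
  kerMap : ∀ {A B A' B' : C.Ob} {f : C.HomM A B} {g : C.HomE A A'} {g' : C.HomE B B'}
    {f' : C.HomM A' B'}, C.Sq f g g' f' → C.HomM (ker g) (ker g')
  kerMap_good : ∀ {A B A' B' : C.Ob} {f : C.HomM A B} {g : C.HomE A A'} {g' : C.HomE B B'}
    {f' : C.HomM A' B'} (s : C.Sq f g g' f'), GoodSq goodM (kerι g) (kerMap s) f' (kerι g')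
  kerMap_hid : ∀ {A A' : C.Ob} (g : C.HomE A A'), kerMap (C.hid g) = C.idM (ker g)
  kerMap_hcomp : ∀ {A₀ A₁ A₂ B₀ B₁ B₂ : C.Ob} {f₁ : C.HomM A₀ A₁} {f₂ : C.HomM A₁ A₂}
    {g₀ : C.HomE A₀ B₀} {g₁ : C.HomE A₁ B₁} {g₂ : C.HomE A₂ B₂}
    {k₁ : C.HomM B₀ B₁} {k₂ : C.HomM B₁ B₂} (s : C.Sq f₁ g₀ g₁ k₁) (t : C.Sq f₂ g₁ g₂ k₂),
    kerMap (C.hcomp s t) = kerMap s ≫ kerMap t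
  cok : ∀ {A B : C.Ob}, C.HomM A B → C.Ob
  cokπ : ∀ {A B : C.Ob} (f : C.HomM A B), C.HomE (cok f) B
  cokMap : ∀ {A B A' B' : C.Ob} {f : C.HomM A B} {g : C.HomE A A'} {g' : C.HomE B B'}
    {f' : C.HomM A' B'}, C.Sq f g g' f' → C.HomE (cok f) (cok f')
  cokMap_good : ∀ {A B A' B' : C.Ob} {f : C.HomM A B} {g : C.HomE A A'} {g' : C.HomE B B'}
    {f' : C.HomM A' B'} (s : C.Sq f g g' f'), GoodSq goodE (cokπ f) (cokMap s) g' (cokπ f')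
  cokMap_vid : ∀ {A B : C.Ob} (f : C.HomM A B), cokMap (C.vid f) = C.idE (cok f)
  cokMap_vcomp : ∀ {A₀ A₁ B₀ B₁ C₀ C₁ : C.Ob} {f : C.HomM A₀ A₁} {k : C.HomM B₀ B₁}
    {l : C.HomM C₀ C₁} {g₀ : C.HomE A₀ B₀} {g₁ : C.HomE A₁ B₁} {h₀ : C.HomE B₀ C₀}
    {h₁ : C.HomE B₁ C₁} (s : C.Sq f g₀ g₁ k) (t : C.Sq k h₀ h₁ l),
    cokMap (C.vcomp s t) = cokMap s ≫ cokMap t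

namespace KerCok

variable {C : DoubleCategory.{u, v, w}}

instance (K : KerCok C) : K.goodM.IsMultiplicative := K.mulM
instance (K : KerCok C) : K.goodE.IsMultiplicative := K.mulE

/-- The functor `k : Ar_↺ ℰ ⥤ Ar_g ℳ`. -/
def kerFunctor (K : KerCok C) : C.ArE ⥤ WideSubcategory K.goodM where
  obj g := ⟨Arrow.mk (K.kerι g.hom)⟩
  map s := ⟨Arrow.homMk (K.kerMap s.sq) s.bot (K.kerMap_good s.sq).1, (K.kerMap_good s.sq).2⟩
  map_id g := by
    apply WideSubcategory.hom_ext
    ext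
    · exact K.kerMap_hid g.hom
    · rfl
  map_comp s t := by
    apply WideSubcategory.hom_ext
    ext
    · exact K.kerMap_hcomp s.sq t.sq
    · rfl

/-- The functor `c : Ar_↺ ℳ ⥤ Ar_g ℰ`. -/
def cokFunctor (K : KerCok C) : C.ArM ⥤ WideSubcategory K.goodE where
  obj f := ⟨Arrow.mk (K.cokπ f.hom)⟩
  map s := ⟨Arrow.homMk (K.cokMap s.sq) s.right (K.cokMap_good s.sq).1, (K.cokMap_good s.sq).2⟩
  map_id f := by
    apply WideSubcategory.hom_ext
    ext
    · exact K.cokMap_vid f.hom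
    · rfl
  map_comp s t := by
    apply WideSubcategory.hom_ext
    ext
    · exact K.cokMap_vcomp s.sq t.sq
    · rfl

/-- A distinguished square: `k` sends it into `Ar_△ ℳ`. -/
def Distinguished (K : KerCok C) {A B A' B' : C.Ob} {f : C.HomM A B} {g : C.HomE A A'}
    {g' : C.HomE B B'} {f' : C.HomM A' B'} (s : C.Sq f g g' f') : Prop :=
  IsIso (K.kerMap s)

end KerCok

/-- The structure of a g-CGW category on a double category. -/
structure GCGW (C : DoubleCategory.{u, v, w}) extends SharedIsos C, KerCok C where
  kerFunctor_isEquivalence : toKerCok.kerFunctor.IsEquivalence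
  cokFunctor_isEquivalence : toKerCok.cokFunctor.IsEquivalence
  /-- (Z) the object `∅`, initial in both `ℳ` and `ℰ`. -/
  zero : C.Ob
  zeroM : IsInitial (C.obM zero)
  zeroE : IsInitial (C.obE zero)
  /-- (M) -/
  monoM : ∀ {A B : C.Ob} (f : C.HomM A B), Mono f
  monoE : ∀ {A B : C.Ob} (g : C.HomE A B), Mono g
  /-- (G), first inclusions: weak triangles are good. -/
  triangleM : ∀ {f f' : Arrow C.M} (s : f ⟶ f'), IsIso s.left → goodM s
  triangleE : ∀ {g g' : Arrow C.E} (s : g ⟶ g'), IsIso s.left → goodE s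
  /-- (G), second inclusions: good squares are pullbacks. -/
  pullbackM : ∀ {f f' : Arrow C.M} (s : f ⟶ f'), goodM s →
    IsPullback s.left f.hom f'.hom s.right
  pullbackE : ∀ {g g' : Arrow C.E} (s : g ⟶ g'), goodE s →
    IsPullback s.left g.hom g'.hom s.right
  /-- (D) -/
  isIso_kerMap_iff : ∀ {A B A' B' : C.Ob} {f : C.HomM A B} {g : C.HomE A A'} {g' : C.HomE B B'}
    {f' : C.HomM A' B'} (s : C.Sq f g g' f'), IsIso (kerMap s) ↔ IsIso (cokMap s)
  /-- (K) -/
  exists_cok_sq : ∀ {A B : C.Ob} (f : C.HomM A B),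
    ∃ s : C.Sq (zeroM.to (cok f)) (zeroE.to A) (cokπ f) f, toKerCok.Distinguished s
  exists_ker_sq : ∀ {A B : C.Ob} (g : C.HomE A B),
    ∃ s : C.Sq (zeroM.to A) (zeroE.to (ker g)) g (kerι g), toKerCok.Distinguished s

/-- In a g-CGW category there is at most one pseudo-commutative square with a given boundary. -/
theorem GCGW.subsingleton_sq {C : DoubleCategory.{u, v, w}} (S : GCGW C) {A B A' B' : C.Ob}
    (f : C.HomM A B) (g : C.HomE A A') (g' : C.HomE B B') (f' : C.HomM A' B') :
    Subsingleton (C.Sq f g g' f') := by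
  constructor
  intro s t
  have := S.kerFunctor_isEquivalence
  have := S.monoM (S.kerι g')
  have h : S.kerMap s = S.kerMap t := by
    rw [← cancel_mono (S.kerι g'), (S.kerMap_good s).1, (S.kerMap_good t).1]
  let s' : (⟨g⟩ : C.ArE) ⟶ ⟨g'⟩ := ⟨f, f', s⟩
  let t' : (⟨g⟩ : C.ArE) ⟶ ⟨g'⟩ := ⟨f, f', t⟩
  have e : s' = t' := by
    apply S.kerFunctor.map_injective
    apply WideSubcategory.hom_ext
    ext
    · exact h
    · rfl
  exact eq_of_heq (DoubleCategory.ArE.Hom.ext_iff.1 e).2.2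

/-- A kernel-cokernel pair `A ↣ B ↢ Z`: an m-morphism `f` and an e-morphism `g` that
fit in a distinguished square with upper left corner `∅`. -/
def GCGW.IsKerCokPair {C : DoubleCategory.{u, v, w}} (S : GCGW C) {A B Z : C.Ob}
    (f : C.HomM A B) (g : C.HomE Z B) : Prop :=
  ∃ s : C.Sq (S.zeroM.to Z) (S.zeroE.to A) g f, S.Distinguished s

/-! ## ⋆-CGW and ECGW categories -/

/-- The structure of a ⋆-CGW category on a double category. -/
structure StarCGW (C : DoubleCategory.{u, v, w}) extends GCGW C where
  /-- (GS) -/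
  good_symmM : ∀ {A B X Y : C.Ob} (f : C.HomM A B) (g : C.HomM A X) (h : C.HomM B Y)
    (k : C.HomM X Y), GoodSq goodM f g h k ↔ GoodSq goodM g f k h
  good_symmE : ∀ {A B X Y : C.Ob} (f : C.HomE A B) (g : C.HomE A X) (h : C.HomE B Y)
    (k : C.HomE X Y), GoodSq goodE f g h k ↔ GoodSq goodE g f k h
  /-- (⋆) for m-morphisms: existence of the initial good square. -/
  exists_starM : ∀ {A B X Y : C.Ob} (f : C.HomM A B) (g : C.HomM A X) (h : C.HomM B Y)
    (k : C.HomM X Y), GoodSq goodM f g h k →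
    ∃ (P : C.Ob) (i : C.HomM B P) (j : C.HomM X P), IsStarPushout goodM f g i j
  /-- (⋆) for m-morphisms: the induced maps `B / A ⟶ (B ⋆_A X) / X` and
  `X / A ⟶ (B ⋆_A X) / B` are isomorphisms. -/
  starM_cok : ∀ {A B X P : C.Ob} (f : C.HomM A B) (g : C.HomM A X) (i : C.HomM B P)
    (j : C.HomM X P), IsStarPushout goodM f g i j →
    (∃ m : C.HomM (cok f) (cok j), IsIso m ∧ Nonempty (C.Sq m (cokπ f) (cokπ j) i)) ∧
    (∃ m : C.HomM (cok g) (cok i), IsIso m ∧ Nonempty (C.Sq m (cokπ g) (cokπ i) j))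
  /-- (⋆) for e-morphisms: existence of the initial good square. -/
  exists_starE : ∀ {A B X Y : C.Ob} (f : C.HomE A B) (g : C.HomE A X) (h : C.HomE B Y)
    (k : C.HomE X Y), GoodSq goodE f g h k →
    ∃ (P : C.Ob) (i : C.HomE B P) (j : C.HomE X P), IsStarPushout goodE f g i j
  /-- (⋆) for e-morphisms: the induced maps on kernels are isomorphisms. -/
  starE_ker : ∀ {A B X P : C.Ob} (f : C.HomE A B) (g : C.HomE A X) (i : C.HomE B P)
    (j : C.HomE X P), IsStarPushout goodE f g i j →
    (∃ e : C.HomE (ker f) (ker j), IsIso e ∧ Nonempty (C.Sq (kerι f) e i (kerι j))) ∧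
    (∃ e : C.HomE (ker g) (ker i), IsIso e ∧ Nonempty (C.Sq (kerι g) e j (kerι i)))
  /-- (PO), for m-morphisms only. -/
  exists_good : ∀ {A B X : C.Ob} (f : C.HomM A B) (g : C.HomM A X),
    ∃ (Y : C.Ob) (h : C.HomM B Y) (k : C.HomM X Y), GoodSq goodM f g h k
  /-- (PBL) in the m-direction. -/
  pblM : ∀ {A₀ A₁ A₂ B₀ B₁ B₂ : C.Ob} (f₁ : C.HomM A₀ A₁) (f₂ : C.HomM A₁ A₂)
    (g₀ : C.HomE A₀ B₀) (g₁ : C.HomE A₁ B₁) (g₂ : C.HomE A₂ B₂)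
    (k₁ : C.HomM B₀ B₁) (k₂ : C.HomM B₁ B₂), Nonempty (C.Sq f₂ g₁ g₂ k₂) →
    Nonempty (C.Sq (f₁ ≫ f₂) g₀ g₂ (k₁ ≫ k₂)) → Nonempty (C.Sq f₁ g₀ g₁ k₁)
  /-- (PBL) in the e-direction. -/
  pblE : ∀ {A₀ A₁ B₀ B₁ C₀ C₁ : C.Ob} (f : C.HomM A₀ A₁) (k : C.HomM B₀ B₁)
    (l : C.HomM C₀ C₁) (g₀ : C.HomE A₀ B₀) (g₁ : C.HomE A₁ B₁) (h₀ : C.HomE B₀ C₀)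
    (h₁ : C.HomE B₁ C₁), Nonempty (C.Sq k h₀ h₁ l) →
    Nonempty (C.Sq f (g₀ ≫ h₀) (g₁ ≫ h₁) l) → Nonempty (C.Sq f g₀ g₁ k)
  /-- (POL) for m-morphisms. -/
  polM : ∀ {A B X P D Y : C.Ob} (f : C.HomM A B) (g : C.HomM A X) (i : C.HomM B P)
    (j : C.HomM X P) (p : C.HomM B D) (q : C.HomM D Y) (r : C.HomM P Y),
    IsStarPushout goodM f g i j → p ≫ q = i ≫ r →
    GoodSq goodM (f ≫ p) g q (j ≫ r) → GoodSq goodM p i q r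
  /-- (POL) for e-morphisms. -/
  polE : ∀ {A B X P D Y : C.Ob} (f : C.HomE A B) (g : C.HomE A X) (i : C.HomE B P)
    (j : C.HomE X P) (p : C.HomE B D) (q : C.HomE D Y) (r : C.HomE P Y),
    IsStarPushout goodE f g i j → p ≫ q = i ≫ r →
    GoodSq goodE (f ≫ p) g q (j ≫ r) → GoodSq goodE p i q r

/-- The structure of an ECGW category on a double category: a ⋆-CGW structure together with
an acyclicity structure. -/
structure ECGW (C : DoubleCategory.{u, v, w}) extends StarCGW C where
  acyclic : C.Ob → Prop
  /-- (IA) -/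
  acyclic_of_isInitial : ∀ A : C.Ob, Nonempty (IsInitial (C.obM A)) → acyclic A
  /-- (A23) -/
  acyclic_mid : ∀ {A B Z : C.Ob} (f : C.HomM A B) (g : C.HomE Z B),
    toGCGW.IsKerCokPair f g → acyclic A → acyclic Z → acyclic B
  acyclic_ker : ∀ {A B Z : C.Ob} (f : C.HomM A B) (g : C.HomE Z B),
    toGCGW.IsKerCokPair f g → acyclic B → acyclic Z → acyclic A
  acyclic_cok : ∀ {A B Z : C.Ob} (f : C.HomM A B) (g : C.HomE Z B),
    toGCGW.IsKerCokPair f g → acyclic A → acyclic B → acyclic Z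

/-- The ⋆-CGW structure `U` on the full double subcategory of `X` on the objects satisfying `P` is
inherited from the ⋆-CGW structure `T` on `X`, i.e. the full double subcategory
with `U` is a ⋆-CGW subcategory of `X`. -/
structure StarCGW.InheritedFrom {X : DoubleCategory.{u, v, w}} {P : X.Ob → Prop}
    (U : StarCGW (X.fullSub P)) (T : StarCGW X) : Prop where
  iso : ∀ {A B : (X.fullSub P).Ob} (f : (X.fullSub P).obM A ≅ (X.fullSub P).obM B),
    (X.inclE P).mapIso (U.toE f) = T.toE ((X.inclM P).mapIso f)
  goodM : ∀ {f f' : Arrow (X.fullSub P).M} (s : f ⟶ f'),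
    U.goodM s ↔ T.goodM ((X.inclM P).mapArrow.map s)
  goodE : ∀ {g g' : Arrow (X.fullSub P).E} (s : g ⟶ g'),
    U.goodE s ↔ T.goodE ((X.inclE P).mapArrow.map s)
  ker : ∀ {A B : (X.fullSub P).Ob} (g : (X.fullSub P).HomE A B),
    Arrow.mk ((X.inclM P).map (U.kerι g)) = Arrow.mk (T.kerι ((X.inclE P).map g))
  cok : ∀ {A B : (X.fullSub P).Ob} (f : (X.fullSub P).HomM A B),
    Arrow.mk ((X.inclE P).map (U.cokπ f)) = Arrow.mk (T.cokπ ((X.inclM P).map f))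
  zero : (X.inclM P).obj U.zero = T.zero
  starM : ∀ {A B Y D : (X.fullSub P).Ob} (f : (X.fullSub P).HomM A B)
    (g : (X.fullSub P).HomM A Y) (i : (X.fullSub P).HomM B D) (j : (X.fullSub P).HomM Y D),
    IsStarPushout U.goodM f g i j ↔ IsStarPushout T.goodM ((X.inclM P).map f)
      ((X.inclM P).map g) ((X.inclM P).map i) ((X.inclM P).map j)
  starE : ∀ {A B Y D : (X.fullSub P).Ob} (f : (X.fullSub P).HomE A B)
    (g : (X.fullSub P).HomE A Y) (i : (X.fullSub P).HomE B D) (j : (X.fullSub P).HomE Y D),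
    IsStarPushout U.goodE f g i j ↔ IsStarPushout T.goodE ((X.inclE P).map f)
      ((X.inclE P).map g) ((X.inclE P).map i) ((X.inclE P).map j)

/-! ## Double functors and the functor double category -/

/-- Double functors. -/
structure DoubleFunctor (D : DoubleCategory.{u', v', w'}) (C : DoubleCategory.{u, v, w}) where
  obj : D.Ob → C.Ob
  mapM : ∀ {a b : D.Ob}, D.HomM a b → C.HomM (obj a) (obj b)
  mapE : ∀ {a b : D.Ob}, D.HomE a b → C.HomE (obj a) (obj b)
  mapM_id : ∀ a : D.Ob, mapM (D.idM a) = C.idM (obj a)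
  mapM_comp : ∀ {a b c : D.Ob} (f : D.HomM a b) (f' : D.HomM b c),
    mapM (f ≫ f') = mapM f ≫ mapM f'
  mapE_id : ∀ a : D.Ob, mapE (D.idE a) = C.idE (obj a)
  mapE_comp : ∀ {a b c : D.Ob} (g : D.HomE a b) (g' : D.HomE b c),
    mapE (g ≫ g') = mapE g ≫ mapE g'
  mapSq : ∀ {a b a' b' : D.Ob} {f : D.HomM a b} {g : D.HomE a a'} {g' : D.HomE b b'}
    {f' : D.HomM a' b'}, D.Sq f g g' f' → C.Sq (mapM f) (mapE g) (mapE g') (mapM f')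
  mapSq_hid : ∀ {a a' : D.Ob} (g : D.HomE a a'), HEq (mapSq (D.hid g)) (C.hid (mapE g))
  mapSq_vid : ∀ {a b : D.Ob} (f : D.HomM a b), HEq (mapSq (D.vid f)) (C.vid (mapM f))
  mapSq_hcomp : ∀ {a₀ a₁ a₂ b₀ b₁ b₂ : D.Ob} {f₁ : D.HomM a₀ a₁} {f₂ : D.HomM a₁ a₂}
    {g₀ : D.HomE a₀ b₀} {g₁ : D.HomE a₁ b₁} {g₂ : D.HomE a₂ b₂}
    {k₁ : D.HomM b₀ b₁} {k₂ : D.HomM b₁ b₂} (s : D.Sq f₁ g₀ g₁ k₁) (t : D.Sq f₂ g₁ g₂ k₂),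
    HEq (mapSq (D.hcomp s t)) (C.hcomp (mapSq s) (mapSq t))
  mapSq_vcomp : ∀ {a₀ a₁ b₀ b₁ c₀ c₁ : D.Ob} {f : D.HomM a₀ a₁} {k : D.HomM b₀ b₁}
    {l : D.HomM c₀ c₁} {g₀ : D.HomE a₀ b₀} {g₁ : D.HomE a₁ b₁} {h₀ : D.HomE b₀ c₀}
    {h₁ : D.HomE b₁ c₁} (s : D.Sq f g₀ g₁ k) (t : D.Sq k h₀ h₁ l),
    HEq (mapSq (D.vcomp s t)) (C.vcomp (mapSq s) (mapSq t))

section FunctorDouble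

variable {D : DoubleCategory.{u', v', w'}} {C : DoubleCategory.{u, v, w}}

/-- Good m-natural transformations: m-natural transformations whose naturality squares of
m-morphisms are good (in particular, commute). -/
structure MNat (S : StarCGW C) (F G : DoubleFunctor D C) where
  app : ∀ a : D.Ob, C.HomM (F.obj a) (G.obj a)
  sq : ∀ {a b : D.Ob} (g : D.HomE a b), C.Sq (app a) (F.mapE g) (G.mapE g) (app b)
  good : ∀ {a b : D.Ob} (f : D.HomM a b),
    GoodSq S.goodM (F.mapM f) (app a) (app b) (G.mapM f)
  sq_id : ∀ a : D.Ob, HEq (sq (D.idE a)) (C.vid (app a))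
  sq_comp : ∀ {a b c : D.Ob} (g : D.HomE a b) (h : D.HomE b c),
    HEq (sq (g ≫ h)) (C.vcomp (sq g) (sq h))
  sq_natural : ∀ {a b a' b' : D.Ob} {f : D.HomM a b} {g : D.HomE a a'} {g' : D.HomE b b'}
    {f' : D.HomM a' b'} (s : D.Sq f g g' f'),
    HEq (C.hcomp (F.mapSq s) (sq g')) (C.hcomp (sq g) (G.mapSq s))

/-- Good e-natural transformations: e-natural transformations whose naturality squares of
e-morphisms are good (in particular, commute). -/
structure ENat (S : StarCGW C) (F G : DoubleFunctor D C) where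
  app : ∀ a : D.Ob, C.HomE (F.obj a) (G.obj a)
  sq : ∀ {a b : D.Ob} (f : D.HomM a b), C.Sq (F.mapM f) (app a) (app b) (G.mapM f)
  good : ∀ {a b : D.Ob} (g : D.HomE a b),
    GoodSq S.goodE (F.mapE g) (app a) (app b) (G.mapE g)
  sq_id : ∀ a : D.Ob, HEq (sq (D.idM a)) (C.hid (app a))
  sq_comp : ∀ {a b c : D.Ob} (f : D.HomM a b) (f' : D.HomM b c),
    HEq (sq (f ≫ f')) (C.hcomp (sq f) (sq f'))
  sq_natural : ∀ {a b a' b' : D.Ob} {f : D.HomM a b} {g : D.HomE a a'} {g' : D.HomE b b'}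
    {f' : D.HomM a' b'} (s : D.Sq f g g' f'),
    HEq (C.vcomp (F.mapSq s) (sq f')) (C.vcomp (sq f) (G.mapSq s))

theorem StarCGW.heq (S : StarCGW C) {A B A' B' : C.Ob} {f f₁ : C.HomM A B}
    {g g₁ : C.HomE A A'} {g' g₁' : C.HomE B B'} {f' f₁' : C.HomM A' B'}
    (hf : f = f₁) (hg : g = g₁) (hg' : g' = g₁') (hf' : f' = f₁')
    (s : C.Sq f g g' f') (t : C.Sq f₁ g₁ g₁' f₁') : HEq s t :=
  DoubleCategory.heq_of_subsingleton (Sq := C.Sq) (fun f g g' f' => S.subsingleton_sq f g g' f')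
    hf hg hg' hf' s t

variable {S : StarCGW C} {F G H : DoubleFunctor D C}

theorem MNat.ext' {μ ν : MNat S F G} (h : ∀ a, μ.app a = ν.app a) : μ = ν := by
  obtain ⟨p, s, _, _, _, _⟩ := μ
  obtain ⟨q, t, _, _, _, _⟩ := ν
  obtain rfl : p = q := funext h
  have : @s = @t := by
    funext a b g
    exact (S.subsingleton_sq _ _ _ _).elim _ _
  subst this
  rfl

theorem ENat.ext' {μ ν : ENat S F G} (h : ∀ a, μ.app a = ν.app a) : μ = ν := by
  obtain ⟨p, s, _, _, _, _⟩ := μ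
  obtain ⟨q, t, _, _, _, _⟩ := ν
  obtain rfl : p = q := funext h
  have : @s = @t := by
    funext a b g
    exact (S.subsingleton_sq _ _ _ _).elim _ _
  subst this
  rfl

/-- The identity m-natural transformation. -/
def MNat.id (S : StarCGW C) (F : DoubleFunctor D C) : MNat S F F where
  app a := C.idM (F.obj a)
  sq g := C.hid (F.mapE g)
  good f := GoodSq.id S.mulM _
  sq_id a := S.heq rfl (F.mapE_id a) (F.mapE_id a) rfl _ _
  sq_comp g h := S.heq (by simp) (F.mapE_comp g h) (F.mapE_comp g h) (by simp) _ _
  sq_natural s := S.heq (by simp) rfl rfl (by simp) _ _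

/-- Composition of m-natural transformations. -/
def MNat.comp (μ : MNat S F G) (ν : MNat S G H) : MNat S F H where
  app a := μ.app a ≫ ν.app a
  sq g := C.hcomp (μ.sq g) (ν.sq g)
  good f := GoodSq.comp S.mulM (μ.good f) (ν.good f)
  sq_id a := S.heq rfl (F.mapE_id a) (H.mapE_id a) rfl _ _
  sq_comp g h := S.heq rfl (F.mapE_comp g h) (H.mapE_comp g h) rfl _ _
  sq_natural {_ _ _ _ f _ _ f'} _ :=
    S.heq (GoodSq.comp S.mulM (μ.good f) (ν.good f)).1.symm rfl rfl
      (GoodSq.comp S.mulM (μ.good f') (ν.good f')).1.symm _ _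

/-- The identity e-natural transformation. -/
def ENat.id (S : StarCGW C) (F : DoubleFunctor D C) : ENat S F F where
  app a := C.idE (F.obj a)
  sq f := C.vid (F.mapM f)
  good f := GoodSq.id S.mulE _
  sq_id a := S.heq (F.mapM_id a) rfl rfl (F.mapM_id a) _ _
  sq_comp g h := S.heq (F.mapM_comp g h) (by simp) (by simp) (F.mapM_comp g h) _ _
  sq_natural s := S.heq rfl (by simp) (by simp) rfl _ _

/-- Composition of e-natural transformations. -/
def ENat.comp (μ : ENat S F G) (ν : ENat S G H) : ENat S F H where
  app a := μ.app a ≫ ν.app a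
  sq f := C.vcomp (μ.sq f) (ν.sq f)
  good f := GoodSq.comp S.mulE (μ.good f) (ν.good f)
  sq_id a := S.heq (F.mapM_id a) rfl rfl (H.mapM_id a) _ _
  sq_comp g h := S.heq (F.mapM_comp g h) rfl rfl (H.mapM_comp g h) _ _
  sq_natural {_ _ _ _ _ g g' _} _ :=
    S.heq rfl (GoodSq.comp S.mulE (μ.good g) (ν.good g)).1.symm
      (GoodSq.comp S.mulE (μ.good g') (ν.good g')).1.symm rfl _ _

/-- The double functors `D ⥤ C`, with the good m- and e-natural transformations. -/
def functorPair (S : StarCGW C) (D : DoubleCategory.{u', v', w'}) :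
    PairOfCategories where
  Ob := DoubleFunctor D C
  catM :=
    { Hom := MNat S
      id := MNat.id S
      comp := MNat.comp
      id_comp := fun _ => MNat.ext' fun _ => Category.id_comp _
      comp_id := fun _ => MNat.ext' fun _ => Category.comp_id _
      assoc := fun _ _ _ => MNat.ext' fun _ => Category.assoc _ _ _ }
  catE :=
    { Hom := ENat S
      id := ENat.id S
      comp := ENat.comp
      id_comp := fun _ => ENat.ext' fun _ => Category.id_comp _
      comp_id := fun _ => ENat.ext' fun _ => Category.comp_id _
      assoc := fun _ _ _ => ENat.ext' fun _ => Category.assoc _ _ _ }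

/-- Modifications. -/
@[ext]
structure Modif (S : StarCGW C) {F G F' G' : DoubleFunctor D C} (μ : MNat S F G)
    (η : ENat S F F') (η' : ENat S G G') (μ' : MNat S F' G') where
  app : ∀ a : D.Ob, C.Sq (μ.app a) (η.app a) (η'.app a) (μ'.app a)
  coh_horiz : ∀ {a b : D.Ob} (f : D.HomM a b),
    HEq (C.hcomp (η.sq f) (app b)) (C.hcomp (app a) (η'.sq f))
  coh_vert : ∀ {a b : D.Ob} (g : D.HomE a b),
    HEq (C.vcomp (μ.sq g) (app b)) (C.vcomp (app a) (μ'.sq g))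

/-- The coherence conditions of a modification hold automatically, as squares are unique. -/
def Modif.mk' {F G F' G' : DoubleFunctor D C} {μ : MNat S F G}
    {η : ENat S F F'} {η' : ENat S G G'} {μ' : MNat S F' G'}
    (app : ∀ a : D.Ob, C.Sq (μ.app a) (η.app a) (η'.app a) (μ'.app a)) : Modif S μ η η' μ' where
  app := app
  coh_horiz f := S.heq (μ.good f).1.symm rfl rfl (μ'.good f).1.symm _ _
  coh_vert g := S.heq rfl (η.good g).1.symm (η'.good g).1.symm rfl _ _

end FunctorDouble

/-- The double category `C^D` of double functors `D ⥤ C`, good m-natural transformations,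
good e-natural transformations, and modifications. -/
def functorDouble {C : DoubleCategory.{u, v, w}} (S : StarCGW C)
    (D : DoubleCategory.{u', v', w'}) : DoubleCategory :=
  DoubleCategory.ofSubsingleton (functorPair S D)
    (fun {F G F' G'} (μ : MNat S F G) (η : ENat S F F') (η' : ENat S G G') (μ' : MNat S F' G') =>
      Modif S μ η η' μ')
    (fun _ _ _ _ => ⟨fun _ _ => Modif.ext (funext fun _ => (S.subsingleton_sq _ _ _ _).elim _ _)⟩)
    (fun g => Modif.mk' fun a => C.hid (ENat.app g a))
    (fun f => Modif.mk' fun a => C.vid (MNat.app f a))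
    (fun s t => Modif.mk' fun a => C.hcomp (Modif.app s a) (Modif.app t a))
    (fun s t => Modif.mk' fun a => C.vcomp (Modif.app s a) (Modif.app t a))

/-- The ⋆-CGW structure `T` on `C^D` is the standard one: the good squares are the
commuting squares of natural transformations whose component cubes are good, and `k`, `c` and `⋆`
are computed pointwise. -/
structure IsPointwise {C : DoubleCategory.{u, v, w}} {S : StarCGW C}
    {D : DoubleCategory.{u', v', w'}} (T : StarCGW (functorDouble S D)) : Prop where
  goodM : ∀ {F G F' G' : DoubleFunctor D C} (μ : (functorDouble S D).HomM F G)
    (α : (functorDouble S D).HomM F F') (β : (functorDouble S D).HomM G G')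
    (μ' : (functorDouble S D).HomM F' G'),
    GoodSq T.goodM μ α β μ' ↔ α ≫ μ' = μ ≫ β ∧ ∀ {a b : D.Ob} (f : D.HomM a b),
      IsGoodCube S.goodM (μ.app a) (α.app a) (β.app a) (μ'.app a)
        (μ.app b) (α.app b) (β.app b) (μ'.app b)
        (F.mapM f) (G.mapM f) (F'.mapM f) (G'.mapM f)
  goodE : ∀ {F G F' G' : DoubleFunctor D C} (μ : (functorDouble S D).HomE F G)
    (α : (functorDouble S D).HomE F F') (β : (functorDouble S D).HomE G G')
    (μ' : (functorDouble S D).HomE F' G'),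
    GoodSq T.goodE μ α β μ' ↔ α ≫ μ' = μ ≫ β ∧ ∀ {a b : D.Ob} (g : D.HomE a b),
      IsGoodCube S.goodE (μ.app a) (α.app a) (β.app a) (μ'.app a)
        (μ.app b) (α.app b) (β.app b) (μ'.app b)
        (F.mapE g) (G.mapE g) (F'.mapE g) (G'.mapE g)
  ker : ∀ {F G : DoubleFunctor D C} (η : (functorDouble S D).HomE F G) (a : D.Ob),
    Arrow.mk (MNat.app (T.kerι η) a) = Arrow.mk (S.kerι (η.app a))
  cok : ∀ {F G : DoubleFunctor D C} (μ : (functorDouble S D).HomM F G) (a : D.Ob),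
    Arrow.mk (ENat.app (T.cokπ μ) a) = Arrow.mk (S.cokπ (μ.app a))
  starM : ∀ {F G H P : DoubleFunctor D C} (μ : (functorDouble S D).HomM F G)
    (ν : (functorDouble S D).HomM F H) (i : (functorDouble S D).HomM G P)
    (j : (functorDouble S D).HomM H P), IsStarPushout T.goodM μ ν i j →
    ∀ a : D.Ob, IsStarPushout S.goodM (μ.app a) (ν.app a) (i.app a) (j.app a)
  starE : ∀ {F G H P : DoubleFunctor D C} (μ : (functorDouble S D).HomE F G)
    (ν : (functorDouble S D).HomE F H) (i : (functorDouble S D).HomE G P)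
    (j : (functorDouble S D).HomE H P), IsStarPushout T.goodE μ ν i j →
    ∀ a : D.Ob, IsStarPushout S.goodE (μ.app a) (ν.app a) (i.app a) (j.app a)

/-! ## The staircases -/

/-- The double category generated by the staircase with objects `A_{i,j}`, `i ≤ j ≤ n`,
m-morphisms `A_{i,j} ⟶ A_{i,j+1}`, e-morphisms `A_{i+1,j} ⟶ A_{i,j}` and the evident squares.
In the generated double category there is a unique m-morphism `A_{i,j} ⟶ A_{i,j'}` for `j ≤ j'`,
a unique e-morphism `A_{i',j} ⟶ A_{i,j}` for `i ≤ i'`, there are no other morphisms, and each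
boundary has a unique square. -/
def staircase (n : ℕ) : DoubleCategory.{0, 0, 0} :=
  DoubleCategory.ofSubsingleton
    { Ob := {p : Fin (n + 1) × Fin (n + 1) // p.1 ≤ p.2}
      catM :=
        { Hom := fun p q => PLift (p.1.1 = q.1.1 ∧ p.1.2 ≤ q.1.2)
          id := fun _ => ⟨rfl, le_rfl⟩
          comp := fun f g => ⟨f.down.1.trans g.down.1, f.down.2.trans g.down.2⟩ }
      catE :=
        { Hom := fun p q => PLift (q.1.1 ≤ p.1.1 ∧ p.1.2 = q.1.2)
          id := fun _ => ⟨le_rfl, rfl⟩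
          comp := fun f g => ⟨g.down.1.trans f.down.1, f.down.2.trans g.down.2⟩ } }
    (fun _ _ _ _ => PUnit)
    (fun _ _ _ _ => inferInstance)
    (fun _ => PUnit.unit) (fun _ => PUnit.unit) (fun _ _ => PUnit.unit) (fun _ _ => PUnit.unit)

/-- The diagonal object `A_{i,i}`. -/
def staircase.diag {n : ℕ} (i : Fin (n + 1)) : (staircase n).Ob :=
  (⟨(i, i), le_rfl⟩ : {p : Fin (n + 1) × Fin (n + 1) // p.1 ≤ p.2})

/-- A double functor from the staircase to `C` belongs to `S_n C` if it sends the
diagonal objects to initial objects and all squares to distinguished squares. -/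
def IsStaircase {C : DoubleCategory.{u, v, w}} (S : StarCGW C) (n : ℕ)
    (F : (functorDouble S (staircase n)).Ob) : Prop :=
  (∀ i : Fin (n + 1), Nonempty (IsInitial (C.obM (DoubleFunctor.obj F (staircase.diag i))))) ∧
  ∀ {a b a' b' : (staircase n).Ob} {f : (staircase n).HomM a b} {g : (staircase n).HomE a a'}
    {g' : (staircase n).HomE b b'} {f' : (staircase n).HomM a' b'}
    (s : (staircase n).Sq f g g' f'), S.Distinguished (DoubleFunctor.mapSq F s)

/-- `S_n C`, the full double subcategory of `C^{𝒮_n}` on the staircases. -/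
def sDot {C : DoubleCategory.{u, v, w}} (S : StarCGW C) (n : ℕ) : DoubleCategory :=
  (functorDouble S (staircase n)).fullSub (IsStaircase S n)

end CGW

/-! An m-morphism is read as a subobject, an e-morphism `Z ⟶ B` as a quotient `Z` of `B`, and
`ShortExact f g` says that `f` is a kernel of `g`. All axioms except (PO) are symmetric under
exchanging ℳ and ℰ. They are collected in `PreStarCGW`, so that each statement is proved for ℳ only
and its dual is obtained from `PreStarCGW.transpose`.

Since `k` is fully faithful, a commuting square in ℳ is good exactly when it induces a
pseudo-commutative square on cokernels (`ShortExact.exists_sq`, `ShortExact.good_of_sq`). A good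
square is a ⋆-pushout exactly when the induced map of cokernels is invertible
(`ShortExact.star_isIso`, `ShortExact.star_of_isIso`). Together with preimages of subobjects under
quotients, this gives an elementary calculus of subobjects in which `B ⋆_A X` plays the role of a
sum of subobjects.

For part 1 the shape 𝒮_n plays no role: the argument is made for an arbitrary double category `D`.
Two facts carry it. The first is `ShortExact.isGoodCube_iff`: a cube with good faces is good if and
only if the square which it induces on cokernels in one direction is good. Hence the kernels of a
pseudo-commutative square of transformations form good cubes, and conversely good cubes between
kernels come from good m-natural transformations. This is what makes the pointwise `k` and `c` fully
faithful on `C^D`. The second is that the ⋆-pushout is functorial along e-morphisms: a quotient of a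
span induces a quotient of its ⋆-pushout (`exists_quotient_star`), which is unique
(`quotient_star_unique`), has the ⋆-pushout of the kernels as kernel, and is compatible with maps to
an ambient object (`quotient_star_sq`). So pointwise ⋆-pushouts are double functors; their universal
property holds because the condition on the southern square of a good cube is exactly the goodness
of the naturality squares of the induced map.

For part 2 a square is distinguished if and only if its bottom side contains the kernel of its right
side (`isIso_kerMap_iff_exists`). From this, staircases are closed under m- and e-subobjects, and
under the ⋆-pushouts of m-spans. A full double subcategory which is closed under subobjects,
contains `∅`, and contains some good completion of each of its m-spans inherits the whole structure.
Part 3 is then pointwise, because kernel-cokernel pairs of staircases are pointwise kernel-cokernel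
pairs. -/

namespace CGW

/-! ## Transposition -/

/-- The transpose of a double category: the roles of m- and e-morphisms are exchanged. -/
@[reducible]
def DoubleCategory.transpose (C : DoubleCategory.{u, v, w}) : DoubleCategory.{u, v, w} where
  Ob := C.Ob
  catM := C.catE
  catE := C.catM
  Sq f g g' f' := C.Sq g f f' g'
  hid g := C.vid g
  vid f := C.hid f
  hcomp s t := C.vcomp s t
  vcomp s t := C.hcomp s t
  hid_hcomp s := C.vid_vcomp s
  hcomp_hid s := C.vcomp_vid s
  hcomp_assoc s t r := C.vcomp_assoc s t r
  vid_vcomp s := C.hid_hcomp s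
  vcomp_vid s := C.hcomp_hid s
  vcomp_assoc s t r := C.hcomp_assoc s t r
  hid_id A := (C.hid_id A).symm
  hid_comp g h := C.vid_comp g h
  vid_comp f k := C.hid_comp f k
  interchange a b c d := (C.interchange a c b d).symm

namespace SharedIsos

variable {C : DoubleCategory.{u, v, w}} (I : SharedIsos C)

theorem toE_symm_trans {A B D : C.Ob} (f : C.obE A ≅ C.obE B) (f' : C.obE B ≅ C.obE D) :
    I.toE.symm (f ≪≫ f') = I.toE.symm f ≪≫ I.toE.symm f' := by
  apply I.toE.injective
  rw [I.toE_trans]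
  simp

theorem nonempty_sq_vert_iff' {A B A' B' : C.Ob} (g : C.HomM A B) (f : C.obE A ≅ C.obE A')
    (f' : C.obE B ≅ C.obE B') (g' : C.HomM A' B') :
    Nonempty (C.Sq g f.hom f'.hom g') ↔ g ≫ (I.toE.symm f').hom = (I.toE.symm f).hom ≫ g' := by
  simpa using I.nonempty_sq_vert_iff g (I.toE.symm f) (I.toE.symm f') g'

theorem nonempty_sq_horiz_iff' {A B A' B' : C.Ob} (f : C.obE A ≅ C.obE B) (g : C.HomE A A')
    (g' : C.HomE B B') (f' : C.obE A' ≅ C.obE B') :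
    Nonempty (C.Sq (I.toE.symm f).hom g g' (I.toE.symm f').hom) ↔ g ≫ f'.hom = f.hom ≫ g' := by
  simpa using I.nonempty_sq_horiz_iff (I.toE.symm f) g g' (I.toE.symm f')

/-- Compatibility with composition is enough: the image of an identity is an idempotent isomorphism.
-/
theorem toE_refl (A : C.Ob) : I.toE (Iso.refl (C.obM A)) = Iso.refl (C.obE A) := by
  have h := I.toE_trans (Iso.refl (C.obM A)) (Iso.refl (C.obM A))
  rw [Iso.refl_trans] at h
  have h' := congrArg (fun x => (I.toE (Iso.refl (C.obM A))).symm ≪≫ x) h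
  simp only [Iso.symm_self_id, Iso.symm_self_id_assoc] at h'
  exact h'.symm

theorem toE_symm {A B : C.Ob} (f : C.obM A ≅ C.obM B) : I.toE f.symm = (I.toE f).symm := by
  have h := I.toE_trans f.symm f
  rw [Iso.symm_self_id, toE_refl] at h
  have h' := congrArg (fun x => x ≪≫ (I.toE f).symm) h
  simp only [Iso.refl_trans, Iso.trans_assoc, Iso.self_symm_id, Iso.trans_refl] at h'
  exact h'.symm

end SharedIsos

/-- The data and the properties of a ⋆-CGW structure other than the axiom (PO), in a form that is
invariant under transposition. -/
structure PreStarCGW (C : DoubleCategory.{u, v, w}) extends SharedIsos C, KerCok C where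
  sq_subsingleton : ∀ {A B A' B' : C.Ob} (f : C.HomM A B) (g : C.HomE A A') (g' : C.HomE B B')
    (f' : C.HomM A' B'), Subsingleton (C.Sq f g g' f')
  -- This field, `left_unique`, and the two fields `exists_sq_of_goodM` and `exists_sq_of_goodE`
  -- express that `k` and `c` are faithful and full. Essential surjectivity is omitted, as it
  -- follows from (K) and (D) through `ShortExact.dual`.
  top_unique : ∀ {A B A' B' : C.Ob} {f₁ f₂ : C.HomM A B} {g : C.HomE A A'} {g' : C.HomE B B'}
    {f' : C.HomM A' B'}, C.Sq f₁ g g' f' → C.Sq f₂ g g' f' → f₁ = f₂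
  left_unique : ∀ {A B A' B' : C.Ob} {f : C.HomM A B} {g₁ g₂ : C.HomE A A'} {g' : C.HomE B B'}
    {f' : C.HomM A' B'}, C.Sq f g₁ g' f' → C.Sq f g₂ g' f' → g₁ = g₂
  exists_sq_of_goodM : ∀ {A B A' B' : C.Ob} {g : C.HomE A A'} {g' : C.HomE B B'}
    {f' : C.HomM A' B'} {m : C.HomM (ker g) (ker g')}, GoodSq goodM (kerι g) m f' (kerι g') →
    ∃ f, Nonempty (C.Sq f g g' f')
  exists_sq_of_goodE : ∀ {A B A' B' : C.Ob} {f : C.HomM A B} {g' : C.HomE B B'}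
    {f' : C.HomM A' B'} {e : C.HomE (cok f) (cok f')}, GoodSq goodE (cokπ f) e g' (cokπ f') →
    ∃ g, Nonempty (C.Sq f g g' f')
  zero : C.Ob
  zeroM : IsInitial (C.obM zero)
  zeroE : IsInitial (C.obE zero)
  monoM : ∀ {A B : C.Ob} (f : C.HomM A B), Mono f
  monoE : ∀ {A B : C.Ob} (g : C.HomE A B), Mono g
  triangleM : ∀ {A B X Y : C.Ob} {f : C.HomM A B} {g : C.HomM A X} {h : C.HomM B Y}
    {k : C.HomM X Y}, IsIso g → g ≫ k = f ≫ h → GoodSq goodM f g h k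
  triangleE : ∀ {A B X Y : C.Ob} {f : C.HomE A B} {g : C.HomE A X} {h : C.HomE B Y}
    {k : C.HomE X Y}, IsIso g → g ≫ k = f ≫ h → GoodSq goodE f g h k
  pullbackM : ∀ {A B X Y : C.Ob} {f : C.HomM A B} {g : C.HomM A X} {h : C.HomM B Y}
    {k : C.HomM X Y}, GoodSq goodM f g h k → IsPullback g f k h
  pullbackE : ∀ {A B X Y : C.Ob} {f : C.HomE A B} {g : C.HomE A X} {h : C.HomE B Y}
    {k : C.HomE X Y}, GoodSq goodE f g h k → IsPullback g f k h
  isIso_kerMap_iff : ∀ {A B A' B' : C.Ob} {f : C.HomM A B} {g : C.HomE A A'} {g' : C.HomE B B'}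
    {f' : C.HomM A' B'} (s : C.Sq f g g' f'), IsIso (kerMap s) ↔ IsIso (cokMap s)
  exists_cok_sq : ∀ {A B : C.Ob} (f : C.HomM A B),
    ∃ s : C.Sq (zeroM.to (cok f)) (zeroE.to A) (cokπ f) f, IsIso (kerMap s)
  exists_ker_sq : ∀ {A B : C.Ob} (g : C.HomE A B),
    ∃ s : C.Sq (zeroM.to A) (zeroE.to (ker g)) g (kerι g), IsIso (kerMap s)
  good_symmM : ∀ {A B X Y : C.Ob} {f : C.HomM A B} {g : C.HomM A X} {h : C.HomM B Y}
    {k : C.HomM X Y}, GoodSq goodM f g h k → GoodSq goodM g f k h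
  good_symmE : ∀ {A B X Y : C.Ob} {f : C.HomE A B} {g : C.HomE A X} {h : C.HomE B Y}
    {k : C.HomE X Y}, GoodSq goodE f g h k → GoodSq goodE g f k h
  exists_starM : ∀ {A B X Y : C.Ob} {f : C.HomM A B} {g : C.HomM A X} {h : C.HomM B Y}
    {k : C.HomM X Y}, GoodSq goodM f g h k →
    ∃ (P : C.Ob) (i : C.HomM B P) (j : C.HomM X P), IsStarPushout goodM f g i j
  -- One of the two isomorphisms of (⋆) suffices: the other one comes from exchanging the legs of
  -- the span.
  starM_cok : ∀ {A B X P : C.Ob} {f : C.HomM A B} {g : C.HomM A X} {i : C.HomM B P}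
    {j : C.HomM X P}, IsStarPushout goodM f g i j →
    (∃ m : C.HomM (cok f) (cok j), IsIso m ∧ Nonempty (C.Sq m (cokπ f) (cokπ j) i))
  exists_starE : ∀ {A B X Y : C.Ob} {f : C.HomE A B} {g : C.HomE A X} {h : C.HomE B Y}
    {k : C.HomE X Y}, GoodSq goodE f g h k →
    ∃ (P : C.Ob) (i : C.HomE B P) (j : C.HomE X P), IsStarPushout goodE f g i j
  starE_ker : ∀ {A B X P : C.Ob} {f : C.HomE A B} {g : C.HomE A X} {i : C.HomE B P}
    {j : C.HomE X P}, IsStarPushout goodE f g i j →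
    (∃ e : C.HomE (ker f) (ker j), IsIso e ∧ Nonempty (C.Sq (kerι f) e i (kerι j)))
  pblM : ∀ {A₀ A₁ A₂ B₀ B₁ B₂ : C.Ob} {f₁ : C.HomM A₀ A₁} {f₂ : C.HomM A₁ A₂}
    {g₀ : C.HomE A₀ B₀} {g₁ : C.HomE A₁ B₁} {g₂ : C.HomE A₂ B₂}
    {k₁ : C.HomM B₀ B₁} {k₂ : C.HomM B₁ B₂}, C.Sq f₂ g₁ g₂ k₂ →
    C.Sq (f₁ ≫ f₂) g₀ g₂ (k₁ ≫ k₂) → Nonempty (C.Sq f₁ g₀ g₁ k₁)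
  pblE : ∀ {A₀ A₁ B₀ B₁ C₀ C₁ : C.Ob} {f : C.HomM A₀ A₁} {k : C.HomM B₀ B₁}
    {l : C.HomM C₀ C₁} {g₀ : C.HomE A₀ B₀} {g₁ : C.HomE A₁ B₁} {h₀ : C.HomE B₀ C₀}
    {h₁ : C.HomE B₁ C₁}, C.Sq k h₀ h₁ l →
    C.Sq f (g₀ ≫ h₀) (g₁ ≫ h₁) l → Nonempty (C.Sq f g₀ g₁ k)
  polM : ∀ {A B X P D Y : C.Ob} {f : C.HomM A B} {g : C.HomM A X} {i : C.HomM B P}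
    {j : C.HomM X P} {p : C.HomM B D} {q : C.HomM D Y} {r : C.HomM P Y},
    IsStarPushout goodM f g i j → p ≫ q = i ≫ r →
    GoodSq goodM (f ≫ p) g q (j ≫ r) → GoodSq goodM p i q r
  polE : ∀ {A B X P D Y : C.Ob} {f : C.HomE A B} {g : C.HomE A X} {i : C.HomE B P}
    {j : C.HomE X P} {p : C.HomE B D} {q : C.HomE D Y} {r : C.HomE P Y},
    IsStarPushout goodE f g i j → p ≫ q = i ≫ r →
    GoodSq goodE (f ≫ p) g q (j ≫ r) → GoodSq goodE p i q r

namespace PreStarCGW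

variable {C : DoubleCategory.{u, v, w}}

/-- The transposed structure. -/
@[reducible]
def transpose (W : PreStarCGW C) : PreStarCGW C.transpose where
  toE := W.toE.symm
  toE_trans f f' := W.toE_symm_trans f f'
  nonempty_sq_vert_iff g f f' g' := W.nonempty_sq_horiz_iff' f g g' f'
  subsingleton_sq_vert _ _ _ _ := W.sq_subsingleton _ _ _ _
  nonempty_sq_horiz_iff f g g' f' := W.nonempty_sq_vert_iff' g f f' g'
  subsingleton_sq_horiz _ _ _ _ := W.sq_subsingleton _ _ _ _
  goodM := W.goodE
  goodE := W.goodM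
  mulM := W.mulE
  mulE := W.mulM
  ker f := W.cok f
  kerι f := W.cokπ f
  kerMap s := W.cokMap s
  kerMap_good s := W.cokMap_good s
  kerMap_hid g := W.cokMap_vid g
  kerMap_hcomp s t := W.cokMap_vcomp s t
  cok f := W.ker f
  cokπ f := W.kerι f
  cokMap s := W.kerMap s
  cokMap_good s := W.kerMap_good s
  cokMap_vid g := W.kerMap_hid g
  cokMap_vcomp s t := W.kerMap_hcomp s t
  sq_subsingleton _ _ _ _ := W.sq_subsingleton _ _ _ _
  top_unique s t := W.left_unique s t
  left_unique s t := W.top_unique s t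
  exists_sq_of_goodM h := W.exists_sq_of_goodE h
  exists_sq_of_goodE h := W.exists_sq_of_goodM h
  zero := W.zero
  zeroM := W.zeroE
  zeroE := W.zeroM
  monoM := W.monoE
  monoE := W.monoM
  triangleM := W.triangleE
  triangleE := W.triangleM
  pullbackM := W.pullbackE
  pullbackE := W.pullbackM
  isIso_kerMap_iff s := (W.isIso_kerMap_iff s).symm
  -- The two halves of (K) are exchanged. A transposed square is distinguished when `cokMap` is
  -- invertible, and (D) trades this for `kerMap`.
  exists_cok_sq f := by
    obtain ⟨s, hs⟩ := W.exists_ker_sq f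
    exact ⟨s, (W.isIso_kerMap_iff s).1 hs⟩
  exists_ker_sq f := by
    obtain ⟨s, hs⟩ := W.exists_cok_sq f
    exact ⟨s, (W.isIso_kerMap_iff s).1 hs⟩
  good_symmM := W.good_symmE
  good_symmE := W.good_symmM
  exists_starM := W.exists_starE
  starM_cok := W.starE_ker
  exists_starE := W.exists_starM
  starE_ker := W.starM_cok
  pblM s t := W.pblE s t
  pblE s t := W.pblM s t
  polM := W.polE
  polE := W.polM

end PreStarCGW

/-- The self-dual part of a ⋆-CGW structure. -/
@[reducible]
def StarCGW.toPre {C : DoubleCategory.{u, v, w}} (S : StarCGW C) : PreStarCGW C where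
  toSharedIsos := S.toSharedIsos
  toKerCok := S.toKerCok
  sq_subsingleton := S.subsingleton_sq
  top_unique {A B A' B' f₁ f₂ g g' f'} s t := by
    have := S.kerFunctor_isEquivalence
    have := S.monoM (S.kerι g')
    -- As `kerι g'` is monic, the two squares have the same image under `k`, and faithfulness
    -- identifies their tops.
    have h : S.kerMap s = S.kerMap t := by
      rw [← cancel_mono (S.kerι g'), (S.kerMap_good s).1, (S.kerMap_good t).1]
    let s' : (⟨g⟩ : C.ArE) ⟶ ⟨g'⟩ := ⟨f₁, f', s⟩
    let t' : (⟨g⟩ : C.ArE) ⟶ ⟨g'⟩ := ⟨f₂, f', t⟩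
    have e : s' = t' := by
      apply S.kerFunctor.map_injective
      apply WideSubcategory.hom_ext
      ext
      · exact h
      · rfl
    exact (DoubleCategory.ArE.Hom.ext_iff.1 e).1
  left_unique {A B A' B' f g₁ g₂ g' f'} s t := by
    have := S.cokFunctor_isEquivalence
    have := S.monoE (S.cokπ f')
    have h : S.cokMap s = S.cokMap t := by
      rw [← cancel_mono (S.cokπ f'), (S.cokMap_good s).1, (S.cokMap_good t).1]
    let s' : (⟨f⟩ : C.ArM) ⟶ ⟨f'⟩ := ⟨g₁, g', s⟩
    let t' : (⟨f⟩ : C.ArM) ⟶ ⟨f'⟩ := ⟨g₂, g', t⟩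
    have e : s' = t' := by
      apply S.cokFunctor.map_injective
      apply WideSubcategory.hom_ext
      ext
      · exact h
      · rfl
    exact (DoubleCategory.ArM.Hom.ext_iff.1 e).1
  exists_sq_of_goodM {A B A' B' g g' f' m} h := by
    have := S.kerFunctor_isEquivalence
    let x : S.kerFunctor.obj ⟨g⟩ ⟶ S.kerFunctor.obj ⟨g'⟩ := ⟨Arrow.homMk m f' h.1, h.2⟩
    obtain ⟨y, hy⟩ := S.kerFunctor.map_surjective x
    have : y.bot = f' := congrArg (fun z => z.1.right) hy
    exact ⟨y.top, ⟨this ▸ y.sq⟩⟩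
  exists_sq_of_goodE {A B A' B' f g' f' e} h := by
    have := S.cokFunctor_isEquivalence
    let x : S.cokFunctor.obj ⟨f⟩ ⟶ S.cokFunctor.obj ⟨f'⟩ := ⟨Arrow.homMk e g' h.1, h.2⟩
    obtain ⟨y, hy⟩ := S.cokFunctor.map_surjective x
    have : y.right = g' := congrArg (fun z => z.1.right) hy
    exact ⟨y.left, ⟨this ▸ y.sq⟩⟩
  zero := S.zero
  zeroM := S.zeroM
  zeroE := S.zeroE
  monoM := S.monoM
  monoE := S.monoE
  triangleM hg e := ⟨e, S.triangleM _ hg⟩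
  triangleE hg e := ⟨e, S.triangleE _ hg⟩
  pullbackM h := S.pullbackM _ h.2
  pullbackE h := S.pullbackE _ h.2
  isIso_kerMap_iff := S.isIso_kerMap_iff
  exists_cok_sq := S.exists_cok_sq
  exists_ker_sq := S.exists_ker_sq
  good_symmM := (S.good_symmM _ _ _ _).1
  good_symmE := (S.good_symmE _ _ _ _).1
  exists_starM := S.exists_starM _ _ _ _
  starM_cok h := (S.starM_cok _ _ _ _ h).1
  exists_starE := S.exists_starE _ _ _ _
  starE_ker h := (S.starE_ker _ _ _ _ h).1
  pblM s t := S.pblM _ _ _ _ _ _ _ ⟨s⟩ ⟨t⟩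
  pblE s t := S.pblE _ _ _ _ _ _ _ ⟨s⟩ ⟨t⟩
  polM := S.polM _ _ _ _ _ _ _
  polE := S.polE _ _ _ _ _ _ _

end CGW

namespace CGW

theorem isIso_of_mono_of_isInitial {𝒜 : Type u₁} [Category.{v₁} 𝒜] {A I : 𝒜} (hI : IsInitial I)
    (f : A ⟶ I) [Mono f] : IsIso f :=
  ⟨hI.to A, by rw [← cancel_mono f, Category.assoc, hI.hom_ext (hI.to A ≫ f) (𝟙 I)]; simp,
    hI.hom_ext _ _⟩

namespace PreStarCGW

variable {C : DoubleCategory.{u, v, w}} (W : PreStarCGW C)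

/-! ## Isomorphisms -/

/-- Gluing these squares, or those of `sq_left_iso`, replaces a corner of a square by an isomorphic
object. -/
theorem sq_top_iso {A B D : C.Ob} (f : C.obM A ≅ C.obM B) (g : C.HomE B D) :
    Nonempty (C.Sq f.hom ((W.toE f).hom ≫ g) g (C.idM D)) := by
  refine (W.nonempty_sq_horiz_iff f _ g (Iso.refl _)).2 ?_
  rw [W.toE_refl]
  simp

theorem sq_left_iso {A B D : C.Ob} (m : C.obM A ≅ C.obM B) (f : C.HomM B D) :
    Nonempty (C.Sq (m.hom ≫ f) (W.toE m).hom (C.idE D) f) := by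
  have := (W.nonempty_sq_vert_iff (m.hom ≫ f) m (Iso.refl _) f).2 (by simp)
  rwa [W.toE_refl] at this

theorem kerMap_comm {A B A' B' : C.Ob} {f : C.HomM A B} {g : C.HomE A A'} {g' : C.HomE B B'}
    {f' : C.HomM A' B'} (s : C.Sq f g g' f') : W.kerMap s ≫ W.kerι g' = W.kerι g ≫ f' :=
  (W.kerMap_good s).1

theorem cokMap_comm {A B A' B' : C.Ob} {f : C.HomM A B} {g : C.HomE A A'} {g' : C.HomE B B'}
    {f' : C.HomM A' B'} (s : C.Sq f g g' f') : W.cokMap s ≫ W.cokπ f' = W.cokπ f ≫ g' :=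
  (W.cokMap_good s).1

/-- For identities, (D) compares the kernel over `B` with the kernel over `∅`, which is a subobject
of `∅`. The kernel of any invertible `g` then embeds in the kernel of an identity. -/
theorem ker_isInitial {Z B : C.Ob} (g : C.HomE Z B) (_ : IsIso g) :
    Nonempty (IsInitial (C.obM (W.ker g))) := by
  have key : ∀ B : C.Ob, Nonempty (IsInitial (C.obM (W.ker (C.idE B)))) := by
    intro B
    -- This square runs from the identity of `∅` to that of `B`; its `cokMap` is an identity, so its
    -- `kerMap` is invertible.
    let s := C.vid (W.zeroM.to (C.obM B))
    have h : IsIso (W.kerMap s) := by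
      rw [W.isIso_kerMap_iff, W.cokMap_vid]
      exact IsIso.id _
    have := W.monoM (W.kerι (C.idE W.zero))
    have := isIso_of_mono_of_isInitial W.zeroM (W.kerι (C.idE W.zero))
    exact ⟨(W.zeroM.ofIso (asIso (W.kerι (C.idE W.zero))).symm).ofIso (asIso (W.kerMap s))⟩
  obtain ⟨s⟩ := W.sq_top_iso (W.toE.symm (asIso g)) (C.idE B)
  obtain ⟨hB⟩ := key B
  have e : (W.toE (W.toE.symm (asIso g))).hom ≫ C.idE B = g := by simp
  rw [e] at s
  have hm := W.monoM (W.kerMap s)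
  have := isIso_of_mono_of_isInitial hB (W.kerMap s)
  exact ⟨hB.ofIso (asIso (W.kerMap s)).symm⟩

/-- Both `g` and the identity of `B` have initial kernels, so the identity of `B` underlies good
squares between their kernels in both directions. Fullness of `k` lifts these to mutually inverse
m-morphisms between `B` and `Z`, and the shared isomorphism attached to them is inverse to `g`. -/
theorem isIso_of_ker_isInitial {Z B : C.Ob} (g : C.HomE Z B)
    (hg : IsInitial (C.obM (W.ker g))) : IsIso g := by
  obtain ⟨hB⟩ := W.ker_isInitial (C.idE B) inferInstance
  have h₁ : GoodSq W.goodM (W.kerι (C.idE B)) (hB.to _) (C.idM B) (W.kerι g) :=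
    W.triangleM ⟨hg.to _, hB.hom_ext _ _, hg.hom_ext _ _⟩ (hB.hom_ext _ _)
  have h₂ : GoodSq W.goodM (W.kerι g) (hg.to _) (C.idM B) (W.kerι (C.idE B)) :=
    W.triangleM ⟨hB.to _, hg.hom_ext _ _, hB.hom_ext _ _⟩ (hg.hom_ext _ _)
  obtain ⟨f, ⟨s⟩⟩ := W.exists_sq_of_goodM h₁
  obtain ⟨k, ⟨t⟩⟩ := W.exists_sq_of_goodM h₂
  have st := C.hcomp s t
  have ts := C.hcomp t s
  rw [Category.id_comp] at st ts
  let i : C.obM B ≅ C.obM Z :=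
    ⟨f, k, W.top_unique st (C.hid _), W.top_unique ts (C.hid _)⟩
  have := (W.nonempty_sq_horiz_iff i (C.idE B) g (Iso.refl _)).1 ⟨s⟩
  rw [W.toE_refl] at this
  have e : g = (W.toE i).inv := by
    rw [← cancel_epi (W.toE i).hom, ← this]
    simp
  rw [e]
  infer_instance

theorem cok_isInitial {A B : C.Ob} (f : C.HomM A B) (hf : IsIso f) :
    Nonempty (IsInitial (C.obE (W.cok f))) :=
  W.transpose.ker_isInitial f hf

theorem isIso_of_cok_isInitial {A B : C.Ob} (f : C.HomM A B)
    (hf : IsInitial (C.obE (W.cok f))) : IsIso f :=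
  W.transpose.isIso_of_ker_isInitial f hf

theorem isInitialE (W : PreStarCGW C) {A : C.Ob} (h : IsInitial (C.obM A)) : Nonempty (IsInitial (C.obE A)) :=
  ⟨W.zeroE.ofIso (W.toE (W.zeroM.uniqueUpToIso h))⟩

theorem isInitialM (W : PreStarCGW C) {A : C.Ob} (h : IsInitial (C.obE A)) : Nonempty (IsInitial (C.obM A)) :=
  W.transpose.isInitialE h

/-- By (K) the kernel of this quotient is that of `∅ ⟶ ∅`, which is initial. -/
theorem isIso_cokπ_of_isInitial {B : C.Ob} : IsIso (W.cokπ (W.zeroM.to (C.obM B))) := by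
  obtain ⟨s, hs⟩ := W.exists_cok_sq (W.zeroM.to (C.obM B))
  have : IsIso (W.zeroE.to (C.obE W.zero)) :=
    ⟨W.zeroE.to _, W.zeroE.hom_ext _ _, W.zeroE.hom_ext _ _⟩
  obtain ⟨h⟩ := W.ker_isInitial (W.zeroE.to (C.obE W.zero)) this
  exact W.isIso_of_ker_isInitial _ (h.ofIso (asIso (W.kerMap s)))

theorem isIso_kerMap_of_isIso {A B A' B' : C.Ob} {f : C.HomM A B} {g : C.HomE A A'}
    {g' : C.HomE B B'} {f' : C.HomM A' B'} (s : C.Sq f g g' f') [IsIso g] [IsIso g'] :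
    IsIso (W.kerMap s) := by
  obtain ⟨h⟩ := W.ker_isInitial g inferInstance
  obtain ⟨h'⟩ := W.ker_isInitial g' inferInstance
  exact ⟨h'.to _, h.hom_ext _ _, h'.hom_ext _ _⟩

/-! ## Short exact sequences -/

/-- The m-morphism `f : A ⟶ B` is a kernel of the e-morphism `g : Z ⟶ B`; equivalently, `g` is
a cokernel of `f`. -/
def ShortExact {A B Z : C.Ob} (f : C.HomM A B) (g : C.HomE Z B) : Prop :=
  ∃ m : C.HomM (W.ker g) A, IsIso m ∧ m ≫ f = W.kerι g

variable {W}

/-- The notion is self-dual. The square of (K) for `g` is distinguished, so by (D) it identifies the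
cokernel of `kerι g` with that of `∅ ⟶ Z`, which is `Z`; the isomorphism between `ker g` and `A`
carries this over to `f`. -/
theorem ShortExact.dual {A B Z : C.Ob} {f : C.HomM A B} {g : C.HomE Z B}
    (h : W.ShortExact f g) : W.transpose.ShortExact g f := by
  obtain ⟨m, hm, e⟩ := h
  obtain ⟨s, hs⟩ := W.exists_ker_sq g
  rw [W.isIso_kerMap_iff] at hs
  have := W.isIso_cokπ_of_isInitial (B := Z)
  obtain ⟨t⟩ := W.sq_left_iso (asIso m) f
  have e' : (asIso m).hom ≫ f = W.kerι g := e
  rw [e'] at t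
  have ht : IsIso (W.cokMap t) := by
    rw [← W.isIso_kerMap_iff]
    exact W.isIso_kerMap_of_isIso t
  have hs' := W.cokMap_comm s
  have ht' := W.cokMap_comm t
  refine ⟨(inv (W.cokMap t) ≫ inv (W.cokMap s) ≫ W.cokπ (W.zeroM.to (C.obM Z)) :
    C.HomE (W.cok f) Z), ?_, ?_⟩
  · exact (inferInstance : IsIso (inv (W.cokMap t) ≫ inv (W.cokMap s) ≫
      W.cokπ (W.zeroM.to (C.obM Z))))
  · change (inv (W.cokMap t) ≫ inv (W.cokMap s) ≫ W.cokπ (W.zeroM.to (C.obM Z))) ≫ g = W.cokπ f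
    rw [Category.assoc, Category.assoc, ← hs', IsIso.inv_hom_id_assoc, IsIso.inv_comp_eq, ht']
    simp

theorem ShortExact.undual {A B Z : C.Ob} {f : C.HomM A B} {g : C.HomE Z B}
    (h : W.transpose.ShortExact g f) : W.ShortExact f g :=
  ShortExact.dual (W := W.transpose) h

theorem ShortExact.exists_cok_iso {A B Z : C.Ob} {f : C.HomM A B} {g : C.HomE Z B}
    (h : W.ShortExact f g) : ∃ e : C.HomE (W.cok f) Z, IsIso e ∧ e ≫ g = W.cokπ f :=
  h.dual

variable (W)

theorem shortExact_kerι {Z B : C.Ob} (g : C.HomE Z B) : W.ShortExact (W.kerι g) g :=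
  ⟨C.idM _, IsIso.id _, Category.id_comp _⟩

theorem shortExact_cokπ {A B : C.Ob} (f : C.HomM A B) : W.ShortExact f (W.cokπ f) :=
  (W.transpose.shortExact_kerι f).undual

variable {W}

theorem ShortExact.iso_left {A A' B Z : C.Ob} {f : C.HomM A B} {f' : C.HomM A' B}
    {g : C.HomE Z B} (h : W.ShortExact f g) (m : C.HomM A A') (hm : IsIso m) (e : m ≫ f' = f) :
    W.ShortExact f' g := by
  obtain ⟨n, hn, e'⟩ := h
  exact ⟨n ≫ m, inferInstance, by rw [Category.assoc, e, e']⟩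

theorem ShortExact.iso_right {A B Z Z' : C.Ob} {f : C.HomM A B} {g : C.HomE Z B}
    {g' : C.HomE Z' B} (h : W.ShortExact f g) (n : C.HomE Z Z') (hn : IsIso n)
    (e : n ≫ g' = g) : W.ShortExact f g' :=
  (h.dual.iso_left n hn e).undual

theorem ShortExact.unique_left {A A' B Z : C.Ob} {f : C.HomM A B} {f' : C.HomM A' B}
    {g : C.HomE Z B} (h : W.ShortExact f g) (h' : W.ShortExact f' g) :
    ∃ m : C.HomM A A', IsIso m ∧ m ≫ f' = f := by
  obtain ⟨n, hn, e⟩ := h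
  obtain ⟨n', hn', e'⟩ := h'
  refine ⟨inv n ≫ n', inferInstance, ?_⟩
  rw [Category.assoc, e', ← e, IsIso.inv_hom_id_assoc]

theorem ShortExact.unique_right {A B Z Z' : C.Ob} {f : C.HomM A B} {g : C.HomE Z B}
    {g' : C.HomE Z' B} (h : W.ShortExact f g) (h' : W.ShortExact f g') :
    ∃ n : C.HomE Z Z', IsIso n ∧ n ≫ g' = g :=
  ShortExact.unique_left h.dual h'.dual

theorem ShortExact.isIso_right {A B Z : C.Ob} {f : C.HomM A B} {g : C.HomE Z B}
    (h : W.ShortExact f g) (hA : IsInitial (C.obM A)) : IsIso g := by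
  obtain ⟨n, hn, -⟩ := h
  exact W.isIso_of_ker_isInitial g (hA.ofIso (asIso n).symm)

theorem ShortExact.isIso_left {A B Z : C.Ob} {f : C.HomM A B} {g : C.HomE Z B}
    (h : W.ShortExact f g) (hZ : IsInitial (C.obE Z)) : IsIso f :=
  ShortExact.isIso_right h.dual hZ

/-! ## Pseudo-commutative squares and good squares -/

/-- Fullness of `k`, for arbitrary kernels instead of the chosen ones: the comparison isomorphisms
give squares that are good by (G), and these are glued on both sides of the given square. -/
theorem ShortExact.exists_sq {A B X Y Z Z' : C.Ob} {f : C.HomM A B} {p : C.HomE Z B}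
    {k : C.HomM X Y} {q : C.HomE Z' Y} {g : C.HomM A X} {h : C.HomM B Y}
    (hf : W.ShortExact f p) (hk : W.ShortExact k q) (H : GoodSq W.goodM f g h k) :
    ∃ m : C.HomM Z Z', Nonempty (C.Sq m p q h) := by
  obtain ⟨a, ha, ea⟩ := hf
  obtain ⟨b, hb, eb⟩ := hk
  have h₁ : GoodSq W.goodM (W.kerι p) a (C.idM B) f := W.triangleM ha (by rw [ea]; simp)
  have h₂ : GoodSq W.goodM k (inv b) (C.idM Y) (W.kerι q) :=
    W.triangleM inferInstance (by rw [← eb]; simp)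
  have h₃ := GoodSq.comp W.mulM h₁ (GoodSq.comp W.mulM H h₂)
  rw [Category.id_comp, Category.comp_id] at h₃
  exact W.exists_sq_of_goodM h₃

theorem ShortExact.exists_good {A B X Y Z Z' : C.Ob} {f : C.HomM A B} {p : C.HomE Z B}
    {k : C.HomM X Y} {q : C.HomE Z' Y} {m : C.HomM Z Z'} {h : C.HomM B Y}
    (hf : W.ShortExact f p) (hk : W.ShortExact k q) (s : C.Sq m p q h) :
    ∃ g : C.HomM A X, GoodSq W.goodM f g h k := by
  obtain ⟨a, ha, ea⟩ := hf
  obtain ⟨b, hb, eb⟩ := hk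
  have h₁ : GoodSq W.goodM f (inv a) (C.idM B) (W.kerι p) :=
    W.triangleM inferInstance (by rw [← ea]; simp)
  have h₂ : GoodSq W.goodM (W.kerι q) b (C.idM Y) k :=
    W.triangleM hb (by rw [eb]; simp)
  have h₃ := GoodSq.comp W.mulM h₁ (GoodSq.comp W.mulM (W.kerMap_good s) h₂)
  rw [Category.id_comp, Category.comp_id] at h₃
  exact ⟨_, h₃⟩

/-- The map on kernels induced by the pseudo-commutative square must be `g`, because `k` is monic.
With `exists_sq`, goodness of a commuting square is thus a condition on cokernels alone. -/
theorem ShortExact.good_of_sq {A B X Y Z Z' : C.Ob} {f : C.HomM A B} {p : C.HomE Z B}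
    {k : C.HomM X Y} {q : C.HomE Z' Y} {g : C.HomM A X} {m : C.HomM Z Z'} {h : C.HomM B Y}
    (hf : W.ShortExact f p) (hk : W.ShortExact k q) (s : C.Sq m p q h) (e : g ≫ k = f ≫ h) :
    GoodSq W.goodM f g h k := by
  obtain ⟨g', H⟩ := hf.exists_good hk s
  have := W.monoM k
  rwa [← (cancel_mono k).1 (H.1.trans e.symm)]

theorem ShortExact.exists_sqE {A A' B B' Z Z' : C.Ob} {f : C.HomM A B} {p : C.HomE Z B}
    {k : C.HomM A' B'} {q : C.HomE Z' B'} {x : C.HomE Z Z'} {h : C.HomE B B'}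
    (hf : W.ShortExact f p) (hk : W.ShortExact k q) (H : GoodSq W.goodE p x h q) :
    ∃ e : C.HomE A A', Nonempty (C.Sq f e h k) :=
  ShortExact.exists_sq hf.dual hk.dual H

theorem ShortExact.exists_goodE {A A' B B' Z Z' : C.Ob} {f : C.HomM A B} {p : C.HomE Z B}
    {k : C.HomM A' B'} {q : C.HomE Z' B'} {e : C.HomE A A'} {h : C.HomE B B'}
    (hf : W.ShortExact f p) (hk : W.ShortExact k q) (s : C.Sq f e h k) :
    ∃ x : C.HomE Z Z', GoodSq W.goodE p x h q :=
  ShortExact.exists_good (W := W.transpose) hf.dual hk.dual s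

/-- Replace the upper left corner of a pseudo-commutative square along an isomorphism. -/
theorem sq_of_iso {A A' B X Y : C.Ob} {f : C.HomM A B} {p : C.HomE A X} {q : C.HomE B Y}
    {h : C.HomM X Y} (s : C.Sq f p q h) (m : C.HomM A' A) (hm : IsIso m) :
    Nonempty (C.Sq (m ≫ f) ((W.toE (asIso m)).hom ≫ p) q h) := by
  obtain ⟨t⟩ := W.sq_top_iso (asIso m) p
  have := C.hcomp t s
  rw [Category.id_comp] at this
  exact ⟨this⟩

/-- A distinguished square gives a composite of short exact sequences. -/
theorem ShortExact.comp {K L Y X' Y' R : C.Ob} {c : C.HomM K L} {e : C.HomE X' L}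
    {l : C.HomM L Y} {y : C.HomE Y' Y} {t : C.HomM X' Y'} {r : C.HomE R Y'}
    (hc : W.ShortExact c e) (hcl : W.ShortExact (c ≫ l) y) (ht : W.ShortExact t r)
    (s : C.Sq t e y l) : W.ShortExact l (r ≫ y) := by
  obtain ⟨a, ha, ea⟩ := hc
  obtain ⟨b, hb, eb⟩ := hcl
  -- The kernels of `e` and of `y` are both `K`, so the square is distinguished; by (D) the
  -- cokernels of `t` and of `l` then agree. This is the third isomorphism theorem.
  have hs : IsIso (W.kerMap s) := by
    have : W.kerMap s = a ≫ inv b := by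
      have := W.monoM (W.kerι y)
      rw [← cancel_mono (W.kerι y), W.kerMap_comm, ← ea, ← eb]
      simp
    rw [this]
    infer_instance
  rw [W.isIso_kerMap_iff] at hs
  have hs' := W.cokMap_comm s
  obtain ⟨d, hd, ed⟩ := ht.exists_cok_iso
  refine ShortExact.iso_right (W.shortExact_cokπ l) (inv (W.cokMap s) ≫ d) inferInstance ?_
  rw [Category.assoc, reassoc_of% ed, ← hs', IsIso.inv_hom_id_assoc]

/-- The preimage of a subobject under a quotient map. -/
theorem ShortExact.exists_preimage {K Y X' Y' : C.Ob} {κ : C.HomM K Y} {y : C.HomE Y' Y}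
    (t : C.HomM X' Y') (hy : W.ShortExact κ y) :
    ∃ (L : C.Ob) (l : C.HomM L Y) (e : C.HomE X' L) (c : C.HomM K L),
      Nonempty (C.Sq t e y l) ∧ W.ShortExact c e ∧ c ≫ l = κ := by
  -- The preimage is the kernel of the composite quotient of `Y`, first to `Y'` and then to `Y'/X'`,
  -- that is, of `r ≫ y`.
  let r := W.cokπ t
  have H : GoodSq W.goodE r (C.idE _) y (r ≫ y) := W.triangleE inferInstance (by simp)
  obtain ⟨e, ⟨s⟩⟩ := ShortExact.exists_sqE (W.shortExact_cokπ t) (W.shortExact_kerι (r ≫ y)) H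
  -- By (D) it is enough to invert `cokMap s`, and its source and target are both the quotient `r ≫
  -- y` of `Y`.
  have hs : IsIso (W.kerMap s) := by
    rw [W.isIso_kerMap_iff]
    have : W.cokMap s ≫ W.cokπ (W.kerι (r ≫ y)) = r ≫ y := W.cokMap_comm s
    obtain ⟨d, hd, ed⟩ := (W.shortExact_kerι (r ≫ y)).exists_cok_iso
    have e' : W.cokMap s = inv d := by
      have := W.monoE (W.cokπ (W.kerι (r ≫ y)))
      rw [← cancel_mono (W.cokπ (W.kerι (r ≫ y))), ‹W.cokMap s ≫ _ = _›, ← ed,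
        IsIso.inv_hom_id_assoc]
    rw [e']
    infer_instance
  obtain ⟨b, hb, eb⟩ := hy
  refine ⟨_, W.kerι (r ≫ y), e, inv b ≫ inv (W.kerMap s) ≫ W.kerι e, ⟨s⟩, ?_, ?_⟩
  · refine ⟨W.kerMap s ≫ b, inferInstance, ?_⟩
    simp
  · rw [Category.assoc, Category.assoc, ← W.kerMap_comm, IsIso.inv_hom_id_assoc, ← eb,
      IsIso.inv_hom_id_assoc]

/-- Passing to kernels reverses the order. -/
theorem ShortExact.exists_factor {K₂ K D Z₁ Z₂ : C.Ob} {m₂ : C.HomM K₂ D} {m : C.HomM K D}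
    {p₂ : C.HomE Z₂ D} {w : C.HomE Z₁ Z₂} (h₂ : W.ShortExact m₂ p₂)
    (h : W.ShortExact m (w ≫ p₂)) : ∃ t : C.HomM K₂ K, t ≫ m = m₂ := by
  -- The preimage `L` of the kernel of `w` contains `K₂`, and it is itself a kernel of `w ≫ p₂`,
  -- hence isomorphic to `K` over `D`.
  obtain ⟨L, l, e, c, ⟨s⟩, hc, hcl⟩ := h₂.exists_preimage (W.kerι w)
  have hl : W.ShortExact l (w ≫ p₂) :=
    ShortExact.comp hc (hcl ▸ h₂) (W.shortExact_kerι w) s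
  obtain ⟨n, -, hn⟩ := hl.unique_left h
  exact ⟨c ≫ n, by rw [Category.assoc, hn, hcl]⟩

theorem ShortExact.exists_factorE {A B D Z Z' : C.Ob} {t : C.HomM A B} {h : C.HomM B D}
    {q : C.HomE Z D} {r : C.HomE Z' D} (hq : W.ShortExact h q) (hr : W.ShortExact (t ≫ h) r) :
    ∃ x : C.HomE Z Z', x ≫ r = q :=
  ShortExact.exists_factor (W := W.transpose) hq.dual hr.dual

/-- Lifting along a distinguished square, on the bottom side. -/
theorem ShortExact.dist_lift {K L Y X' Y' G' G : C.Ob} {c : C.HomM K L} {e : C.HomE X' L}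
    {l : C.HomM L Y} {y : C.HomE Y' Y} {t : C.HomM X' Y'} {m : C.HomM G' X'}
    {γ : C.HomE G' G} {h : C.HomM G Y}
    (hc : W.ShortExact c e) (hcl : W.ShortExact (c ≫ l) y) (s : C.Sq t e y l)
    (s' : C.Sq (m ≫ t) γ y h) :
    ∃ n : C.HomM G L, n ≫ l = h ∧ Nonempty (C.Sq m γ e n) := by
  -- By `exists_factor` it is enough that the quotient of `Y` by `L`, which is `cokπ t ≫ y`, factors
  -- through the quotient by `G`. The square `s'` compares the quotient of `Y` by `G` with that of
  -- `Y'` by `G'`, and `G'` is contained in `X'`.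
  have hl := ShortExact.comp hc hcl (W.shortExact_cokπ t) s
  obtain ⟨z, hz⟩ := ShortExact.exists_goodE (W.shortExact_cokπ _) (W.shortExact_cokπ h) s'
  obtain ⟨x, hx⟩ := ShortExact.exists_factorE (W.shortExact_cokπ t) (W.shortExact_cokπ (m ≫ t))
  have e₁ : W.cokπ t ≫ y = (x ≫ z) ≫ W.cokπ h := by
    rw [Category.assoc, hz.1, reassoc_of% hx]
  rw [e₁] at hl
  obtain ⟨n, hn⟩ := ShortExact.exists_factor (W.shortExact_cokπ h) hl
  refine ⟨n, hn, W.pblM s ?_⟩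
  rwa [hn]

/-- Lifting along a distinguished square, on the top side. -/
theorem ShortExact.dist_lift_top {X D D' Z Z' A' B : C.Ob} {k : C.HomM X D} {d : C.HomM D D'}
    {q : C.HomE Z D} {q' : C.HomE Z' D'} {n : C.HomM Z Z'} {m' : C.HomM A' Z'}
    {p : C.HomE A' B} {h : C.HomM B D}
    (hk : W.ShortExact k q) (hkd : W.ShortExact (k ≫ d) q') (s : C.Sq n q q' d)
    (s' : C.Sq m' p q' (h ≫ d)) : ∃ m : C.HomM A' Z, m ≫ n = m' ∧ Nonempty (C.Sq m p q h) := by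
  have hd := ShortExact.comp hk hkd (W.shortExact_cokπ n) s
  obtain ⟨z, hz⟩ := ShortExact.exists_goodE (W.shortExact_cokπ m') (W.shortExact_cokπ (h ≫ d)) s'
  obtain ⟨x, hx⟩ := ShortExact.exists_factorE hd (W.shortExact_cokπ (h ≫ d))
  -- Good squares are pullbacks, so the quotient of `Z'` by `Z` factors through the quotient by
  -- `A'`; hence `A'` is contained in `Z`.
  have pb := W.pullbackE hz
  let y := pb.lift x (W.cokπ n) hx
  have hy : y ≫ W.cokπ m' = W.cokπ n := pb.lift_snd _ _ _
  have hn := W.shortExact_cokπ n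
  rw [← hy] at hn
  obtain ⟨m, hm⟩ := ShortExact.exists_factor (W.shortExact_cokπ m') hn
  refine ⟨m, hm, W.pblM s ?_⟩
  rwa [hm]

variable (W)

/-! ## Permanence properties of good squares -/

theorem good_shrink {A B X X' Y : C.Ob} {f : C.HomM A B} {g : C.HomM A X'} {g' : C.HomM X' X}
    {h : C.HomM B Y} {k : C.HomM X Y} (H : GoodSq W.goodM f (g ≫ g') h k) :
    GoodSq W.goodM f g h (g' ≫ k) := by
  have h₁ : GoodSq W.goodM g (C.idM A) g' (g ≫ g') := W.triangleM inferInstance (by simp)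
  have h₂ := GoodSq.comp W.mulM h₁ (W.good_symmM H)
  rw [Category.id_comp] at h₂
  exact W.good_symmM h₂

theorem good_enlarge {A B X D D' : C.Ob} {f : C.HomM A B} {g : C.HomM A X} {h : C.HomM B D}
    {k : C.HomM X D} (H : GoodSq W.goodM f g h k) (d : C.HomM D D') :
    GoodSq W.goodM f g (h ≫ d) (k ≫ d) := by
  have h₁ : GoodSq W.goodM k (C.idM X) d (k ≫ d) := W.triangleM inferInstance (by simp)
  have := GoodSq.comp W.mulM H h₁
  rwa [Category.comp_id] at this

/-- Goodness may be tested in a larger ambient object: the induced map of cokernels to `D'/X`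
factors through `D/X` by `dist_lift_top`. -/
theorem good_reflect {A B X D D' : C.Ob} {f : C.HomM A B} {g : C.HomM A X} {h : C.HomM B D}
    {k : C.HomM X D} {d : C.HomM D D'} (H : GoodSq W.goodM f g (h ≫ d) (k ≫ d)) :
    GoodSq W.goodM f g h k := by
  have h₁ : GoodSq W.goodM k (C.idM X) d (k ≫ d) := W.triangleM inferInstance (by simp)
  obtain ⟨n, ⟨s⟩⟩ := ShortExact.exists_sq (W.shortExact_cokπ k) (W.shortExact_cokπ (k ≫ d)) h₁
  obtain ⟨m', ⟨s'⟩⟩ := ShortExact.exists_sq (W.shortExact_cokπ f) (W.shortExact_cokπ (k ≫ d)) H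
  obtain ⟨m, -, ⟨t⟩⟩ := ShortExact.dist_lift_top (W.shortExact_cokπ k)
    (W.shortExact_cokπ (k ≫ d)) s s'
  refine ShortExact.good_of_sq (W.shortExact_cokπ f) (W.shortExact_cokπ k) t ?_
  have := W.monoM d
  rw [← cancel_mono d, Category.assoc, Category.assoc, H.1]

/-- This provides the good naturality squares of the first factor when a composite is m-natural. -/
theorem good_cancel {A B X Y X' Y' : C.Ob} {x : C.HomM A B} {y : C.HomM A X} {y' : C.HomM X X'}
    {z : C.HomM B Y} {z' : C.HomM Y Y'} {t : C.HomM X' Y'} {r : C.HomM X Y}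
    (H : GoodSq W.goodM x (y ≫ y') (z ≫ z') t) (e : y' ≫ t = r ≫ z') :
    GoodSq W.goodM x y z r := by
  have := W.good_shrink H
  rw [e] at this
  exact W.good_reflect this

theorem good_vcomp {A B X D X' D' : C.Ob} {f : C.HomM A B} {g : C.HomM A X} {h : C.HomM B D}
    {k : C.HomM X D} {g' : C.HomM X X'} {h' : C.HomM D D'} {k' : C.HomM X' D'}
    (H : GoodSq W.goodM f g h k) (H' : GoodSq W.goodM k g' h' k') :
    GoodSq W.goodM f (g ≫ g') (h ≫ h') k' :=
  GoodSq.comp W.mulM H H'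

theorem good_hcomp {A B X D B' D' : C.Ob} {f : C.HomM A B} {g : C.HomM A X} {h : C.HomM B D}
    {k : C.HomM X D} {f' : C.HomM B B'} {h' : C.HomM B' D'} {k' : C.HomM D D'}
    (H : GoodSq W.goodM f g h k) (H' : GoodSq W.goodM f' h h' k') :
    GoodSq W.goodM (f ≫ f') g h' (k ≫ k') :=
  W.good_symmM (W.good_vcomp (W.good_symmM H) (W.good_symmM H'))

end PreStarCGW

end CGW

namespace CGW

theorem IsStarPushout.exists_isIso {𝒜 : Type u₁} [Category.{v₁} 𝒜]
    {Q : MorphismProperty (Arrow 𝒜)} {A B X P P' : 𝒜} {f : A ⟶ B} {g : A ⟶ X} {i : B ⟶ P}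
    {j : X ⟶ P} {i' : B ⟶ P'} {j' : X ⟶ P'} (H : IsStarPushout Q f g i j)
    (H' : IsStarPushout Q f g i' j') : ∃ m : P ⟶ P', IsIso m ∧ i ≫ m = i' ∧ j ≫ m = j' := by
  obtain ⟨m, ⟨h₁, h₂⟩, -⟩ := H.desc _ _ H'.good
  obtain ⟨n, ⟨h₃, h₄⟩, -⟩ := H'.desc _ _ H.good
  refine ⟨m, ⟨n, (H.desc _ _ H.good).unique ⟨?_, ?_⟩ ⟨Category.comp_id _, Category.comp_id _⟩,
    (H'.desc _ _ H'.good).unique ⟨?_, ?_⟩ ⟨Category.comp_id _, Category.comp_id _⟩⟩, h₁, h₂⟩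
  · rw [reassoc_of% h₁, h₃]
  · rw [reassoc_of% h₂, h₄]
  · rw [reassoc_of% h₃, h₁]
  · rw [reassoc_of% h₄, h₂]

namespace PreStarCGW

variable {C : DoubleCategory.{u, v, w}} (W : PreStarCGW C)

/-! ## ⋆-pushouts -/

theorem star_symm {A B X P : C.Ob} {f : C.HomM A B} {g : C.HomM A X} {i : C.HomM B P}
    {j : C.HomM X P} (H : IsStarPushout W.goodM f g i j) : IsStarPushout W.goodM g f j i where
  good := W.good_symmM H.good
  desc i' j' h := by
    obtain ⟨t, ht, ht'⟩ := H.desc j' i' (W.good_symmM h)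
    exact ⟨t, ht.symm, fun y hy => ht' y hy.symm⟩

/-- Composition with `y` turns the ⋆-pushout square into another good completion of the span, to
which the uniqueness in the universal property applies. -/
theorem star_hom_ext {A B X P D : C.Ob} {f : C.HomM A B} {g : C.HomM A X} {i : C.HomM B P}
    {j : C.HomM X P} (H : IsStarPushout W.goodM f g i j) {x y : C.HomM P D}
    (hi : i ≫ x = i ≫ y) (hj : j ≫ x = j ≫ y) : x = y :=
  (H.desc _ _ (W.good_enlarge H.good y)).unique ⟨hi, hj⟩ ⟨rfl, rfl⟩

theorem star_unique {A B X P P' : C.Ob} {f : C.HomM A B} {g : C.HomM A X} {i : C.HomM B P}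
    {j : C.HomM X P} {i' : C.HomM B P'} {j' : C.HomM X P'} (H : IsStarPushout W.goodM f g i j)
    (H' : IsStarPushout W.goodM f g i' j') :
    ∃ m : C.HomM P P', IsIso m ∧ i ≫ m = i' ∧ j ≫ m = j' :=
  H.exists_isIso H'

theorem star_of_isIso {A B X P P' : C.Ob} {f : C.HomM A B} {g : C.HomM A X} {i : C.HomM B P}
    {j : C.HomM X P} (H : IsStarPushout W.goodM f g i j) (m : C.HomM P P') [IsIso m] :
    IsStarPushout W.goodM f g (i ≫ m) (j ≫ m) where
  good := W.good_enlarge H.good m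
  desc i' j' h := by
    obtain ⟨t, ⟨h₁, h₂⟩, -⟩ := H.desc i' j' h
    refine ⟨inv m ≫ t, ⟨by simpa using h₁, by simpa using h₂⟩, fun y hy => ?_⟩
    rw [IsIso.eq_inv_comp]
    refine W.star_hom_ext H ?_ ?_
    · rw [h₁, ← hy.1, Category.assoc]
    · rw [h₂, ← hy.2, Category.assoc]

/-- The pasting law for pushouts. The universal property of the second square can be applied only to
good squares, and goodness is supplied by (POL). -/
theorem star_paste {A B X P X' Q : C.Ob} {f : C.HomM A B} {g : C.HomM A X} {i : C.HomM B P}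
    {j : C.HomM X P} {g' : C.HomM X X'} {i' : C.HomM P Q} {j' : C.HomM X' Q}
    (H : IsStarPushout W.goodM f g i j) (H' : IsStarPushout W.goodM j g' i' j') :
    IsStarPushout W.goodM f (g ≫ g') (i ≫ i') j' where
  good := W.good_vcomp H.good H'.good
  desc x y h := by
    obtain ⟨t, ⟨h₁, h₂⟩, -⟩ := H.desc x (g' ≫ y) (W.good_shrink h)
    have h₃ : GoodSq W.goodM j g' t y :=
      W.good_symmM (W.polM (W.star_symm H) h₂.symm (W.good_symmM (by rwa [h₁])))
    obtain ⟨s, ⟨h₄, h₅⟩, h₆⟩ := H'.desc t y h₃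
    refine ⟨s, ⟨by rw [Category.assoc, h₄, h₁], h₅⟩, fun z hz => h₆ z ⟨?_, hz.2⟩⟩
    refine W.star_hom_ext H ?_ ?_
    · rw [h₁, ← hz.1, Category.assoc]
    · rw [h₂, ← hz.2, ← Category.assoc, ← Category.assoc, H'.good.1]

/-- The cancellation half of the pasting law, which again rests on (POL). -/
theorem star_cancel {A B X P X' Q : C.Ob} {f : C.HomM A B} {g : C.HomM A X} {i : C.HomM B P}
    {j : C.HomM X P} {g' : C.HomM X X'} {i' : C.HomM B Q} {j' : C.HomM X' Q}
    (H : IsStarPushout W.goodM f g i j) (H' : IsStarPushout W.goodM f (g ≫ g') i' j') :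
    ∃ t : C.HomM P Q, i ≫ t = i' ∧ j ≫ t = g' ≫ j' ∧ IsStarPushout W.goodM j g' t j' := by
  obtain ⟨t, ⟨h₁, h₂⟩, -⟩ := H.desc i' (g' ≫ j') (W.good_shrink H'.good)
  have h₃ : GoodSq W.goodM j g' t j' :=
    W.good_symmM (W.polM (W.star_symm H) h₂.symm (W.good_symmM (by rw [h₁]; exact H'.good)))
  refine ⟨t, h₁, h₂, h₃, fun x y h => ?_⟩
  obtain ⟨s, ⟨h₄, h₅⟩, h₆⟩ := H'.desc _ _ (W.good_vcomp H.good h)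
  refine ⟨s, ⟨W.star_hom_ext H ?_ ?_, h₅⟩, fun z hz => h₆ z ⟨?_, hz.2⟩⟩
  · rw [reassoc_of% h₁, h₄]
  · rw [reassoc_of% h₂, h₅, h.1]
  · rw [← h₁, Category.assoc, hz.1]

/-- The ⋆-pushout is functorial for good squares. -/
theorem star_map {A B X P A' B' X' P' : C.Ob} {f : C.HomM A B} {g : C.HomM A X}
    {i : C.HomM B P} {j : C.HomM X P} {f' : C.HomM A' B'} {g' : C.HomM A' X'}
    {i' : C.HomM B' P'} {j' : C.HomM X' P'} {a : C.HomM A A'} {b : C.HomM B B'}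
    {c : C.HomM X X'} (H : IsStarPushout W.goodM f g i j)
    (H' : IsStarPushout W.goodM f' g' i' j') (hf : GoodSq W.goodM f a b f')
    (hg : GoodSq W.goodM g a c g') :
    ∃ s : C.HomM P P', i ≫ s = b ≫ i' ∧ j ≫ s = c ≫ j' ∧
      GoodSq W.goodM i b s i' ∧ GoodSq W.goodM j c s j' := by
  have h₁ : GoodSq W.goodM f (a ≫ g') (b ≫ i') j' := W.good_vcomp hf H'.good
  have h₂ : GoodSq W.goodM g (a ≫ f') (c ≫ j') i' := W.good_vcomp hg (W.good_symmM H'.good)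
  rw [hg.1] at h₁
  obtain ⟨s, ⟨h₃, h₄⟩, -⟩ := H.desc _ _ (W.good_shrink h₁)
  -- Both naturality squares are right-hand squares of pastings that begin with the ⋆-pushout, so
  -- they are good by (POL).
  refine ⟨s, h₃, h₄, W.good_symmM (W.polM H h₃.symm ?_),
    W.good_symmM (W.polM (W.star_symm H) h₄.symm ?_)⟩
  · rw [h₄, ← hf.1]
    exact W.good_symmM h₂
  · rw [h₃]
    exact W.good_symmM h₁

variable {W}

theorem ShortExact.exists_sq_id {A B Z Z' : C.Ob} {f : C.HomM A B} {p : C.HomE Z B}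
    {p' : C.HomE Z' B} (h : W.ShortExact f p) (h' : W.ShortExact f p') :
    ∃ m : C.HomM Z Z', IsIso m ∧ Nonempty (C.Sq m p p' (C.idM B)) := by
  obtain ⟨n, hn, e⟩ := h.unique_right h'
  have := W.sq_top_iso (W.toE.symm (asIso n)) p'
  refine ⟨(W.toE.symm (asIso n)).hom, inferInstance, ?_⟩
  have e' : (W.toE (W.toE.symm (asIso n))).hom ≫ p' = p := by simpa using e
  rwa [e'] at this

/-- The axiom (⋆) for an arbitrary choice of cokernels; tops of squares are unique, so `m` is the
map of the axiom up to the comparison isomorphisms. -/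
theorem ShortExact.star_isIso {A B X P Z Z' : C.Ob} {f : C.HomM A B} {g : C.HomM A X}
    {i : C.HomM B P} {j : C.HomM X P} {p : C.HomE Z B} {q : C.HomE Z' P} {m : C.HomM Z Z'}
    (hf : W.ShortExact f p) (hj : W.ShortExact j q) (s : C.Sq m p q i)
    (H : IsStarPushout W.goodM f g i j) : IsIso m := by
  obtain ⟨m₀, h₀, ⟨s₀⟩⟩ := W.starM_cok H
  obtain ⟨m₁, h₁, ⟨s₁⟩⟩ := hf.exists_sq_id (W.shortExact_cokπ f)
  obtain ⟨m₂, h₂, ⟨s₂⟩⟩ := (W.shortExact_cokπ j).exists_sq_id hj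
  have t := C.hcomp s₁ (C.hcomp s₀ s₂)
  rw [Category.id_comp, Category.comp_id] at t
  rw [W.top_unique s t]
  infer_instance

/-- A converse to (⋆). The comparison `v : P ⟶ D` from the ⋆-pushout induces an isomorphism of
cokernels over `X`, so its own cokernel is initial and `v` is invertible. -/
theorem ShortExact.star_of_isIso {A B X D Z Z' : C.Ob} {f : C.HomM A B} {g : C.HomM A X}
    {h : C.HomM B D} {k : C.HomM X D} {p : C.HomE Z B} {q : C.HomE Z' D} {m : C.HomM Z Z'}
    (hf : W.ShortExact f p) (hk : W.ShortExact k q) (s : C.Sq m p q h) (hm : IsIso m)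
    (H : GoodSq W.goodM f g h k) : IsStarPushout W.goodM f g h k := by
  obtain ⟨P, i, j, HP⟩ := W.exists_starM H
  obtain ⟨v, ⟨rfl, rfl⟩, -⟩ := HP.desc _ _ H
  have hj := W.shortExact_cokπ j
  obtain ⟨m₁, ⟨s₁⟩⟩ := hf.exists_sq hj HP.good
  have h₁ := hf.star_isIso hj s₁ HP
  obtain ⟨m₂, ⟨s₂⟩⟩ := hj.exists_sq (h := v) hk
    (W.triangleM (g := C.idM X) inferInstance (by simp))
  have e := W.top_unique s (C.hcomp s₁ s₂)
  have h₂ : IsIso m₂ := by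
    rw [e] at hm
    exact IsIso.of_isIso_comp_left m₁ m₂
  have hv := ShortExact.comp hj hk (W.shortExact_cokπ m₂) s₂
  obtain ⟨hZ⟩ := W.cok_isInitial m₂ h₂
  have := hv.isIso_left hZ
  exact W.star_of_isIso HP v

theorem ShortExact.exists_star {A B X D Z Z' : C.Ob} {f : C.HomM A B} {h : C.HomM B D}
    {k : C.HomM X D} {p : C.HomE Z B} {q : C.HomE Z' D} {m : C.HomM Z Z'}
    (hf : W.ShortExact f p) (hk : W.ShortExact k q) (s : C.Sq m p q h) (hm : IsIso m) :
    ∃ g : C.HomM A X, IsStarPushout W.goodM f g h k := by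
  obtain ⟨g, H⟩ := hf.exists_good hk s
  exact ⟨g, hf.star_of_isIso hk s hm H⟩

/-- The cokernel of `B ⋆_A X ⟶ D` is the cokernel of `B / A ⟶ D / X`. -/
theorem ShortExact.south {A B X D P Z Z' R : C.Ob} {f : C.HomM A B} {g : C.HomM A X}
    {i : C.HomM B P} {j : C.HomM X P} {v : C.HomM P D} {p : C.HomE Z B} {q : C.HomE Z' D}
    {m : C.HomM Z Z'} {t : C.HomE R Z'} (hf : W.ShortExact f p) (hk : W.ShortExact (j ≫ v) q)
    (s : C.Sq m p q (i ≫ v)) (ht : W.ShortExact m t) (H : IsStarPushout W.goodM f g i j) :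
    W.ShortExact v (t ≫ q) := by
  -- The preimage `L` in `D` of the subobject `B/A` of `D/X` satisfies `L/X = B/A`, so it is the
  -- ⋆-pushout, and its cokernel in `D` is that of `m`.
  obtain ⟨L, l, e, c, ⟨s'⟩, hc, hcl⟩ := hk.exists_preimage m
  have s'' : C.Sq (C.idM Z ≫ m) p q (i ≫ v) := by rwa [Category.id_comp]
  obtain ⟨x, hx, ⟨sx⟩⟩ := ShortExact.dist_lift hc (hcl ▸ hk) s' s''
  obtain ⟨g', H'⟩ := hf.exists_star hc sx inferInstance
  have hl := ShortExact.comp hc (hcl ▸ hk) ht s'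
  have e₁ : g' = g := by
    have := W.monoM c
    have := W.monoM l
    have := H.good.1
    rw [← cancel_mono c, ← cancel_mono l, H'.good.1, Category.assoc, Category.assoc, hx, hcl,
      reassoc_of% this]
  subst e₁
  obtain ⟨n, hn, h₁, h₂⟩ := W.star_unique H' H
  refine hl.iso_left n hn (W.star_hom_ext H' ?_ ?_)
  · rw [reassoc_of% h₁, hx]
  · rw [reassoc_of% h₂, hcl]

/-! ## Good cubes -/

/-- By `south` the cokernels of the southern maps are the composites `cokπ m ≫ q` and `cokπ m' ≫
q'`. Hence goodness of the southern square amounts to a pseudo-commutative square over `d`. Pasting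
with `sr`, or cancelling it by (PBL), passes to a square over `r`, which amounts to goodness of the
square on `m` and `m'`. -/
theorem ShortExact.isGoodCube_iff {A B X D A' B' X' D' Z Y Z' Y' : C.Ob}
    {f : C.HomM A B} {g : C.HomM A X} {h : C.HomM B D} {k : C.HomM X D}
    {f' : C.HomM A' B'} {g' : C.HomM A' X'} {h' : C.HomM B' D'} {k' : C.HomM X' D'}
    {a : C.HomM A A'} {b : C.HomM B B'} {c : C.HomM X X'} {d : C.HomM D D'}
    {p : C.HomE Z B} {q : C.HomE Y D} {p' : C.HomE Z' B'} {q' : C.HomE Y' D'}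
    {m : C.HomM Z Y} {m' : C.HomM Z' Y'} {r : C.HomM Y Y'}
    (hf : W.ShortExact f p) (hk : W.ShortExact k q) (hf' : W.ShortExact f' p')
    (hk' : W.ShortExact k' q') (s : C.Sq m p q h) (s' : C.Sq m' p' q' h')
    (sr : C.Sq r q q' d) :
    IsGoodCube W.goodM f g h k f' g' h' k' a b c d ↔
      (GoodSq W.goodM f g h k ∧ GoodSq W.goodM f' g' h' k' ∧
        GoodSq W.goodM f a b f' ∧ GoodSq W.goodM g a c g' ∧ GoodSq W.goodM h b d h' ∧
        GoodSq W.goodM k c d k') ∧ ∃ z : C.HomM Z Z', GoodSq W.goodM m z r m' := by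
  have ht := W.shortExact_cokπ m
  have ht' := W.shortExact_cokπ m'
  constructor
  · rintro ⟨h₁, h₂, h₃, h₄, h₅, h₆, S, S', i, j, i', j', x, y, y', H, H', -, ⟨rfl, rfl⟩,
      ⟨rfl, rfl⟩, G⟩
    refine ⟨⟨h₁, h₂, h₃, h₄, h₅, h₆⟩, ?_⟩
    have hy := ShortExact.south hf hk s ht H
    have hy' := ShortExact.south hf' hk' s' ht' H'
    obtain ⟨n, ⟨sn⟩⟩ := hy.exists_sq hy' G
    obtain ⟨sn'⟩ := W.pblE sr sn
    exact ht.exists_good ht' sn'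
  · rintro ⟨⟨h₁, h₂, h₃, h₄, h₅, h₆⟩, z, Hz⟩
    obtain ⟨S, i, j, H⟩ := W.exists_starM h₁
    obtain ⟨S', i', j', H'⟩ := W.exists_starM h₂
    obtain ⟨y, ⟨rfl, rfl⟩, -⟩ := H.desc _ _ h₁
    obtain ⟨y', ⟨rfl, rfl⟩, -⟩ := H'.desc _ _ h₂
    obtain ⟨x, hx₁, hx₂, -, -⟩ := W.star_map H H' h₃ h₄
    have hy := ShortExact.south hf hk s ht H
    have hy' := ShortExact.south hf' hk' s' ht' H'
    obtain ⟨n, ⟨sn⟩⟩ := ht.exists_sq ht' Hz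
    refine ⟨h₁, h₂, h₃, h₄, h₅, h₆, S, S', i, j, i', j', x, y, y', H, H', ⟨hx₁, hx₂⟩, ⟨rfl, rfl⟩,
      ⟨rfl, rfl⟩, hy.good_of_sq hy' (C.vcomp sn sr) (W.star_hom_ext H ?_ ?_)⟩
    · have := h₅.1
      rw [reassoc_of% hx₁, this, Category.assoc]
    · have := h₆.1
      rw [reassoc_of% hx₂, this, Category.assoc]

variable (W)

theorem IsGoodCube_symm {A B X D A' B' X' D' : C.Ob}
    {f : C.HomM A B} {g : C.HomM A X} {h : C.HomM B D} {k : C.HomM X D}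
    {f' : C.HomM A' B'} {g' : C.HomM A' X'} {h' : C.HomM B' D'} {k' : C.HomM X' D'}
    {a : C.HomM A A'} {b : C.HomM B B'} {c : C.HomM X X'} {d : C.HomM D D'}
    (H : IsGoodCube W.goodM f g h k f' g' h' k' a b c d) :
    IsGoodCube W.goodM g f k h g' f' k' h' a c b d := by
  obtain ⟨h₁, h₂, h₃, h₄, h₅, h₆, S, S', i, j, i', j', x, y, y', HS, HS', e₁, e₂, e₃, G⟩ := H
  exact ⟨W.good_symmM h₁, W.good_symmM h₂, h₄, h₃, h₆, h₅, S, S', j, i, j', i', x, y, y',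
    W.star_symm HS, W.star_symm HS', e₁.symm, e₂.symm, e₃.symm, G⟩

/-- The southern square of a good cube is good, for any choice of the ⋆-pushouts. -/
theorem IsGoodCube_south {A B X D A' B' X' D' S S' : C.Ob}
    {f : C.HomM A B} {g : C.HomM A X} {h : C.HomM B D} {k : C.HomM X D}
    {f' : C.HomM A' B'} {g' : C.HomM A' X'} {h' : C.HomM B' D'} {k' : C.HomM X' D'}
    {a : C.HomM A A'} {b : C.HomM B B'} {c : C.HomM X X'} {d : C.HomM D D'}
    {i : C.HomM B S} {j : C.HomM X S} {i' : C.HomM B' S'} {j' : C.HomM X' S'}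
    {x : C.HomM S S'} {y : C.HomM S D} {y' : C.HomM S' D'}
    (G : IsGoodCube W.goodM f g h k f' g' h' k' a b c d)
    (H : IsStarPushout W.goodM f g i j) (H' : IsStarPushout W.goodM f' g' i' j')
    (hx : i ≫ x = b ≫ i') (hx' : j ≫ x = c ≫ j') (hy : i ≫ y = h) (hy' : j ≫ y = k)
    (hz : i' ≫ y' = h') (hz' : j' ≫ y' = k') : GoodSq W.goodM y x d y' := by
  obtain ⟨-, -, -, -, h₅, h₆, T, T', i₁, j₁, i₁', j₁', x₁, y₁, y₁', H₁, H₁', ⟨e₁, e₁'⟩, ⟨e₂, e₂'⟩,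
    ⟨e₃, e₃'⟩, G⟩ := G
  obtain ⟨n, hn, n₁, n₂⟩ := W.star_unique H H₁
  obtain ⟨n', hn', n₁', n₂'⟩ := W.star_unique H₁' H'
  have c₁ : n ≫ y₁ = y := W.star_hom_ext H (by rw [reassoc_of% n₁, e₂, hy])
    (by rw [reassoc_of% n₂, e₂', hy'])
  have c₂ : n' ≫ y' = y₁' := W.star_hom_ext H₁' (by rw [reassoc_of% n₁', e₃, hz])
    (by rw [reassoc_of% n₂', e₃', hz'])
  have c₃ : n ≫ x₁ ≫ n' = x := W.star_hom_ext H
    (by rw [reassoc_of% n₁, reassoc_of% e₁, n₁', hx])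
    (by rw [reassoc_of% n₂, reassoc_of% e₁', n₂', hx'])
  have t₁ : GoodSq W.goodM y n (C.idM D) y₁ := W.triangleM hn (by simpa using c₁)
  have t₂ : GoodSq W.goodM y₁' n' (C.idM D') y' := W.triangleM hn' (by simpa using c₂)
  have := W.good_vcomp t₁ (W.good_vcomp G t₂)
  rw [c₃, Category.id_comp, Category.comp_id] at this
  exact this

theorem IsGoodCube_of_south {A B X D A' B' X' D' S S' : C.Ob}
    {f : C.HomM A B} {g : C.HomM A X} {h : C.HomM B D} {k : C.HomM X D}
    {f' : C.HomM A' B'} {g' : C.HomM A' X'} {h' : C.HomM B' D'} {k' : C.HomM X' D'}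
    {a : C.HomM A A'} {b : C.HomM B B'} {c : C.HomM X X'} {d : C.HomM D D'}
    {i : C.HomM B S} {j : C.HomM X S} {i' : C.HomM B' S'} {j' : C.HomM X' S'}
    {x : C.HomM S S'} {y : C.HomM S D} {y' : C.HomM S' D'}
    (H : IsStarPushout W.goodM f g i j) (H' : IsStarPushout W.goodM f' g' i' j')
    (hf : GoodSq W.goodM f a b f') (hg : GoodSq W.goodM g a c g')
    (hh : GoodSq W.goodM h b d h') (hk : GoodSq W.goodM k c d k')
    (hx : i ≫ x = b ≫ i') (hx' : j ≫ x = c ≫ j') (hy : i ≫ y = h) (hy' : j ≫ y = k)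
    (hz : i' ≫ y' = h') (hz' : j' ≫ y' = k') (G : GoodSq W.goodM y x d y') :
    IsGoodCube W.goodM f g h k f' g' h' k' a b c d :=
  ⟨hy ▸ hy' ▸ W.good_enlarge H.good y, hz ▸ hz' ▸ W.good_enlarge H'.good y', hf, hg, hh, hk,
    S, S', i, j, i', j', x, y, y', H, H', ⟨hx, hx'⟩, ⟨hy, hy'⟩, ⟨hz, hz'⟩, G⟩

end PreStarCGW

end CGW

namespace CGW

namespace PreStarCGW

variable {C : DoubleCategory.{u, v, w}} {W : PreStarCGW C}

/-! ## Quotients of ⋆-pushouts -/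

section Quotient

variable {F G H P KF KG KH KP F' G' H' P' : C.Ob}
  {f : C.HomM F G} {g : C.HomM F H} {i : C.HomM G P} {j : C.HomM H P}
  {f' : C.HomM F' G'} {g' : C.HomM F' H'} {i' : C.HomM G' P'} {j' : C.HomM H' P'}
  {a : C.HomM KF KG} {b : C.HomM KF KH} {α : C.HomM KG KP} {β : C.HomM KH KP}
  {κF : C.HomM KF F} {κG : C.HomM KG G} {κH : C.HomM KH H} {κP : C.HomM KP P}
  {φ : C.HomE F' F} {γ : C.HomE G' G} {χ : C.HomE H' H}

/-- The filtration of `G ⋆_F H` given by subobjects of `F`, `G` and `H`. -/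
theorem exists_star_filtration (HP : IsStarPushout W.goodM f g i j)
    (HK : IsStarPushout W.goodM a b α β) (hf : GoodSq W.goodM a κF κG f)
    (hg : GoodSq W.goodM b κF κH g) (hα : α ≫ κP = κG ≫ i) (hβ : β ≫ κP = κH ≫ j) :
    ∃ (R N : C.Ob) (s : C.HomM F R) (r : C.HomM KG R) (t : C.HomM R G) (n : C.HomM H N)
      (l : C.HomM KP N) (x : C.HomM R N) (z : C.HomM N P),
      IsStarPushout W.goodM κF a s r ∧ s ≫ t = f ∧ r ≫ t = κG ∧
      IsStarPushout W.goodM κH β n l ∧ n ≫ z = j ∧ l ≫ z = κP ∧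
      IsStarPushout W.goodM t x i z := by
  obtain ⟨κ, hκ₁, hκ₂, hκ₃, hκ₄⟩ := W.star_map HK HP hf hg
  obtain rfl : κ = κP := W.star_hom_ext HK (by rw [hκ₁, hα]) (by rw [hκ₂, hβ])
  -- Think of `R` as `F + KG` inside `G` and of `N` as `H + KP` inside `P`. Pasting and cancellation
  -- of ⋆-pushouts give `N = R ⋆_F H`, and then `P = G ⋆_R N`.
  obtain ⟨R, s, r, HR⟩ := W.exists_starM (W.good_symmM hf)
  obtain ⟨t, ⟨ht₁, ht₂⟩, -⟩ := HR.desc _ _ (W.good_symmM hf)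
  obtain ⟨N, n, l, HN⟩ := W.exists_starM (W.good_symmM hκ₄)
  have h₁ := W.star_paste HK (W.star_symm HN)
  rw [← hg.1] at h₁
  obtain ⟨x, hx₁, hx₂, Hx⟩ := W.star_cancel (W.star_symm HR) h₁
  have h₂ := W.star_symm HP
  rw [← ht₁] at h₂
  obtain ⟨z, hz₁, hz₂, Hz⟩ := W.star_cancel (W.star_symm Hx) h₂
  refine ⟨R, N, s, r, t, n, l, x, z, HR, ht₁, ht₂, HN, hz₁, ?_, W.star_symm Hz⟩
  refine W.star_hom_ext HK ?_ ?_
  · rw [← reassoc_of% hx₁, hz₂, reassoc_of% ht₂, hα]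
  · have := HN.good.1
    rw [reassoc_of% this, hz₁, hβ]

/-- The kernels of a quotient of a span with a ⋆-pushout have a ⋆-pushout. -/
theorem exists_star_ker (HP : IsStarPushout W.goodM f g i j)
    (hF : W.ShortExact κF φ) (hG : W.ShortExact κG γ) (hH : W.ShortExact κH χ)
    (sf : C.Sq f' φ γ f) (sg : C.Sq g' φ χ g) :
    ∃ (KP : C.Ob) (a : C.HomM KF KG) (b : C.HomM KF KH) (α : C.HomM KG KP) (β : C.HomM KH KP)
      (κP : C.HomM KP P), GoodSq W.goodM a κF κG f ∧ GoodSq W.goodM b κF κH g ∧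
      IsStarPushout W.goodM a b α β ∧ α ≫ κP = κG ≫ i ∧ β ≫ κP = κH ≫ j ∧
      GoodSq W.goodM κG α i κP ∧ GoodSq W.goodM κH β j κP := by
  obtain ⟨a, ha⟩ := hF.exists_good hG sf
  obtain ⟨b, hb⟩ := hF.exists_good hH sg
  have h := W.good_vcomp (W.good_symmM ha) HP.good
  rw [← hb.1] at h
  -- The span of kernels is completed to a good square by `P` itself, so that (PO), which is not
  -- self-dual, is not needed.
  obtain ⟨KP, α, β, HK⟩ := W.exists_starM (W.good_shrink h)
  obtain ⟨κ, h₁, h₂, h₃, h₄⟩ := W.star_map HK HP (W.good_symmM ha) (W.good_symmM hb)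
  exact ⟨KP, a, b, α, β, κ, W.good_symmM ha, W.good_symmM hb, HK, h₁, h₂, W.good_symmM h₃,
    W.good_symmM h₄⟩

/-- A ⋆-pushout of quotients is a quotient of the ⋆-pushout. -/
theorem exists_quotient_star (HP : IsStarPushout W.goodM f g i j)
    (HP' : IsStarPushout W.goodM f' g' i' j') (sf : C.Sq f' φ γ f) (sg : C.Sq g' φ χ g) :
    ∃ x : C.HomE P' P, Nonempty (C.Sq i' γ x i) ∧ Nonempty (C.Sq j' χ x j) := by
  have hF := W.shortExact_kerι φ
  have hG := W.shortExact_kerι γ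
  have hH := W.shortExact_kerι χ
  obtain ⟨KP, a, b, α, β, κP, hf, hg, HK, hα, hβ, hκ₁, hκ₂⟩ := exists_star_ker HP hF hG hH sf sg
  obtain ⟨R, N, s, r, t, n, l, y, z, HR, ht₁, ht₂, HN, hz₁, hz₂, Hz⟩ :=
    exists_star_filtration HP HK hf hg hα hβ
  -- The quotient of `P` by the ⋆-pushout of the kernels is the candidate; it remains to recognise
  -- it as `G' ⋆_F' H'`.
  let q := W.cokπ κP
  have hP : W.ShortExact κP q := W.shortExact_cokπ κP
  obtain ⟨mG, ⟨sG⟩⟩ := hG.exists_sq hP hκ₁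
  obtain ⟨mH, ⟨sH⟩⟩ := hH.exists_sq hP hκ₂
  have hf' := W.shortExact_cokπ f'
  have hm := W.shortExact_cokπ mH
  have ht : W.ShortExact t (W.cokπ f' ≫ γ) :=
    ShortExact.south hF (by rw [ht₂]; exact hG) (by rw [ht₁]; exact sf) hf' HR
  have hz : W.ShortExact z (W.cokπ mH ≫ q) :=
    ShortExact.south hH (by rw [hz₂]; exact hP) (by rw [hz₁]; exact sH) hm HN
  -- Since `P = G ⋆_R N`, the cokernel of `R ⟶ G` is that of `N ⟶ P`. These are `G'/F'` and
  -- `(P/KP)/H'`, and their isomorphism makes `P/KP` a ⋆-pushout.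
  obtain ⟨m, ⟨sm⟩⟩ := ht.exists_sq hz Hz.good
  have him := ht.star_isIso hz sm Hz
  obtain ⟨sm'⟩ := W.pblE sG sm
  obtain ⟨g₁, HQ⟩ := hf'.exists_star hm sm' him
  have e : g₁ = g' := by
    have := W.monoM mH
    have h₂ := C.hcomp sg sH
    rw [HP.good.1] at h₂
    rw [← cancel_mono mH, HQ.good.1, W.top_unique (C.hcomp sf sG) h₂]
  subst e
  obtain ⟨θ, hθ, e₁, e₂⟩ := W.star_unique HP' HQ
  obtain ⟨sθ⟩ := W.sq_top_iso (asIso θ) q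
  refine ⟨(W.toE (asIso θ)).hom ≫ q, ?_, ?_⟩
  · refine W.pblM sθ ?_
    rw [Category.comp_id]
    exact e₁.symm ▸ sG
  · refine W.pblM sθ ?_
    rw [Category.comp_id]
    exact e₂.symm ▸ sH

variable {Y Y' K : C.Ob} {y : C.HomE Y' Y} {κ : C.HomM K Y} {h : C.HomM P Y} {h' : C.HomM P' Y'}

/-- In the presence of a common ambient object, the quotient map between ⋆-pushouts
is compatible with it, and its kernel is the ⋆-pushout of the kernels. -/
theorem exists_quotient_star_of_ambient (HP : IsStarPushout W.goodM f g i j)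
    (HP' : IsStarPushout W.goodM f' g' i' j') (HK : IsStarPushout W.goodM a b α β)
    (hF : W.ShortExact κF φ) (hG : W.ShortExact κG γ) (hH : W.ShortExact κH χ)
    (sf : C.Sq f' φ γ f) (hf : GoodSq W.goodM a κF κG f)
    (hg : GoodSq W.goodM b κF κH g) (hα : α ≫ κP = κG ≫ i) (hβ : β ≫ κP = κH ≫ j)
    (sG : C.Sq (i' ≫ h') γ y (i ≫ h)) (sH : C.Sq (j' ≫ h') χ y (j ≫ h)) :
    ∃ x : C.HomE P' P, W.ShortExact κP x ∧ Nonempty (C.Sq h' x y h) := by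
  have hy := W.shortExact_kerι y
  -- the preimages of `P'`, `G'`, `H'` and `F'`
  obtain ⟨L, l, e, c, ⟨s⟩, hc, hcl⟩ := hy.exists_preimage h'
  obtain ⟨LG, lG, eG, cG, ⟨tG⟩, hcG, hclG⟩ := hc.exists_preimage i'
  obtain ⟨LH, lH, eH, cH, ⟨tH⟩, hcH, hclH⟩ := hc.exists_preimage j'
  obtain ⟨LF, lF, eF, cF, ⟨tF⟩, hcF, hclF⟩ := hcG.exists_preimage f'
  have hcl' : W.ShortExact (c ≫ l) y := hcl ▸ hy
  have hclG' : W.ShortExact (cG ≫ lG ≫ l) y := by rw [reassoc_of% hclG, hcl]; exact hy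
  have hclH' : W.ShortExact (cH ≫ lH ≫ l) y := by rw [reassoc_of% hclH, hcl]; exact hy
  have hclF' : W.ShortExact (cF ≫ lF ≫ lG ≫ l) y := by
    rw [reassoc_of% hclF, reassoc_of% hclG, hcl]; exact hy
  have tG' := C.hcomp tG s
  have tH' := C.hcomp tH s
  have tF' := C.hcomp tF tG'
  have sF := C.hcomp sf sG
  obtain ⟨uG, euG, ⟨suG⟩⟩ := ShortExact.dist_lift (m := C.idM G') hcG hclG' tG'
    (by rw [Category.id_comp]; exact sG)
  obtain ⟨uH, euH, ⟨suH⟩⟩ := ShortExact.dist_lift (m := C.idM H') hcH hclH' tH'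
    (by rw [Category.id_comp]; exact sH)
  obtain ⟨uF, euF, ⟨suF⟩⟩ := ShortExact.dist_lift (m := C.idM F') hcF hclF' tF'
    (by rw [Category.id_comp]; exact sF)
  -- `G` modulo `KG` and `LG` modulo `K` are both `G'`, so `LG = G ⋆_KG K`; likewise for `H` and
  -- `F`.
  obtain ⟨vG, HLG⟩ := hG.exists_star hcG suG inferInstance
  obtain ⟨vH, HLH⟩ := hH.exists_star hcH suH inferInstance
  obtain ⟨vF, HLF⟩ := hF.exists_star hcF suF inferInstance
  have mY := W.monoM (W.kerι y)
  have ml := W.monoM l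
  have mlG := W.monoM lG
  have mlH := W.monoM lH
  -- `L = LG ⋆_LF LH`
  have hf' := W.shortExact_cokπ f'
  have hj' := W.shortExact_cokπ j'
  have hlF : W.ShortExact lF (W.cokπ f' ≫ eG) :=
    ShortExact.comp hcF (by rw [hclF]; exact hcG) hf' tF
  have hlH : W.ShortExact lH (W.cokπ j' ≫ e) :=
    ShortExact.comp hcH (by rw [hclH]; exact hc) hj' tH
  -- The cokernel of `lF` is `G'/F'` and that of `lH` is `P'/H'`; they agree because `P'` is a
  -- ⋆-pushout.
  obtain ⟨m, ⟨sm⟩⟩ := hf'.exists_sq hj' HP'.good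
  have him := hf'.star_isIso hj' sm HP'
  obtain ⟨n, HL⟩ := hlF.exists_star hlH (C.vcomp sm tG) him
  have en := HL.good.1
  -- the map `KP ⟶ K`
  have kG : κG ≫ uG = vG ≫ cG := HLG.good.1.symm
  have kH : κH ≫ uH = vH ≫ cH := HLH.good.1.symm
  have kF : κF ≫ uF = vF ≫ cF := HLF.good.1.symm
  have kG' : vG ≫ W.kerι y = κG ≫ i ≫ h := by
    rw [← hcl, ← hclG, Category.assoc, ← reassoc_of% kG, euG]
  have kH' : vH ≫ W.kerι y = κH ≫ j ≫ h := by
    rw [← hcl, ← hclH, Category.assoc, ← reassoc_of% kH, euH]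
  -- Goodness is tested in `Y`, where the square is an enlargement of the ⋆-pushout square of the
  -- kernels.
  have gK : GoodSq W.goodM a b vG vH := by
    refine W.good_reflect (d := W.kerι y) ?_
    rw [kG', kH', ← reassoc_of% hα, ← reassoc_of% hβ]
    exact W.good_enlarge HK.good (κP ≫ h)
  obtain ⟨v, ⟨ev₁, ev₂⟩, -⟩ := HK.desc _ _ gK
  obtain ⟨R, N, s', r, t, n', k, x, z, HR, ht₁, ht₂, HN, hz₁, hz₂, Hz⟩ :=
    exists_star_filtration HP HK hf hg hα hβ
  -- `LH = N ⋆_KP K`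
  rw [← ev₂] at HLH
  obtain ⟨w₁, ew₁, ew₁', H₁⟩ := W.star_cancel HN HLH
  -- `LF = R ⋆_KG K`
  have evF : vF = a ≫ vG := by
    rw [← cancel_mono (W.kerι y), Category.assoc, kG', ← hcl, ← hclG, ← hclF]
    have := hf.1
    rw [← reassoc_of% this, ← euF, reassoc_of% kF]
    simp only [Category.assoc]
  rw [evF] at HLF
  obtain ⟨w₂, ew₂, ew₂', H₂⟩ := W.star_cancel HR HLF
  -- `LG = G ⋆_R LF`
  rw [← ht₂] at HLG
  obtain ⟨w₃, ew₃, ew₃', H₃⟩ := W.star_cancel (W.star_symm H₂) (W.star_symm HLG)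
  have e₁ : w₂ ≫ lF = t ≫ uG := by
    rw [← cancel_mono lG, ← cancel_mono l]
    simp only [Category.assoc]
    rw [euG]
    refine W.star_hom_ext HR ?_ ?_
    · rw [reassoc_of% ew₂, reassoc_of% ht₁, euF]
    · rw [reassoc_of% ew₂', reassoc_of% ht₂, reassoc_of% hclF, reassoc_of% hclG, hcl, kG']
  obtain rfl : w₃ = lF := W.star_hom_ext H₂ (by rw [ew₃', e₁]) (by rw [ew₃, hclF])
  -- `L = G ⋆_R LH`
  have H₄ := W.star_paste (W.star_symm H₃) HL
  have ev : v ≫ W.kerι y = κP ≫ h := by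
    refine W.star_hom_ext HK ?_ ?_
    · rw [reassoc_of% ev₁, reassoc_of% hα, kG']
    · rw [reassoc_of% ev₂, reassoc_of% hβ, kH']
  have e₂ : w₁ ≫ lH ≫ l = z ≫ h := by
    refine W.star_hom_ext HN ?_ ?_
    · rw [reassoc_of% ew₁, euH, reassoc_of% hz₁]
    · rw [reassoc_of% ew₁', reassoc_of% hclH, hcl, ev, reassoc_of% hz₂]
  have e₃ : w₂ ≫ n = x ≫ w₁ := by
    rw [← cancel_mono lH, ← cancel_mono l]
    simp only [Category.assoc]
    have h₁ := Hz.good.1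
    rw [e₂, reassoc_of% en, reassoc_of% e₁, euG, reassoc_of% h₁]
  rw [e₃] at H₄
  -- `L = P ⋆_N LH = P ⋆_KP K`
  obtain ⟨p, ep₁, ep₂, H₅⟩ := W.star_cancel Hz H₄
  have H₆ := W.star_symm (W.star_paste (W.star_symm H₁) (W.star_symm H₅))
  rw [hz₂, hclH] at H₆
  have ep : p ≫ l = h := W.star_hom_ext HP (by rw [reassoc_of% ep₁, euG])
    (by rw [← hz₁, Category.assoc, reassoc_of% ep₂, reassoc_of% ew₁, euH, hz₁])
  have hP := W.shortExact_cokπ κP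
  -- From `L = P ⋆_KP K` the cokernels of `κP` and of `c` agree, and the latter is `P'`. This yields
  -- the quotient map, and pasting with `s` gives its compatibility with `y`.
  obtain ⟨m₀, ⟨s₀⟩⟩ := hP.exists_sq hc H₆.good
  have := hP.star_isIso hc s₀ H₆
  obtain ⟨s₁⟩ := sq_of_iso (W := W) s₀ (inv m₀) inferInstance
  have s₂ := C.hcomp s₁ s
  rw [IsIso.inv_hom_id, Category.id_comp, ep] at s₂
  refine ⟨_, hP.iso_right (inv (W.toE (asIso (inv m₀))).hom) inferInstance ?_, ⟨s₂⟩⟩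
  simp

/-- The ambient object is taken to be `P` itself with identity maps; the square so obtained forces
the resulting e-morphism to be `x`. -/
theorem quotient_star_shortExact (HP : IsStarPushout W.goodM f g i j)
    (HP' : IsStarPushout W.goodM f' g' i' j') (HK : IsStarPushout W.goodM a b α β)
    (hF : W.ShortExact κF φ) (hG : W.ShortExact κG γ) (hH : W.ShortExact κH χ)
    (sf : C.Sq f' φ γ f) (hf : GoodSq W.goodM a κF κG f)
    (hg : GoodSq W.goodM b κF κH g) (hα : α ≫ κP = κG ≫ i) (hβ : β ≫ κP = κH ≫ j)
    {x : C.HomE P' P} (sG : C.Sq i' γ x i) (sH : C.Sq j' χ x j) : W.ShortExact κP x := by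
  obtain ⟨x', hx', ⟨s⟩⟩ := exists_quotient_star_of_ambient (h := C.idM P) (h' := C.idM P') HP HP'
    HK hF hG hH sf hf hg hα hβ (by simpa using sG) (by simpa using sH)
  rwa [W.left_unique (C.hid x) s]

/-- The quotient map between ⋆-pushouts is unique. -/
theorem quotient_star_unique (HP : IsStarPushout W.goodM f g i j)
    (HP' : IsStarPushout W.goodM f' g' i' j') (sf : C.Sq f' φ γ f) (sg : C.Sq g' φ χ g)
    {x₁ x₂ : C.HomE P' P} (sG₁ : C.Sq i' γ x₁ i) (sH₁ : C.Sq j' χ x₁ j)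
    (sG₂ : C.Sq i' γ x₂ i) (sH₂ : C.Sq j' χ x₂ j) : x₁ = x₂ := by
  have hF := W.shortExact_kerι φ
  have hG := W.shortExact_kerι γ
  have hH := W.shortExact_kerι χ
  obtain ⟨KP, a, b, α, β, κP, hf, hg, HK, hα, hβ, hκ₁, hκ₂⟩ := exists_star_ker HP hF hG hH sf sg
  have h₁ := quotient_star_shortExact HP HP' HK hF hG hH sf hf hg hα hβ sG₁ sH₁
  have h₂ := quotient_star_shortExact HP HP' HK hF hG hH sf hf hg hα hβ sG₂ sH₂
  -- Both maps are cokernels of `κP`, so they differ by an automorphism of `P'`; it is compatible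
  -- with `i'` and `j'`, hence the identity.
  obtain ⟨m, hm, ⟨s⟩⟩ := h₁.exists_sq_id h₂
  have e : m = C.idM P' := by
    have hi := C.hcomp sG₁ s
    have hj := C.hcomp sH₁ s
    rw [Category.comp_id] at hi hj
    refine W.star_hom_ext HP' ?_ ?_
    · rw [W.top_unique hi sG₂, Category.comp_id]
    · rw [W.top_unique hj sH₂, Category.comp_id]
  subst e
  exact W.left_unique s (C.hid x₂)

/-- The ambient construction yields some e-morphism with the desired square. By (PBL) it is
compatible with `i` and `j`, and uniqueness identifies it with `x`. -/
theorem quotient_star_sq (HP : IsStarPushout W.goodM f g i j)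
    (HP' : IsStarPushout W.goodM f' g' i' j') (sf : C.Sq f' φ γ f) (sg : C.Sq g' φ χ g)
    {x : C.HomE P' P} (sG : C.Sq i' γ x i) (sH : C.Sq j' χ x j)
    (sG' : C.Sq (i' ≫ h') γ y (i ≫ h)) (sH' : C.Sq (j' ≫ h') χ y (j ≫ h)) :
    Nonempty (C.Sq h' x y h) := by
  have hF := W.shortExact_kerι φ
  have hG := W.shortExact_kerι γ
  have hH := W.shortExact_kerι χ
  obtain ⟨KP, a, b, α, β, κP, hf, hg, HK, hα, hβ, hκ₁, hκ₂⟩ := exists_star_ker HP hF hG hH sf sg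
  obtain ⟨x', -, ⟨s⟩⟩ := exists_quotient_star_of_ambient HP HP' HK hF hG hH sf hf hg hα hβ sG' sH'
  obtain ⟨s₁⟩ := W.pblM s sG'
  obtain ⟨s₂⟩ := W.pblM s sH'
  rw [quotient_star_unique HP HP' sf sg sG sH s₁ s₂]
  exact ⟨s⟩

end Quotient

end PreStarCGW

end CGW

namespace CGW

variable {D : DoubleCategory.{u', v', w'}} {C : DoubleCategory.{u, v, w}}

/-! ## Double functors and pointwise natural transformations -/

/-- The transpose of a double functor. -/
@[reducible]
def DoubleFunctor.transpose (F : DoubleFunctor D C) : DoubleFunctor D.transpose C.transpose where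
  obj a := F.obj a
  mapM g := F.mapE g
  mapE f := F.mapM f
  mapM_id a := F.mapE_id a
  mapM_comp g h := F.mapE_comp g h
  mapE_id a := F.mapM_id a
  mapE_comp f h := F.mapM_comp f h
  mapSq s := F.mapSq s
  mapSq_hid f := F.mapSq_vid f
  mapSq_vid g := F.mapSq_hid g
  mapSq_hcomp s t := F.mapSq_vcomp s t
  mapSq_vcomp s t := F.mapSq_hcomp s t

/-- The double functor with a given transpose. -/
@[reducible]
def DoubleFunctor.untranspose (F : DoubleFunctor D.transpose C.transpose) : DoubleFunctor D C where
  obj a := F.obj a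
  mapM g := F.mapE g
  mapE f := F.mapM f
  mapM_id a := F.mapE_id a
  mapM_comp g h := F.mapE_comp g h
  mapE_id a := F.mapM_id a
  mapE_comp f h := F.mapM_comp f h
  mapSq s := F.mapSq s
  mapSq_hid f := F.mapSq_vid f
  mapSq_vid g := F.mapSq_hid g
  mapSq_hcomp s t := F.mapSq_vcomp s t
  mapSq_vcomp s t := F.mapSq_hcomp s t

namespace PreStarCGW

variable (W : PreStarCGW C)

theorem sq_heq (W : PreStarCGW C) {A B A' B' : C.Ob} {f f₁ : C.HomM A B} {g g₁ : C.HomE A A'}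
    {g' g₁' : C.HomE B B'} {f' f₁' : C.HomM A' B'} (hf : f = f₁) (hg : g = g₁) (hg' : g' = g₁')
    (hf' : f' = f₁') (s : C.Sq f g g' f') (t : C.Sq f₁ g₁ g₁' f₁') : HEq s t :=
  DoubleCategory.heq_of_subsingleton (Sq := C.Sq)
    (fun f g g' f' => W.sq_subsingleton f g g' f') hf hg hg' hf' s t

/-- A double functor, from its action on objects and morphisms. -/
noncomputable def mkFunctor (W : PreStarCGW C) (obj : D.Ob → C.Ob)
    (mapM : ∀ {a b : D.Ob}, D.HomM a b → C.HomM (obj a) (obj b))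
    (mapE : ∀ {a b : D.Ob}, D.HomE a b → C.HomE (obj a) (obj b))
    (mapM_id : ∀ a : D.Ob, mapM (D.idM a) = C.idM (obj a))
    (mapM_comp : ∀ {a b c : D.Ob} (f : D.HomM a b) (f' : D.HomM b c),
      mapM (f ≫ f') = mapM f ≫ mapM f')
    (mapE_id : ∀ a : D.Ob, mapE (D.idE a) = C.idE (obj a))
    (mapE_comp : ∀ {a b c : D.Ob} (g : D.HomE a b) (g' : D.HomE b c),
      mapE (g ≫ g') = mapE g ≫ mapE g')
    (mapSq : ∀ {a b a' b' : D.Ob} {f : D.HomM a b} {g : D.HomE a a'} {g' : D.HomE b b'}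
      {f' : D.HomM a' b'}, D.Sq f g g' f' →
      Nonempty (C.Sq (mapM f) (mapE g) (mapE g') (mapM f'))) : DoubleFunctor D C where
  obj := obj
  mapM := mapM
  mapE := mapE
  mapM_id := mapM_id
  mapM_comp := mapM_comp
  mapE_id := mapE_id
  mapE_comp := mapE_comp
  mapSq s := (mapSq s).some
  mapSq_hid _ := W.sq_heq (mapM_id _) rfl rfl (mapM_id _) _ _
  mapSq_vid _ := W.sq_heq rfl (mapE_id _) (mapE_id _) rfl _ _
  mapSq_hcomp _ _ := W.sq_heq (mapM_comp _ _) rfl rfl (mapM_comp _ _) _ _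
  mapSq_vcomp _ _ := W.sq_heq rfl (mapE_comp _ _) (mapE_comp _ _) rfl _ _

/-- The components `app` form an m-natural transformation with good naturality squares. -/
structure IsMNat (F G : DoubleFunctor D C) (app : ∀ a : D.Ob, C.HomM (F.obj a) (G.obj a)) :
    Prop where
  sq : ∀ {a b : D.Ob} (g : D.HomE a b),
    Nonempty (C.Sq (app a) (F.mapE g) (G.mapE g) (app b))
  good : ∀ {a b : D.Ob} (f : D.HomM a b),
    GoodSq W.goodM (F.mapM f) (app a) (app b) (G.mapM f)

/-- The components `app` form an e-natural transformation with good naturality squares. -/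
abbrev IsENat (F G : DoubleFunctor D C) (app : ∀ a : D.Ob, C.HomE (F.obj a) (G.obj a)) : Prop :=
  W.transpose.IsMNat F.transpose G.transpose app

/-- The component cubes of a square of m-natural transformations are good. -/
def GoodCubes (F G F' G' : DoubleFunctor D C) (μ : ∀ a : D.Ob, C.HomM (F.obj a) (G.obj a))
    (α : ∀ a : D.Ob, C.HomM (F.obj a) (F'.obj a)) (β : ∀ a : D.Ob, C.HomM (G.obj a) (G'.obj a))
    (μ' : ∀ a : D.Ob, C.HomM (F'.obj a) (G'.obj a)) : Prop :=
  ∀ ⦃a b : D.Ob⦄ (f : D.HomM a b), IsGoodCube W.goodM (μ a) (α a) (β a) (μ' a)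
    (μ b) (α b) (β b) (μ' b) (F.mapM f) (G.mapM f) (F'.mapM f) (G'.mapM f)

variable {W}

section

variable {F G F' G' F'' G'' : DoubleFunctor D C} {μ : ∀ a : D.Ob, C.HomM (F.obj a) (G.obj a)}
  {α : ∀ a : D.Ob, C.HomM (F.obj a) (F'.obj a)} {β : ∀ a : D.Ob, C.HomM (G.obj a) (G'.obj a)}
  {μ' : ∀ a : D.Ob, C.HomM (F'.obj a) (G'.obj a)}
  {α' : ∀ a : D.Ob, C.HomM (F'.obj a) (F''.obj a)}
  {β' : ∀ a : D.Ob, C.HomM (G'.obj a) (G''.obj a)}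
  {μ'' : ∀ a : D.Ob, C.HomM (F''.obj a) (G''.obj a)}

/-- The first factor inherits its e-naturality squares from (PBL) and its good squares from
`good_cancel`. Hence maps that are constructed pointwise into a double functor are natural as soon
as a composite with an m-natural transformation is. -/
theorem IsMNat.of_comp {u : ∀ a : D.Ob, C.HomM (F.obj a) (G.obj a)}
    {v : ∀ a : D.Ob, C.HomM (G.obj a) (G'.obj a)} (hv : W.IsMNat G G' v)
    (huv : W.IsMNat F G' (fun a => u a ≫ v a)) : W.IsMNat F G u where
  sq g := by
    obtain ⟨s⟩ := hv.sq g
    obtain ⟨t⟩ := huv.sq g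
    exact W.pblM s t
  good f := W.good_cancel (huv.good f) (hv.good f).1

theorem IsMNat.comp {u : ∀ a : D.Ob, C.HomM (F.obj a) (G.obj a)}
    {v : ∀ a : D.Ob, C.HomM (G.obj a) (G'.obj a)} (hu : W.IsMNat F G u) (hv : W.IsMNat G G' v) :
    W.IsMNat F G' (fun a => u a ≫ v a) where
  sq g := by
    obtain ⟨s⟩ := hu.sq g
    obtain ⟨t⟩ := hv.sq g
    exact ⟨C.hcomp s t⟩
  good f := W.good_vcomp (hu.good f) (hv.good f)

theorem GoodCubes.good (H : W.GoodCubes F G F' G' μ α β μ') (a : D.Ob) :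
    GoodSq W.goodM (μ a) (α a) (β a) (μ' a) := (H (D.idM a)).1

theorem GoodCubes.symm (H : W.GoodCubes F G F' G' μ α β μ') :
    W.GoodCubes F F' G G' α μ μ' β := fun _ _ f => W.IsGoodCube_symm (H f)

/-- When `α` is invertible the ⋆-pushout is `G` itself, and the southern square is a naturality
square of `β`. -/
theorem goodCubes_of_isIso (hμ : W.IsMNat F G μ) (hα : W.IsMNat F F' α) (hβ : W.IsMNat G G' β)
    (hμ' : W.IsMNat F' G' μ') (hi : ∀ a, IsIso (α a)) (e : ∀ a, α a ≫ μ' a = μ a ≫ β a) :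
    W.GoodCubes F G F' G' μ α β μ' := by
  have star : ∀ a, IsStarPushout W.goodM (μ a) (α a) (C.idM (G.obj a)) (inv (α a) ≫ μ a) := by
    intro a
    refine ⟨W.triangleM (hi a) (by simp), fun i' j' h => ⟨i', ⟨Category.id_comp _, ?_⟩, ?_⟩⟩
    · rw [Category.assoc, ← h.1, IsIso.inv_hom_id_assoc]
    · rintro y ⟨hy, -⟩
      rw [← hy, Category.id_comp]
  intro a b f
  refine W.IsGoodCube_of_south (x := G.mapM f) (y := β a) (y' := β b) (star a) (star b)
    (W.good_symmM (hμ.good f))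
    (W.good_symmM (hα.good f)) (W.good_symmM (hβ.good f)) (W.good_symmM (hμ'.good f))
    (by simp) ?_ (Category.id_comp _) ?_ (Category.id_comp _) ?_ (W.good_symmM (hβ.good f))
  · rw [Category.assoc, IsIso.inv_comp_eq, (hμ.good f).1]
    have := (hα.good f).1
    rw [reassoc_of% this, IsIso.hom_inv_id_assoc]
  · rw [Category.assoc, ← e, IsIso.inv_hom_id_assoc]
  · rw [Category.assoc, ← e, IsIso.inv_hom_id_assoc]

/-- After passage to the cokernels of `μ`, `μ'` and `μ''`, this reduces to pasting good squares. -/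
theorem GoodCubes.comp (H : W.GoodCubes F G F' G' μ α β μ')
    (H' : W.GoodCubes F' G' F'' G'' μ' α' β' μ'') :
    W.GoodCubes F G F'' G'' μ (fun a => α a ≫ α' a) (fun a => β a ≫ β' a) μ'' := by
  intro a b f
  have hμ := fun a => W.shortExact_cokπ (μ a)
  have hμ' := fun a => W.shortExact_cokπ (μ' a)
  have hμ'' := fun a => W.shortExact_cokπ (μ'' a)
  choose m sm using fun a => (hμ a).exists_sq (hμ' a) (H.good a)
  choose m' sm' using fun a => (hμ' a).exists_sq (hμ'' a) (H'.good a)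
  obtain ⟨h₁, h₂, h₃, h₄, h₅, h₆, -⟩ := H f
  obtain ⟨k₁, k₂, k₃, k₄, k₅, k₆, -⟩ := H' f
  obtain ⟨r', ⟨sr'⟩⟩ := (hμ' a).exists_sq (hμ' b) h₆
  obtain ⟨r'', ⟨sr''⟩⟩ := (hμ'' a).exists_sq (hμ'' b) k₆
  obtain ⟨-, z, hz⟩ := (ShortExact.isGoodCube_iff (hμ a) (hμ' a) (hμ b) (hμ' b)
    (sm a).some (sm b).some sr').1 (H f)
  obtain ⟨-, z', hz'⟩ := (ShortExact.isGoodCube_iff (hμ' a) (hμ'' a) (hμ' b) (hμ'' b)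
    (sm' a).some (sm' b).some sr'').1 (H' f)
  refine (ShortExact.isGoodCube_iff (hμ a) (hμ'' a) (hμ b) (hμ'' b)
    (C.hcomp (sm a).some (sm' a).some) (C.hcomp (sm b).some (sm' b).some) sr'').2
    ⟨⟨W.good_vcomp h₁ k₁, W.good_vcomp h₂ k₂, h₃, W.good_hcomp h₄ k₄, W.good_hcomp h₅ k₅, k₆⟩, z, ?_⟩
  -- The two induced squares can be pasted only if their common side agrees; it does because `m' b`
  -- is monic.
  have e : z' = r' := by
    have := W.monoM (m' b)
    have t := C.hcomp sr' (sm' b).some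
    rw [k₅.1] at t
    rw [← cancel_mono (m' b), hz'.1]
    exact W.top_unique (C.hcomp (sm' a).some sr'') t
  subst e
  exact W.good_hcomp hz hz'

end

/-! ## Subfunctors and kernels -/

section

variable {Y : DoubleFunctor D C} {P : D.Ob → C.Ob} {v : ∀ a : D.Ob, C.HomM (P a) (Y.obj a)}

/-- A family of subobjects of the values of a double functor that is stable under
m- and e-morphisms is a double functor. -/
noncomputable def subfunctor
    (hM : ∀ {a b : D.Ob} (f : D.HomM a b), ∃ m : C.HomM (P a) (P b),
      GoodSq W.goodM m (v a) (v b) (Y.mapM f))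
    (hE : ∀ {a b : D.Ob} (g : D.HomE a b), ∃ e : C.HomE (P a) (P b),
      Nonempty (C.Sq (v a) e (Y.mapE g) (v b))) : DoubleFunctor D C :=
  W.mkFunctor P (fun f => (hM f).choose) (fun g => (hE g).choose)
    -- Functoriality is forced: the m-maps are determined because the components of `v` are monic,
    -- and the e-maps because the left side of a square is determined by the other three. Squares
    -- are obtained by (PBL).
    (fun a => by
      have := W.monoM (v a)
      have h := (hM (D.idM a)).choose_spec.1
      exact (cancel_mono (v a)).1 (h.symm.trans
        (by rw [Y.mapM_id, Category.comp_id, Category.id_comp])))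
    (fun {a b c} f f' => by
      have := W.monoM (v c)
      have h := (hM (f ≫ f')).choose_spec.1
      have h₁ := (hM f).choose_spec.1
      have h₂ := (hM f').choose_spec.1
      rw [← cancel_mono (v c), ← h, Category.assoc, ← h₂, ← reassoc_of% h₁, Y.mapM_comp])
    (fun a => by
      have s := (hE (D.idE a)).choose_spec.some
      have t := C.vid (v a)
      rw [← Y.mapE_id] at t
      exact W.left_unique s t)
    (fun {a b c} g g' => by
      have s := (hE (g ≫ g')).choose_spec.some
      have t := C.vcomp (hE g).choose_spec.some (hE g').choose_spec.some
      rw [← Y.mapE_comp] at t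
      exact W.left_unique s t)
    (fun {a b a' b' f g g' f'} s => by
      have t := C.hcomp (hE g).choose_spec.some (Y.mapSq s)
      rw [(hM f).choose_spec.1, (hM f').choose_spec.1] at t
      exact W.pblM (hE g').choose_spec.some t)

theorem isMNat_subfunctor
    (hM : ∀ {a b : D.Ob} (f : D.HomM a b), ∃ m : C.HomM (P a) (P b),
      GoodSq W.goodM m (v a) (v b) (Y.mapM f))
    (hE : ∀ {a b : D.Ob} (g : D.HomE a b), ∃ e : C.HomE (P a) (P b),
      Nonempty (C.Sq (v a) e (Y.mapE g) (v b))) : W.IsMNat (subfunctor hM hE) Y v where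
  sq g := (hE g).choose_spec
  good f := (hM f).choose_spec

variable {F G F' G' K K' : DoubleFunctor D C}

theorem exists_ker_mapM {η : ∀ a : D.Ob, C.HomE (F.obj a) (G.obj a)} (hη : W.IsENat F G η)
    {a b : D.Ob} (f : D.HomM a b) : ∃ m : C.HomM (W.ker (η a)) (W.ker (η b)),
      GoodSq W.goodM m (W.kerι (η a)) (W.kerι (η b)) (G.mapM f) :=
  ⟨W.kerMap (hη.sq f).some, W.good_symmM (W.kerMap_good _)⟩

theorem exists_ker_mapE {η : ∀ a : D.Ob, C.HomE (F.obj a) (G.obj a)} (hη : W.IsENat F G η)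
    {a b : D.Ob} (g : D.HomE a b) : ∃ e : C.HomE (W.ker (η a)) (W.ker (η b)),
      Nonempty (C.Sq (W.kerι (η a)) e (G.mapE g) (W.kerι (η b))) :=
  ShortExact.exists_sqE (W.shortExact_kerι _) (W.shortExact_kerι _) (W.good_symmE (hη.good g))

/-- The pointwise kernel of an e-natural transformation. -/
noncomputable def kerFunctorOf {η : ∀ a : D.Ob, C.HomE (F.obj a) (G.obj a)}
    (hη : W.IsENat F G η) : DoubleFunctor D C :=
  subfunctor (exists_ker_mapM hη) (exists_ker_mapE hη)

theorem isMNat_kerι {η : ∀ a : D.Ob, C.HomE (F.obj a) (G.obj a)} (hη : W.IsENat F G η) :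
    W.IsMNat (kerFunctorOf hη) G (fun a => W.kerι (η a)) :=
  isMNat_subfunctor (exists_ker_mapM hη) (exists_ker_mapE hη)

variable {η : ∀ a : D.Ob, C.HomE (F.obj a) (F'.obj a)} {η' : ∀ a : D.Ob, C.HomE (G.obj a) (G'.obj a)}
  {μ : ∀ a : D.Ob, C.HomM (F.obj a) (G.obj a)} {μ' : ∀ a : D.Ob, C.HomM (F'.obj a) (G'.obj a)}
  {k : ∀ a : D.Ob, C.HomM (K.obj a) (F'.obj a)} {k' : ∀ a : D.Ob, C.HomM (K'.obj a) (G'.obj a)}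
  {n : ∀ a : D.Ob, C.HomM (K.obj a) (K'.obj a)}

theorem isMNat_of_ker (hk : W.IsMNat K F' k) (hk' : W.IsMNat K' G' k') (hμ' : W.IsMNat F' G' μ')
    (e : ∀ a, n a ≫ k' a = k a ≫ μ' a) : W.IsMNat K K' n := by
  refine IsMNat.of_comp hk' ?_
  simp only [e]
  exact hk.comp hμ'

/-- By `isGoodCube_iff` the extra condition on the cubes of kernels is that the naturality squares
of `μ` at m-morphisms are good. -/
theorem goodCubes_of_sq (hη' : W.IsENat G G' η') (hμ : W.IsMNat F G μ) (hμ' : W.IsMNat F' G' μ')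
    (hk : W.IsMNat K F' k) (hk' : W.IsMNat K' G' k')
    (ex : ∀ a, W.ShortExact (k a) (η a)) (ex' : ∀ a, W.ShortExact (k' a) (η' a))
    (s : ∀ a, C.Sq (μ a) (η a) (η' a) (μ' a))
    (e : ∀ a, n a ≫ k' a = k a ≫ μ' a) : W.GoodCubes K F' K' G' k n μ' k' := by
  intro a b f
  have hn := isMNat_of_ker hk hk' hμ' e
  exact (ShortExact.isGoodCube_iff (ex a) (ex' a) (ex b) (ex' b) (s a) (s b) (hη'.sq f).some).2
    ⟨⟨(ex a).good_of_sq (ex' a) (s a) (e a), (ex b).good_of_sq (ex' b) (s b) (e b),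
      W.good_symmM (hk.good f), W.good_symmM (hn.good f), W.good_symmM (hμ'.good f),
      W.good_symmM (hk'.good f)⟩, _, W.good_symmM (hμ.good f)⟩

/-- Fullness of the pointwise `k`. The components of `μ` are induced on cokernels; (PBL) in the
e-direction gives their e-naturality squares, and the cube condition gives the good m-naturality
squares. -/
theorem exists_isMNat_of_goodCubes (hη : W.IsENat F F' η) (hη' : W.IsENat G G' η')
    (hμ' : W.IsMNat F' G' μ') (ex : ∀ a, W.ShortExact (k a) (η a))
    (ex' : ∀ a, W.ShortExact (k' a) (η' a)) (H : W.GoodCubes K F' K' G' k n μ' k') :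
    ∃ μ : ∀ a : D.Ob, C.HomM (F.obj a) (G.obj a), W.IsMNat F G μ ∧
      ∀ a, Nonempty (C.Sq (μ a) (η a) (η' a) (μ' a)) := by
  choose μ s using fun a => (ex a).exists_sq (ex' a) (H.good a)
  refine ⟨μ, ⟨fun {a b} g => ?_, fun {a b} f => ?_⟩, s⟩
  · obtain ⟨t⟩ := hμ'.sq g
    have t' := C.vcomp (s a).some t
    have h₁ := (hη.good g).1
    have h₂ := (hη'.good g).1
    have h₁' : η a ≫ F'.mapE g = F.mapE g ≫ η b := h₁
    have h₂' : η' a ≫ G'.mapE g = G.mapE g ≫ η' b := h₂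
    rw [h₁', h₂'] at t'
    exact W.pblE (s b).some t'
  · obtain ⟨-, z, hz⟩ := (ShortExact.isGoodCube_iff (ex a) (ex' a) (ex b) (ex' b) (s a).some
      (s b).some (hη'.sq f).some).1 (H f)
    -- The cube condition yields a good square with an unspecified side `z`; as `μ b` is monic, this
    -- side is the expected one.
    have e : z = F.mapM f := by
      have := W.monoM (μ b)
      rw [← cancel_mono (μ b), hz.1]
      have t₁ := C.hcomp (s a).some (hη'.sq f).some
      have t₂ := C.hcomp (hη.sq f).some (s b).some
      have h₃ : μ' a ≫ G'.mapM f = F'.mapM f ≫ μ' b := (hμ'.good f).1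
      change C.Sq (μ a ≫ G.mapM f) (η a) (η' b) (μ' a ≫ G'.mapM f) at t₁
      rw [h₃] at t₁
      exact W.top_unique t₁ t₂
    subst e
    exact W.good_symmM hz

end

end PreStarCGW

end CGW

namespace CGW

namespace PreStarCGW

variable {D : DoubleCategory.{u', v', w'}} {C : DoubleCategory.{u, v, w}} {W : PreStarCGW C}

/-! ## ⋆-pushouts of double functors -/

variable {F G H P Y : DoubleFunctor D C}
  {μ : ∀ a : D.Ob, C.HomM (F.obj a) (G.obj a)} {ν : ∀ a : D.Ob, C.HomM (F.obj a) (H.obj a)}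

section

variable {Q : D.Ob → C.Ob} {i : ∀ a : D.Ob, C.HomM (G.obj a) (Q a)}
  {j : ∀ a : D.Ob, C.HomM (H.obj a) (Q a)}

theorem exists_star_mapM (hμ : W.IsMNat F G μ) (hν : W.IsMNat F H ν)
    (hQ : ∀ a, IsStarPushout W.goodM (μ a) (ν a) (i a) (j a)) {a b : D.Ob} (f : D.HomM a b) :
    ∃ s : C.HomM (Q a) (Q b), i a ≫ s = G.mapM f ≫ i b ∧ j a ≫ s = H.mapM f ≫ j b ∧
      GoodSq W.goodM (i a) (G.mapM f) s (i b) ∧ GoodSq W.goodM (j a) (H.mapM f) s (j b) :=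
  W.star_map (hQ a) (hQ b) (W.good_symmM (hμ.good f)) (W.good_symmM (hν.good f))

theorem exists_star_mapE (hμ : W.IsMNat F G μ) (hν : W.IsMNat F H ν)
    (hQ : ∀ a, IsStarPushout W.goodM (μ a) (ν a) (i a) (j a)) {a b : D.Ob} (g : D.HomE a b) :
    ∃ x : C.HomE (Q a) (Q b), Nonempty (C.Sq (i a) (G.mapE g) x (i b)) ∧
      Nonempty (C.Sq (j a) (H.mapE g) x (j b)) :=
  exists_quotient_star (hQ b) (hQ a) (hμ.sq g).some (hν.sq g).some

/-- The pointwise ⋆-pushout. -/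
noncomputable def starFunctor (hμ : W.IsMNat F G μ) (hν : W.IsMNat F H ν)
    (hQ : ∀ a, IsStarPushout W.goodM (μ a) (ν a) (i a) (j a)) : DoubleFunctor D C :=
  W.mkFunctor Q (fun f => (exists_star_mapM hμ hν hQ f).choose)
    (fun g => (exists_star_mapE hμ hν hQ g).choose)
    (fun a => by
      obtain ⟨h₁, h₂, -⟩ := (exists_star_mapM hμ hν hQ (D.idM a)).choose_spec
      refine W.star_hom_ext (hQ a) (h₁.trans ?_) (h₂.trans ?_)
      · rw [G.mapM_id, Category.id_comp, Category.comp_id]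
      · rw [H.mapM_id, Category.id_comp, Category.comp_id])
    (fun {a b c} f f' => by
      obtain ⟨h₁, h₂, -⟩ := (exists_star_mapM hμ hν hQ (f ≫ f')).choose_spec
      obtain ⟨k₁, k₂, -⟩ := (exists_star_mapM hμ hν hQ f).choose_spec
      obtain ⟨l₁, l₂, -⟩ := (exists_star_mapM hμ hν hQ f').choose_spec
      refine W.star_hom_ext (hQ a) (h₁.trans ?_) (h₂.trans ?_)
      · rw [reassoc_of% k₁, l₁, G.mapM_comp, Category.assoc]
      · rw [reassoc_of% k₂, l₂, H.mapM_comp, Category.assoc])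
    -- Functoriality along e-morphisms is the uniqueness of the quotient map between ⋆-pushouts.
    (fun a => by
      obtain ⟨⟨s₁⟩, ⟨s₂⟩⟩ := (exists_star_mapE hμ hν hQ (D.idE a)).choose_spec
      refine quotient_star_unique (hQ a) (hQ a) (hμ.sq (D.idE a)).some
        (hν.sq (D.idE a)).some s₁ s₂ ?_ ?_
      · exact (G.mapE_id a).symm ▸ C.vid (i a)
      · exact (H.mapE_id a).symm ▸ C.vid (j a))
    (fun {a b c} g g' => by
      obtain ⟨⟨s₁⟩, ⟨s₂⟩⟩ := (exists_star_mapE hμ hν hQ (g ≫ g')).choose_spec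
      obtain ⟨⟨k₁⟩, ⟨k₂⟩⟩ := (exists_star_mapE hμ hν hQ g).choose_spec
      obtain ⟨⟨l₁⟩, ⟨l₂⟩⟩ := (exists_star_mapE hμ hν hQ g').choose_spec
      refine quotient_star_unique (hQ c) (hQ a) (hμ.sq (g ≫ g')).some
        (hν.sq (g ≫ g')).some s₁ s₂ ?_ ?_
      · exact (G.mapE_comp g g').symm ▸ C.vcomp k₁ l₁
      · exact (H.mapE_comp g g').symm ▸ C.vcomp k₂ l₂)
    (fun {a b a' b' f g g' f'} s => by
      obtain ⟨h₁, h₂, -⟩ := (exists_star_mapM hμ hν hQ f).choose_spec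
      obtain ⟨k₁, k₂, -⟩ := (exists_star_mapM hμ hν hQ f').choose_spec
      obtain ⟨⟨s₁⟩, ⟨s₂⟩⟩ := (exists_star_mapE hμ hν hQ g).choose_spec
      obtain ⟨⟨t₁⟩, ⟨t₂⟩⟩ := (exists_star_mapE hμ hν hQ g').choose_spec
      have u₁ := C.hcomp (G.mapSq s) t₁
      have u₂ := C.hcomp (H.mapSq s) t₂
      rw [← h₁, ← k₁] at u₁
      rw [← h₂, ← k₂] at u₂
      -- The ambient object is `Q b'`, with quotient `Q b`.
      exact quotient_star_sq (hQ a') (hQ a) (hμ.sq g).some (hν.sq g).some s₁ s₂ u₁ u₂)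

theorem isMNat_star_inl (hμ : W.IsMNat F G μ) (hν : W.IsMNat F H ν)
    (hQ : ∀ a, IsStarPushout W.goodM (μ a) (ν a) (i a) (j a)) :
    W.IsMNat G (starFunctor hμ hν hQ) i where
  sq g := (exists_star_mapE hμ hν hQ g).choose_spec.1
  good f := W.good_symmM (exists_star_mapM hμ hν hQ f).choose_spec.2.2.1

theorem isMNat_star_inr (hμ : W.IsMNat F G μ) (hν : W.IsMNat F H ν)
    (hQ : ∀ a, IsStarPushout W.goodM (μ a) (ν a) (i a) (j a)) :
    W.IsMNat H (starFunctor hμ hν hQ) j where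
  sq g := (exists_star_mapE hμ hν hQ g).choose_spec.2
  good f := W.good_symmM (exists_star_mapM hμ hν hQ f).choose_spec.2.2.2

end

section

variable {i : ∀ a : D.Ob, C.HomM (G.obj a) (P.obj a)} {j : ∀ a : D.Ob, C.HomM (H.obj a) (P.obj a)}
  {h : ∀ a : D.Ob, C.HomM (G.obj a) (Y.obj a)} {k : ∀ a : D.Ob, C.HomM (H.obj a) (Y.obj a)}
  {x : ∀ a : D.Ob, C.HomM (P.obj a) (Y.obj a)}

/-- The southern maps are identities, so the southern square is an identity square. -/
theorem goodCubes_of_star (hμ : W.IsMNat F G μ) (hν : W.IsMNat F H ν) (hi : W.IsMNat G P i)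
    (hj : W.IsMNat H P j) (hP : ∀ a, IsStarPushout W.goodM (μ a) (ν a) (i a) (j a)) :
    W.GoodCubes F G H P μ ν i j := fun a b f =>
  W.IsGoodCube_of_south (x := P.mapM f) (y := C.idM (P.obj a)) (y' := C.idM (P.obj b))
    (hP a) (hP b) (W.good_symmM (hμ.good f)) (W.good_symmM (hν.good f))
    (W.good_symmM (hi.good f)) (W.good_symmM (hj.good f)) (hi.good f).1
    (hj.good f).1 (Category.comp_id _) (Category.comp_id _) (Category.comp_id _)
    (Category.comp_id _) (W.good_symmM (GoodSq.id W.mulM _))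

/-- The e-naturality squares come from `quotient_star_sq`. The m-naturality squares are the southern
squares of the given cubes, which is why good cubes are the right notion of good square in `C^D`. -/
theorem isMNat_star_desc (hμ : W.IsMNat F G μ) (hν : W.IsMNat F H ν) (hi : W.IsMNat G P i)
    (hj : W.IsMNat H P j) (hP : ∀ a, IsStarPushout W.goodM (μ a) (ν a) (i a) (j a))
    (hh : W.IsMNat G Y h) (hk : W.IsMNat H Y k) (Hc : W.GoodCubes F G H Y μ ν h k)
    (e₁ : ∀ a, i a ≫ x a = h a) (e₂ : ∀ a, j a ≫ x a = k a) : W.IsMNat P Y x where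
  sq {a b} g := by
    obtain ⟨s₁⟩ := hh.sq g
    obtain ⟨s₂⟩ := hk.sq g
    rw [← e₁, ← e₁] at s₁
    rw [← e₂, ← e₂] at s₂
    exact quotient_star_sq (hP b) (hP a) (hμ.sq g).some (hν.sq g).some (hi.sq g).some
      (hj.sq g).some s₁ s₂
  good {a b} f := W.good_symmM (W.IsGoodCube_south (Hc f) (hP a) (hP b) (hi.good f).1
    (hj.good f).1 (e₁ a) (e₂ a) (e₁ b) (e₂ b))

end

variable {X B : DoubleFunctor D C}

/-- By cancellation `B ⋆_F X = B ⋆_G P`, so the outer cube and the right cube have the same southern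
square. -/
theorem goodCubes_pol {f : ∀ a : D.Ob, C.HomM (F.obj a) (G.obj a)}
    {g : ∀ a : D.Ob, C.HomM (F.obj a) (X.obj a)} {i : ∀ a : D.Ob, C.HomM (G.obj a) (P.obj a)}
    {j : ∀ a : D.Ob, C.HomM (X.obj a) (P.obj a)} {p : ∀ a : D.Ob, C.HomM (G.obj a) (B.obj a)}
    {q : ∀ a : D.Ob, C.HomM (B.obj a) (Y.obj a)} {r : ∀ a : D.Ob, C.HomM (P.obj a) (Y.obj a)}
    (hi : W.IsMNat G P i) (hj : W.IsMNat X P j)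
    (hp : W.IsMNat G B p) (hr : W.IsMNat P Y r)
    (hP : ∀ a, IsStarPushout W.goodM (f a) (g a) (i a) (j a))
    (e : ∀ a, p a ≫ q a = i a ≫ r a)
    (Hc : W.GoodCubes F B X Y (fun a => f a ≫ p a) g q (fun a => j a ≫ r a)) :
    W.GoodCubes G B P Y p i q r := by
  intro a b m
  obtain ⟨h₁, h₂, h₃, h₄, h₅, h₆, S, S', k, l, k', l', x, y, y', HS, HS', ⟨ex, ex'⟩, ⟨ey, ey'⟩,
    ⟨ez, ez'⟩, HG⟩ := Hc m
  obtain ⟨t, et, et', Ht⟩ := W.star_cancel (W.star_symm (hP a)) (W.star_symm HS)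
  obtain ⟨t', eu, eu', Ht'⟩ := W.star_cancel (W.star_symm (hP b)) (W.star_symm HS')
  refine W.IsGoodCube_of_south (x := x) (y := y) (y' := y') (W.star_symm Ht) (W.star_symm Ht')
    (W.good_symmM (hp.good m)) (W.good_symmM (hi.good m)) h₅ (W.good_symmM (hr.good m)) ex ?_ ey ?_
    ez ?_ HG
  · refine W.star_hom_ext (hP a) ?_ ?_
    · rw [reassoc_of% et', ex, reassoc_of% (hi.good m).1, eu', reassoc_of% (hp.good m).1]
    · rw [reassoc_of% et, ex', reassoc_of% (hj.good m).1, eu]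
  · refine W.star_hom_ext (hP a) ?_ ?_
    · rw [reassoc_of% et', ey, e]
    · rw [reassoc_of% et, ey']
  · refine W.star_hom_ext (hP b) ?_ ?_
    · rw [reassoc_of% eu', ez, e]
    · rw [reassoc_of% eu, ez']

end PreStarCGW

end CGW

namespace CGW

/-! ## The double category of double functors -/

section Equivalence

variable {C : DoubleCategory.{u, v, w}} (K : KerCok C)

/-- For fullness, the existence of a square over the given `f'` is enough: its `kerMap` is the given
map because `kerι g'` is monic. -/
theorem KerCok.kerFunctor_isEquivalence (mono : ∀ {A B : C.Ob} (f : C.HomM A B), Mono f)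
    (subsingleton : ∀ {A B A' B' : C.Ob} (f : C.HomM A B) (g : C.HomE A A') (g' : C.HomE B B')
      (f' : C.HomM A' B'), Subsingleton (C.Sq f g g' f'))
    (unique : ∀ {A B A' B' : C.Ob} {f₁ f₂ : C.HomM A B} {g : C.HomE A A'} {g' : C.HomE B B'}
      {f' : C.HomM A' B'}, C.Sq f₁ g g' f' → C.Sq f₂ g g' f' → f₁ = f₂)
    (full : ∀ {A B A' B' : C.Ob} {g : C.HomE A A'} {g' : C.HomE B B'}
      {f' : C.HomM A' B'} {m : C.HomM (K.ker g) (K.ker g')},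
      GoodSq K.goodM (K.kerι g) m f' (K.kerι g') → ∃ f, Nonempty (C.Sq f g g' f'))
    (ess : ∀ {A B : C.Ob} (f : C.HomM A B), ∃ (Z : C.Ob) (g : C.HomE Z B)
      (m : C.HomM (K.ker g) A), IsIso m ∧ m ≫ f = K.kerι g)
    (triangle : ∀ {f f' : Arrow C.M} (s : f ⟶ f'), IsIso s.left → K.goodM s) :
    K.kerFunctor.IsEquivalence where
  faithful := ⟨by
    rintro ⟨g⟩ ⟨g'⟩ ⟨f₁, k₁, s₁⟩ ⟨f₂, k₂, s₂⟩ h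
    obtain rfl : k₁ = k₂ := congrArg (fun z => z.1.right) h
    obtain rfl : f₁ = f₂ := unique s₁ s₂
    obtain rfl : s₁ = s₂ := (subsingleton _ _ _ _).elim _ _
    rfl⟩
  full := ⟨by
    rintro ⟨g⟩ ⟨g'⟩ ⟨x, hx⟩
    obtain ⟨f, ⟨s⟩⟩ := full (g := g) (g' := g') (f' := x.right) (m := x.left) ⟨x.w, hx⟩
    refine ⟨⟨f, x.right, s⟩, ?_⟩
    apply WideSubcategory.hom_ext
    ext
    · have := mono (K.kerι g')
      refine (cancel_mono (K.kerι g')).1 ?_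
      exact (K.kerMap_good s).1.trans x.w.symm
    · rfl⟩
  essSurj := ⟨by
    rintro ⟨f⟩
    obtain ⟨Z, g, m, hm, e⟩ := ess f.hom
    refine ⟨⟨g⟩, ⟨?_⟩⟩
    let i : Arrow.mk (K.kerι g) ≅ f := Arrow.isoMk (asIso m) (Iso.refl _) (by simpa using e)
    exact ⟨⟨i.hom, triangle _ hm⟩,
      ⟨i.inv, triangle _ (inferInstanceAs (IsIso (inv m)))⟩,
      WideSubcategory.hom_ext _ i.hom_inv_id, WideSubcategory.hom_ext _ i.inv_hom_id⟩⟩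

theorem KerCok.cokFunctor_isEquivalence (mono : ∀ {A B : C.Ob} (f : C.HomE A B), Mono f)
    (subsingleton : ∀ {A B A' B' : C.Ob} (f : C.HomM A B) (g : C.HomE A A') (g' : C.HomE B B')
      (f' : C.HomM A' B'), Subsingleton (C.Sq f g g' f'))
    (unique : ∀ {A B A' B' : C.Ob} {f : C.HomM A B} {g₁ g₂ : C.HomE A A'} {g' : C.HomE B B'}
      {f' : C.HomM A' B'}, C.Sq f g₁ g' f' → C.Sq f g₂ g' f' → g₁ = g₂)
    (full : ∀ {A B A' B' : C.Ob} {f : C.HomM A B} {g' : C.HomE B B'}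
      {f' : C.HomM A' B'} {e : C.HomE (K.cok f) (K.cok f')},
      GoodSq K.goodE (K.cokπ f) e g' (K.cokπ f') → ∃ g, Nonempty (C.Sq f g g' f'))
    (ess : ∀ {A B : C.Ob} (g : C.HomE A B), ∃ (Z : C.Ob) (f : C.HomM Z B)
      (e : C.HomE (K.cok f) A), IsIso e ∧ e ≫ g = K.cokπ f)
    (triangle : ∀ {f f' : Arrow C.E} (s : f ⟶ f'), IsIso s.left → K.goodE s) :
    K.cokFunctor.IsEquivalence where
  faithful := ⟨by
    rintro ⟨g⟩ ⟨g'⟩ ⟨f₁, k₁, s₁⟩ ⟨f₂, k₂, s₂⟩ h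
    obtain rfl : k₁ = k₂ := congrArg (fun z => z.1.right) h
    obtain rfl : f₁ = f₂ := unique s₁ s₂
    obtain rfl : s₁ = s₂ := (subsingleton _ _ _ _).elim _ _
    rfl⟩
  full := ⟨by
    rintro ⟨g⟩ ⟨g'⟩ ⟨x, hx⟩
    obtain ⟨f, ⟨s⟩⟩ := full (f := g) (f' := g') (g' := x.right) (e := x.left) ⟨x.w, hx⟩
    refine ⟨⟨f, x.right, s⟩, ?_⟩
    apply WideSubcategory.hom_ext
    ext
    · have := mono (K.cokπ g')
      refine (cancel_mono (K.cokπ g')).1 ?_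
      exact (K.cokMap_good s).1.trans x.w.symm
    · rfl⟩
  essSurj := ⟨by
    rintro ⟨f⟩
    obtain ⟨Z, g, m, hm, e⟩ := ess f.hom
    refine ⟨⟨g⟩, ⟨?_⟩⟩
    let i : Arrow.mk (K.cokπ g) ≅ f := Arrow.isoMk (asIso m) (Iso.refl _) (by simpa using e)
    exact ⟨⟨i.hom, triangle _ hm⟩,
      ⟨i.inv, triangle _ (inferInstanceAs (IsIso (inv m)))⟩,
      WideSubcategory.hom_ext _ i.hom_inv_id, WideSubcategory.hom_ext _ i.inv_hom_id⟩⟩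

end Equivalence

/-! ### Morphisms of `C^D` and their components -/

variable {D : DoubleCategory.{u', v', w'}} {C : DoubleCategory.{u, v, w}} {S : StarCGW C}
  {F G H P : DoubleFunctor D C}

theorem MNat.isMNat (μ : MNat S F G) : S.toPre.IsMNat F G μ.app where
  sq g := ⟨μ.sq g⟩
  good f := μ.good f

theorem ENat.isENat (η : ENat S F G) : S.toPre.IsENat F G η.app where
  sq f := ⟨η.sq f⟩
  good g := η.good g

/-- The m-natural transformation with given components. -/
noncomputable def MNat.ofIsMNat {app : ∀ a : D.Ob, C.HomM (F.obj a) (G.obj a)}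
    (h : S.toPre.IsMNat F G app) : MNat S F G where
  app := app
  sq g := (h.sq g).some
  good f := h.good f
  sq_id a := S.heq rfl (F.mapE_id a) (G.mapE_id a) rfl _ _
  sq_comp g g' := S.heq rfl (F.mapE_comp g g') (G.mapE_comp g g') rfl _ _
  sq_natural {_ _ _ _ f _ _ f'} _ := S.heq (h.good f).1.symm rfl rfl (h.good f').1.symm _ _

/-- The e-natural transformation with given components. -/
noncomputable def ENat.ofIsENat {app : ∀ a : D.Ob, C.HomE (F.obj a) (G.obj a)}
    (h : S.toPre.IsENat F G app) : ENat S F G where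
  app := app
  sq f := (h.sq f).some
  good g := h.good g
  sq_id a := S.heq (F.mapM_id a) rfl rfl (G.mapM_id a) _ _
  sq_comp f f' := S.heq (F.mapM_comp f f') rfl rfl (G.mapM_comp f f') _ _
  sq_natural {_ _ _ _ _ g g' _} _ := S.heq rfl (h.good g).1.symm (h.good g').1.symm rfl _ _

/-- The component of an m-morphism of `C^D`. -/
abbrev appM (μ : (functorDouble S D).HomM F G) (a : D.Ob) : C.HomM (F.obj a) (G.obj a) :=
  MNat.app μ a

/-- The component of an e-morphism of `C^D`. -/
abbrev appE (η : (functorDouble S D).HomE F G) (a : D.Ob) : C.HomE (F.obj a) (G.obj a) :=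
  ENat.app η a

theorem functorDouble_homM_ext {μ ν : (functorDouble S D).HomM F G}
    (h : ∀ a, appM μ a = appM ν a) : μ = ν :=
  MNat.ext' h

theorem functorDouble_homE_ext {μ ν : (functorDouble S D).HomE F G}
    (h : ∀ a, appE μ a = appE ν a) : μ = ν :=
  ENat.ext' h

theorem appM_congr {μ ν : (functorDouble S D).HomM F G} (h : μ = ν) (a : D.Ob) :
    appM μ a = appM ν a := by rw [h]

theorem appE_congr {μ ν : (functorDouble S D).HomE F G} (h : μ = ν) (a : D.Ob) :
    appE μ a = appE ν a := by rw [h]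

/-- The m-morphism of `C^D` with given components. -/
noncomputable abbrev mkM {app : ∀ a : D.Ob, C.HomM (F.obj a) (G.obj a)}
    (h : S.toPre.IsMNat F G app) : (functorDouble S D).HomM F G := MNat.ofIsMNat h

/-- The e-morphism of `C^D` with given components. -/
noncomputable abbrev mkE {app : ∀ a : D.Ob, C.HomE (F.obj a) (G.obj a)}
    (h : S.toPre.IsENat F G app) : (functorDouble S D).HomE F G := ENat.ofIsENat h

theorem isMNat_appM (μ : (functorDouble S D).HomM F G) : S.toPre.IsMNat F G (appM μ) :=
  MNat.isMNat μ

theorem isENat_appE (μ : (functorDouble S D).HomE F G) : S.toPre.IsENat F G (appE μ) :=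
  ENat.isENat μ

/-- Transposing twice gives back the original structure by definition, so statements about e-natural
transformations apply to m-natural ones over the transpose. -/
theorem isENat_transpose_appM (μ : (functorDouble S D).HomM F G) :
    S.toPre.transpose.IsENat F.transpose G.transpose (appM μ) :=
  MNat.isMNat μ

theorem isIso_appM (μ : (functorDouble S D).HomM F G) [IsIso μ] (a : D.Ob) : IsIso (appM μ a) :=
  ⟨appM (inv μ) a, appM_congr (IsIso.hom_inv_id μ) a, appM_congr (IsIso.inv_hom_id μ) a⟩

theorem isIso_appE (μ : (functorDouble S D).HomE F G) [IsIso μ] (a : D.Ob) : IsIso (appE μ a) :=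
  ⟨appE (inv μ) a, appE_congr (IsIso.hom_inv_id μ) a, appE_congr (IsIso.inv_hom_id μ) a⟩

theorem isMNat_id (F : DoubleFunctor D C) : S.toPre.IsMNat F F (fun a => C.idM (F.obj a)) :=
  MNat.isMNat (MNat.id S F)

theorem isENat_id (F : DoubleFunctor D C) : S.toPre.IsENat F F (fun a => C.idE (F.obj a)) :=
  ENat.isENat (ENat.id S F)

theorem isIsoM_of_app (μ : (functorDouble S D).HomM F G) (h : ∀ a, IsIso (appM μ a)) :
    IsIso μ := by
  have h' : S.toPre.IsMNat G F (fun a => inv (appM μ a)) := by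
    refine PreStarCGW.IsMNat.of_comp (isMNat_appM μ) ?_
    simpa using isMNat_id G
  exact ⟨mkM h', functorDouble_homM_ext fun a => IsIso.hom_inv_id (appM μ a),
    functorDouble_homM_ext fun a => IsIso.inv_hom_id (appM μ a)⟩

theorem isIsoE_of_app (μ : (functorDouble S D).HomE F G) (h : ∀ a, IsIso (appE μ a)) :
    IsIso μ := by
  have h' : S.toPre.IsENat G F (fun a => inv (appE μ a)) := by
    refine PreStarCGW.IsMNat.of_comp (W := S.toPre.transpose) (isENat_appE μ) ?_
    have e : (fun a => inv (appE μ a) ≫ appE μ a) = fun a => C.idE (G.obj a) :=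
      funext fun a => IsIso.inv_hom_id (appE μ a)
    exact e.symm ▸ isENat_id G
  exact ⟨mkE h', functorDouble_homE_ext fun a => IsIso.hom_inv_id (appE μ a),
    functorDouble_homE_ext fun a => IsIso.inv_hom_id (appE μ a)⟩

variable (S D)

/-- The pointwise kernels and cokernels, and the good squares of `C^D`. -/
noncomputable def functorKerCok : KerCok (functorDouble S D) where
  goodM f f' s := S.toPre.GoodCubes (D := D) f.left f.right f'.left f'.right (appM f.hom)
    (appM s.left) (appM s.right) (appM f'.hom)
  goodE f f' s := S.toPre.transpose.GoodCubes
    (DoubleFunctor.transpose (D := D) f.left) (DoubleFunctor.transpose f.right)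
    (DoubleFunctor.transpose f'.left) (DoubleFunctor.transpose f'.right) (appE f.hom)
    (appE s.left) (appE s.right) (appE f'.hom)
  mulM :=
    { id_mem f := PreStarCGW.goodCubes_of_isIso (isMNat_appM f.hom) (isMNat_id _) (isMNat_id _)
        (isMNat_appM f.hom) (fun _ => IsIso.id _)
        (fun a => (Category.id_comp (appM f.hom a)).trans (Category.comp_id (appM f.hom a)).symm)
      comp_mem _ _ hs ht := PreStarCGW.GoodCubes.comp hs ht }
  mulE :=
    { id_mem f := PreStarCGW.goodCubes_of_isIso (isENat_appE f.hom) (isENat_id _) (isENat_id _)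
        (isENat_appE f.hom) (fun _ => IsIso.id _)
        (fun a => (Category.id_comp (appE f.hom a)).trans (Category.comp_id (appE f.hom a)).symm)
      comp_mem _ _ hs ht := PreStarCGW.GoodCubes.comp hs ht }
  ker η := PreStarCGW.kerFunctorOf (isENat_appE η)
  kerι η := mkM (PreStarCGW.isMNat_kerι (isENat_appE η))
  kerMap {_ _ _ _ _ η η' μ'} s := mkM (app := fun a => S.kerMap (Modif.app s a))
    (PreStarCGW.isMNat_of_ker (PreStarCGW.isMNat_kerι (isENat_appE η))
      (PreStarCGW.isMNat_kerι (isENat_appE η')) (isMNat_appM μ')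
      (fun a => S.toPre.kerMap_comm (Modif.app s a)))
  kerMap_good {_ _ _ _ μ η η' μ'} s :=
    ⟨functorDouble_homM_ext fun a => S.toPre.kerMap_comm (Modif.app s a),
      PreStarCGW.goodCubes_of_sq (isENat_appE η') (isMNat_appM μ) (isMNat_appM μ')
        (PreStarCGW.isMNat_kerι (isENat_appE η)) (PreStarCGW.isMNat_kerι (isENat_appE η'))
        (fun _ => S.toPre.shortExact_kerι _) (fun _ => S.toPre.shortExact_kerι _)
        (fun a => Modif.app s a) (fun a => S.toPre.kerMap_comm (Modif.app s a))⟩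
  kerMap_hid _ := functorDouble_homM_ext fun _ => S.kerMap_hid _
  kerMap_hcomp _ _ := functorDouble_homM_ext fun _ => S.kerMap_hcomp _ _
  -- Cokernels are kernels for the transposed structure.
  cok μ := DoubleFunctor.untranspose
    (PreStarCGW.kerFunctorOf (W := S.toPre.transpose) (isENat_transpose_appM μ))
  cokπ μ := mkE (PreStarCGW.isMNat_kerι (W := S.toPre.transpose) (isENat_transpose_appM μ))
  cokMap {_ _ _ _ μ _ η' μ'} s := mkE (app := fun a => S.cokMap (Modif.app s a))
    (PreStarCGW.isMNat_of_ker (W := S.toPre.transpose)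
      (PreStarCGW.isMNat_kerι (W := S.toPre.transpose) (isENat_transpose_appM μ))
      (PreStarCGW.isMNat_kerι (W := S.toPre.transpose) (isENat_transpose_appM μ')) (isENat_appE η')
      (fun a => S.toPre.cokMap_comm (Modif.app s a)))
  cokMap_good {_ _ _ _ μ η η' μ'} s :=
    ⟨functorDouble_homE_ext fun a => S.toPre.cokMap_comm (Modif.app s a),
      PreStarCGW.goodCubes_of_sq (W := S.toPre.transpose) (isENat_transpose_appM μ') (isENat_appE η)
        (isENat_appE η')
        (PreStarCGW.isMNat_kerι (W := S.toPre.transpose) (isENat_transpose_appM μ))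
        (PreStarCGW.isMNat_kerι (W := S.toPre.transpose) (isENat_transpose_appM μ'))
        (fun _ => S.toPre.transpose.shortExact_kerι _)
        (fun _ => S.toPre.transpose.shortExact_kerι _)
        (fun a => Modif.app s a) (fun a => S.toPre.cokMap_comm (Modif.app s a))⟩
  cokMap_vid _ := functorDouble_homE_ext fun _ => S.cokMap_vid _
  cokMap_vcomp _ _ := functorDouble_homE_ext fun _ => S.cokMap_vcomp _ _

end CGW

namespace CGW

variable {D : DoubleCategory.{u', v', w'}} {C : DoubleCategory.{u, v, w}}

/-! ## Isomorphisms and initial objects of functor double categories -/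

namespace PreStarCGW

variable (W : PreStarCGW C)

/-- A boundary with two parallel invertible sides has a square if and only if it commutes. So the
two kinds of naturality conditions are exchanged, and goodness is automatic by (G). -/
theorem isENat_toE {F G : DoubleFunctor D C} (i : ∀ a : D.Ob, C.obM (F.obj a) ≅ C.obM (G.obj a))
    (hi : W.IsMNat F G (fun a => (i a).hom)) : W.IsENat F G (fun a => (W.toE (i a)).hom) where
  sq {a b} f := (W.nonempty_sq_vert_iff (F.mapM f) (i a) (i b) (G.mapM f)).2 (hi.good f).1.symm
  good {a b} g := W.triangleE (inferInstance : IsIso (W.toE (i a)).hom)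
    ((W.nonempty_sq_horiz_iff (i a) (F.mapE g) (G.mapE g) (i b)).1 (hi.sq g)).symm

theorem isMNat_toE_symm {F G : DoubleFunctor D C}
    (i : ∀ a : D.Ob, C.obE (F.obj a) ≅ C.obE (G.obj a))
    (hi : W.IsENat F G (fun a => (i a).hom)) : W.IsMNat F G (fun a => (W.toE.symm (i a)).hom) where
  sq {a b} g := (W.nonempty_sq_horiz_iff' (i a) (F.mapE g) (G.mapE g) (i b)).2 (hi.good g).1.symm
  good {a b} f := W.triangleM (inferInstance : IsIso (W.toE.symm (i a)).hom)
    ((W.nonempty_sq_vert_iff' (F.mapM f) (i a) (i b) (G.mapM f)).1 (hi.sq f)).symm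

/-- The square is induced on cokernels by the good square from `∅ ⟶ ∅`, the kernel of the identity
of `∅`, to the kernel of `g`. -/
theorem nonempty_sq_zero {A B : C.Ob} (g : C.HomE A B) :
    Nonempty (C.Sq (W.zeroM.to (C.obM A)) (C.idE W.zero) g (W.zeroM.to (C.obM B))) := by
  have h₀ := W.shortExact_kerι (C.idE W.zero)
  obtain ⟨i⟩ := W.ker_isInitial (C.idE W.zero) inferInstance
  have h₁ : W.ShortExact (C.idM W.zero) (C.idE W.zero) := h₀.iso_left (W.kerι (C.idE W.zero))
    ⟨W.zeroM.to _, i.hom_ext _ _, W.zeroM.hom_ext _ _⟩ (Category.comp_id _)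
  obtain ⟨m, s⟩ := h₁.exists_sq (W.shortExact_kerι g) (h := W.zeroM.to (C.obM B))
    (g := W.zeroM.to (C.obM (W.ker g)))
    (W.good_symmM (W.triangleM (g := C.idM W.zero) inferInstance (W.zeroM.hom_ext _ _)))
  rwa [W.zeroM.hom_ext (W.zeroM.to (C.obM A)) m]

variable (D) in
/-- The constant double functor at the object `∅`. -/
noncomputable def zeroFunctor : DoubleFunctor D C :=
  W.mkFunctor (fun _ => W.zero) (fun _ => C.idM _) (fun _ => C.idE _) (fun _ => rfl)
    (fun _ _ => (Category.comp_id _).symm) (fun _ => rfl) (fun _ _ => (Category.comp_id _).symm)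
    (fun _ => ⟨C.vid _⟩)

theorem isMNat_zero (F : DoubleFunctor D C) :
    W.IsMNat (W.zeroFunctor D) F (fun a => W.zeroM.to (C.obM (F.obj a))) where
  sq g := W.nonempty_sq_zero (F.mapE g)
  good _ := W.good_symmM (W.triangleM (g := C.idM W.zero) inferInstance (W.zeroM.hom_ext _ _))

theorem isENat_zero (F : DoubleFunctor D C) :
    W.IsENat (W.zeroFunctor D) F (fun a => W.zeroE.to (C.obE (F.obj a))) where
  sq f := W.transpose.nonempty_sq_zero (F.mapM f)
  good _ := W.good_symmE (W.triangleE (g := C.idE W.zero) inferInstance (W.zeroE.hom_ext _ _))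

end PreStarCGW

variable {S : StarCGW C} {F G F' G' H P : DoubleFunctor D C}

/-- The components of an isomorphism of m-natural transformations. -/
def appIsoM (i : (functorDouble S D).obM F ≅ (functorDouble S D).obM G) (a : D.Ob) :
    C.obM (F.obj a) ≅ C.obM (G.obj a) where
  hom := appM i.hom a
  inv := appM i.inv a
  hom_inv_id := appM_congr i.hom_inv_id a
  inv_hom_id := appM_congr i.inv_hom_id a

/-- The components of an isomorphism of e-natural transformations. -/
def appIsoE (i : (functorDouble S D).obE F ≅ (functorDouble S D).obE G) (a : D.Ob) :
    C.obE (F.obj a) ≅ C.obE (G.obj a) where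
  hom := appE i.hom a
  inv := appE i.inv a
  hom_inv_id := appE_congr i.hom_inv_id a
  inv_hom_id := appE_congr i.inv_hom_id a

/-- Isomorphisms of m-natural transformations give isomorphisms of e-natural transformations. -/
noncomputable def isoToE (i : (functorDouble S D).obM F ≅ (functorDouble S D).obM G) :
    (functorDouble S D).obE F ≅ (functorDouble S D).obE G where
  hom := mkE (S.toPre.isENat_toE (appIsoM i) (isMNat_appM i.hom))
  inv := mkE (S.toPre.isENat_toE (appIsoM i.symm) (isMNat_appM i.inv))
  hom_inv_id := functorDouble_homE_ext fun a => by
    change (S.toE (appIsoM i a)).hom ≫ (S.toE (appIsoM i a).symm).hom = C.idE _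
    rw [S.toSharedIsos.toE_symm]
    simp
  inv_hom_id := functorDouble_homE_ext fun a => by
    change (S.toE (appIsoM i a).symm).hom ≫ (S.toE (appIsoM i a)).hom = C.idE _
    rw [S.toSharedIsos.toE_symm]
    simp

theorem toE_symm_symm {A B : C.Ob} (f : C.obE A ≅ C.obE B) :
    S.toE.symm f.symm = (S.toE.symm f).symm :=
  S.toPre.transpose.toSharedIsos.toE_symm f

/-- Isomorphisms of e-natural transformations give isomorphisms of m-natural transformations. -/
noncomputable def isoToM (i : (functorDouble S D).obE F ≅ (functorDouble S D).obE G) :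
    (functorDouble S D).obM F ≅ (functorDouble S D).obM G where
  hom := mkM (app := fun a => (S.toE.symm (appIsoE i a)).hom)
    (S.toPre.isMNat_toE_symm (appIsoE i) (isENat_appE i.hom))
  inv := mkM (app := fun a => (S.toE.symm (appIsoE i.symm a)).hom)
    (S.toPre.isMNat_toE_symm (appIsoE i.symm) (isENat_appE i.inv))
  hom_inv_id := functorDouble_homM_ext fun a => by
    change (S.toE.symm (appIsoE i a)).hom ≫ (S.toE.symm (appIsoE i a).symm).hom = C.idM _
    rw [toE_symm_symm]
    simp
  inv_hom_id := functorDouble_homM_ext fun a => by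
    change (S.toE.symm (appIsoE i a).symm).hom ≫ (S.toE.symm (appIsoE i a)).hom = C.idM _
    rw [toE_symm_symm]
    simp

theorem appIsoE_isoToE (i : (functorDouble S D).obM F ≅ (functorDouble S D).obM G) (a : D.Ob) :
    appIsoE (isoToE i) a = S.toE (appIsoM i a) := by
  ext
  rfl

theorem appIsoM_isoToM (i : (functorDouble S D).obE F ≅ (functorDouble S D).obE G) (a : D.Ob) :
    appIsoM (isoToM i) a = S.toE.symm (appIsoE i a) := by
  ext
  rfl

theorem isoToM_isoToE (i : (functorDouble S D).obM F ≅ (functorDouble S D).obM G) :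
    isoToM (isoToE i) = i :=
  Iso.ext (functorDouble_homM_ext fun a => by
    change (appIsoM (isoToM (isoToE i)) a).hom = (appIsoM i a).hom
    rw [appIsoM_isoToM, appIsoE_isoToE, Equiv.symm_apply_apply])

theorem isoToE_isoToM (i : (functorDouble S D).obE F ≅ (functorDouble S D).obE G) :
    isoToE (isoToM i) = i :=
  Iso.ext (functorDouble_homE_ext fun a => by
    change (appIsoE (isoToE (isoToM i)) a).hom = (appIsoE i a).hom
    rw [appIsoE_isoToE, appIsoM_isoToM, Equiv.apply_symm_apply])

variable (S D) in
/-- The shared isomorphisms of `C^D`. -/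
noncomputable def functorSharedIsos : SharedIsos (functorDouble S D) where
  toE :=
    { toFun := isoToE
      invFun := isoToM
      left_inv := isoToM_isoToE
      right_inv := isoToE_isoToM }
  toE_trans f f' := Iso.ext (functorDouble_homE_ext fun a =>
    congrArg Iso.hom (S.toE_trans (appIsoM f a) (appIsoM f' a)))
  nonempty_sq_vert_iff g f f' g' := by
    constructor
    · rintro ⟨s⟩
      exact functorDouble_homM_ext fun a =>
        (S.nonempty_sq_vert_iff (appM g a) (appIsoM f a) (appIsoM f' a) (appM g' a)).1
          ⟨Modif.app s a⟩
    · intro e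
      exact ⟨Modif.mk' fun a => ((S.nonempty_sq_vert_iff (appM g a) (appIsoM f a) (appIsoM f' a)
        (appM g' a)).2 (appM_congr e a)).some⟩
  subsingleton_sq_vert g f f' g' :=
    ⟨fun _ _ => Modif.ext (funext fun _ => (S.subsingleton_sq _ _ _ _).elim _ _)⟩
  nonempty_sq_horiz_iff f g g' f' := by
    constructor
    · rintro ⟨s⟩
      exact functorDouble_homE_ext fun a =>
        (S.nonempty_sq_horiz_iff (appIsoM f a) (appE g a) (appE g' a) (appIsoM f' a)).1
          ⟨Modif.app s a⟩
    · intro e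
      exact ⟨Modif.mk' fun a => ((S.nonempty_sq_horiz_iff (appIsoM f a) (appE g a) (appE g' a)
        (appIsoM f' a)).2 (appE_congr e a)).some⟩
  subsingleton_sq_horiz g f f' g' :=
    ⟨fun _ _ => Modif.ext (funext fun _ => (S.subsingleton_sq _ _ _ _).elim _ _)⟩

variable (S D) in
/-- The constant functor at `∅` is initial for m-morphisms. -/
noncomputable def isInitialM_zeroFunctor :
    IsInitial ((functorDouble S D).obM (S.toPre.zeroFunctor D)) :=
  IsInitial.ofUniqueHom (fun F => mkM (S.toPre.isMNat_zero F))
    (fun _ _ => functorDouble_homM_ext fun _ => S.zeroM.hom_ext _ _)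

variable (S D) in
/-- The constant functor at `∅` is initial for e-morphisms. -/
noncomputable def isInitialE_zeroFunctor :
    IsInitial ((functorDouble S D).obE (S.toPre.zeroFunctor D)) :=
  IsInitial.ofUniqueHom (fun F => mkE (S.toPre.isENat_zero F))
    (fun _ _ => functorDouble_homE_ext fun _ => S.zeroE.hom_ext _ _)

/-! ## Pullbacks -/

/-- The pointwise lift is m-natural because its composite with `g` is (`IsMNat.of_comp`). -/
theorem isPullbackM_of_app {f : (functorDouble S D).HomM F F'} {g : (functorDouble S D).HomM F G}
    {h : (functorDouble S D).HomM F' G'} {k : (functorDouble S D).HomM G G'}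
    (e : f ≫ h = g ≫ k) (H : ∀ a, IsPullback (appM f a) (appM g a) (appM h a) (appM k a)) :
    IsPullback f g h k := by
  refine ⟨⟨e⟩, ⟨PullbackCone.IsLimit.mk _
    (fun s => mkM (app := fun a => (H a).lift (appM s.fst a) (appM s.snd a)
      (appM_congr s.condition a)) ?_)
    (fun s => functorDouble_homM_ext fun a => (H a).lift_fst _ _ _)
    (fun s => functorDouble_homM_ext fun a => (H a).lift_snd _ _ _)
    (fun s m h₁ h₂ => functorDouble_homM_ext fun a => (H a).hom_ext ?_ ?_)⟩⟩
  · refine PreStarCGW.IsMNat.of_comp (isMNat_appM g) ?_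
    have e' : (fun a => (H a).lift (appM s.fst a) (appM s.snd a) (appM_congr s.condition a) ≫
        appM g a) = appM s.snd := funext fun a => (H a).lift_snd _ _ _
    exact e'.symm ▸ isMNat_appM s.snd
  · exact (appM_congr h₁ a).trans ((H a).lift_fst _ _ _).symm
  · exact (appM_congr h₂ a).trans ((H a).lift_snd _ _ _).symm

theorem isPullbackE_of_app {f : (functorDouble S D).HomE F F'} {g : (functorDouble S D).HomE F G}
    {h : (functorDouble S D).HomE F' G'} {k : (functorDouble S D).HomE G G'}
    (e : f ≫ h = g ≫ k) (H : ∀ a, IsPullback (appE f a) (appE g a) (appE h a) (appE k a)) :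
    IsPullback f g h k := by
  refine ⟨⟨e⟩, ⟨PullbackCone.IsLimit.mk _
    (fun s => mkE (app := fun a => (H a).lift (appE s.fst a) (appE s.snd a)
      (appE_congr s.condition a)) ?_)
    (fun s => functorDouble_homE_ext fun a => (H a).lift_fst _ _ _)
    (fun s => functorDouble_homE_ext fun a => (H a).lift_snd _ _ _)
    (fun s m h₁ h₂ => functorDouble_homE_ext fun a => (H a).hom_ext ?_ ?_)⟩⟩
  · refine PreStarCGW.IsMNat.of_comp (W := S.toPre.transpose) (isENat_appE g) ?_
    have e' : (fun a => (H a).lift (appE s.fst a) (appE s.snd a) (appE_congr s.condition a) ≫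
        appE g a) = appE s.snd := funext fun a => (H a).lift_snd _ _ _
    exact e'.symm ▸ isENat_appE s.snd
  · exact (appE_congr h₁ a).trans ((H a).lift_fst _ _ _).symm
  · exact (appE_congr h₂ a).trans ((H a).lift_snd _ _ _).symm

/-! ## ⋆-pushouts -/

theorem goodSqM_iff {μ : (functorDouble S D).HomM F G} {α : (functorDouble S D).HomM F F'}
    {β : (functorDouble S D).HomM G G'} {μ' : (functorDouble S D).HomM F' G'} :
    GoodSq (functorKerCok D S).goodM μ α β μ' ↔
      S.toPre.GoodCubes F G F' G' (appM μ) (appM α) (appM β) (appM μ') :=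
  ⟨fun h => h.2, fun h => ⟨functorDouble_homM_ext fun a => (h.good a).1, h⟩⟩

theorem goodSqE_iff {μ : (functorDouble S D).HomE F G} {α : (functorDouble S D).HomE F F'}
    {β : (functorDouble S D).HomE G G'} {μ' : (functorDouble S D).HomE F' G'} :
    GoodSq (functorKerCok D S).goodE μ α β μ' ↔
      S.toPre.transpose.GoodCubes F.transpose G.transpose F'.transpose G'.transpose
        (appE μ) (appE α) (appE β) (appE μ') :=
  ⟨fun h => h.2, fun h => ⟨functorDouble_homE_ext fun a => (h.good a).1, h⟩⟩

theorem isStarPushoutM_of_app {μ : (functorDouble S D).HomM F G}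
    {ν : (functorDouble S D).HomM F H} {i : (functorDouble S D).HomM G P}
    {j : (functorDouble S D).HomM H P}
    (hP : ∀ a, IsStarPushout S.goodM (appM μ a) (appM ν a) (appM i a) (appM j a)) :
    IsStarPushout (functorKerCok D S).goodM μ ν i j where
  good := goodSqM_iff.2 (PreStarCGW.goodCubes_of_star (isMNat_appM μ) (isMNat_appM ν)
    (isMNat_appM i) (isMNat_appM j) hP)
  desc {Y} h k Hc := by
    replace Hc := goodSqM_iff.1 Hc
    choose x hx hx' using fun a => (hP a).desc _ _ (Hc.good a)
    exact ⟨mkM (PreStarCGW.isMNat_star_desc (isMNat_appM μ) (isMNat_appM ν) (isMNat_appM i)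
      (isMNat_appM j) hP (isMNat_appM h) (isMNat_appM k) Hc (fun a => (hx a).1)
      (fun a => (hx a).2)), ⟨functorDouble_homM_ext fun a => (hx a).1,
      functorDouble_homM_ext fun a => (hx a).2⟩, fun y hy => functorDouble_homM_ext fun a =>
      hx' a _ ⟨appM_congr hy.1 a, appM_congr hy.2 a⟩⟩

theorem isStarPushoutE_of_app {μ : (functorDouble S D).HomE F G}
    {ν : (functorDouble S D).HomE F H} {i : (functorDouble S D).HomE G P}
    {j : (functorDouble S D).HomE H P}
    (hP : ∀ a, IsStarPushout S.goodE (appE μ a) (appE ν a) (appE i a) (appE j a)) :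
    IsStarPushout (functorKerCok D S).goodE μ ν i j where
  good := goodSqE_iff.2 (PreStarCGW.goodCubes_of_star (isENat_appE μ) (isENat_appE ν)
    (isENat_appE i) (isENat_appE j) hP)
  desc {Y} h k Hc := by
    replace Hc := goodSqE_iff.1 Hc
    choose x hx hx' using fun a => (hP a).desc _ _ (Hc.good a)
    exact ⟨mkE (PreStarCGW.isMNat_star_desc (W := S.toPre.transpose) (isENat_appE μ)
      (isENat_appE ν) (isENat_appE i)
      (isENat_appE j) hP (isENat_appE h) (isENat_appE k) Hc (fun a => (hx a).1)
      (fun a => (hx a).2)), ⟨functorDouble_homE_ext fun a => (hx a).1,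
      functorDouble_homE_ext fun a => (hx a).2⟩, fun y hy => functorDouble_homE_ext fun a =>
      hx' a _ ⟨appE_congr hy.1 a, appE_congr hy.2 a⟩⟩

/-- The completions are needed at each object separately, with no naturality: they only ensure that
the ⋆-pushouts exist. -/
theorem exists_isStarPushoutM_app (μ : (functorDouble S D).HomM F G)
    (ν : (functorDouble S D).HomM F H)
    (h : ∀ a, ∃ (Y : C.Ob) (i : C.HomM (G.obj a) Y) (j : C.HomM (H.obj a) Y),
      GoodSq S.goodM (appM μ a) (appM ν a) i j) :
    ∃ (P : DoubleFunctor D C) (i : (functorDouble S D).HomM G P)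
      (j : (functorDouble S D).HomM H P),
      ∀ a, IsStarPushout S.goodM (appM μ a) (appM ν a) (appM i a) (appM j a) := by
  choose Y i' j' hg using h
  choose Q i j hQ using fun a => S.toPre.exists_starM (hg a)
  exact ⟨_, mkM (PreStarCGW.isMNat_star_inl (isMNat_appM μ) (isMNat_appM ν) hQ),
    mkM (PreStarCGW.isMNat_star_inr (isMNat_appM μ) (isMNat_appM ν) hQ), hQ⟩

theorem exists_isStarPushoutE_app (μ : (functorDouble S D).HomE F G)
    (ν : (functorDouble S D).HomE F H)
    (h : ∀ a, ∃ (Y : C.Ob) (i : C.HomE (G.obj a) Y) (j : C.HomE (H.obj a) Y),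
      GoodSq S.goodE (appE μ a) (appE ν a) i j) :
    ∃ (P : DoubleFunctor D C) (i : (functorDouble S D).HomE G P)
      (j : (functorDouble S D).HomE H P),
      ∀ a, IsStarPushout S.goodE (appE μ a) (appE ν a) (appE i a) (appE j a) := by
  choose Y i' j' hg using h
  choose Q i j hQ using fun a => S.toPre.exists_starE (hg a)
  exact ⟨DoubleFunctor.untranspose (PreStarCGW.starFunctor (W := S.toPre.transpose)
      (isENat_appE μ) (isENat_appE ν) hQ),
    mkE (PreStarCGW.isMNat_star_inl (W := S.toPre.transpose) (isENat_appE μ) (isENat_appE ν) hQ),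
    mkE (PreStarCGW.isMNat_star_inr (W := S.toPre.transpose) (isENat_appE μ) (isENat_appE ν) hQ),
    hQ⟩

/-- The good completion `P` ensures that the pointwise ⋆-pushout exists, and any other ⋆-pushout is
isomorphic to it. -/
theorem isStarPushoutM_app {μ : (functorDouble S D).HomM F G}
    {ν : (functorDouble S D).HomM F H} {i : (functorDouble S D).HomM G P}
    {j : (functorDouble S D).HomM H P} (hP : IsStarPushout (functorKerCok D S).goodM μ ν i j)
    (a : D.Ob) : IsStarPushout S.goodM (appM μ a) (appM ν a) (appM i a) (appM j a) := by
  obtain ⟨Q, i', j', hQ⟩ := exists_isStarPushoutM_app μ ν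
    (fun a => ⟨_, _, _, (goodSqM_iff.1 hP.good).good a⟩)
  obtain ⟨m, hm, rfl, rfl⟩ := (isStarPushoutM_of_app hQ).exists_isIso hP
  have := isIso_appM m a
  exact S.toPre.star_of_isIso (hQ a) (appM m a)

theorem isStarPushoutE_app {μ : (functorDouble S D).HomE F G}
    {ν : (functorDouble S D).HomE F H} {i : (functorDouble S D).HomE G P}
    {j : (functorDouble S D).HomE H P} (hP : IsStarPushout (functorKerCok D S).goodE μ ν i j)
    (a : D.Ob) : IsStarPushout S.goodE (appE μ a) (appE ν a) (appE i a) (appE j a) := by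
  obtain ⟨Q, i', j', hQ⟩ := exists_isStarPushoutE_app μ ν
    (fun a => ⟨_, _, _, (goodSqE_iff.1 hP.good).good a⟩)
  obtain ⟨m, hm, rfl, rfl⟩ := (isStarPushoutE_of_app hQ).exists_isIso hP
  have : IsIso (C := C.transpose.M) (appE m a) := isIso_appE m a
  exact PreStarCGW.star_of_isIso S.toPre.transpose (hQ a) (appE m a)

end CGW

namespace CGW

/-! ## The ⋆-CGW structure on functor double categories -/

/-- A `PreStarCGW` structure satisfying (PO) is a ⋆-CGW structure. -/
@[reducible]
def PreStarCGW.toStarCGW {C : DoubleCategory.{u, v, w}} (W : PreStarCGW C)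
    (exists_good : ∀ {A B X : C.Ob} (f : C.HomM A B) (g : C.HomM A X),
      ∃ (Y : C.Ob) (h : C.HomM B Y) (k : C.HomM X Y), GoodSq W.goodM f g h k) : StarCGW C where
  toSharedIsos := W.toSharedIsos
  toKerCok := W.toKerCok
  kerFunctor_isEquivalence := W.toKerCok.kerFunctor_isEquivalence W.monoM W.sq_subsingleton
    W.top_unique W.exists_sq_of_goodM (fun f => ⟨_, W.cokπ f, W.shortExact_cokπ f⟩)
    (fun s hs => (W.triangleM hs s.w).2)
  cokFunctor_isEquivalence := W.toKerCok.cokFunctor_isEquivalence W.monoE W.sq_subsingleton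
    W.left_unique W.exists_sq_of_goodE (fun g => ⟨_, W.kerι g, (W.shortExact_kerι g).dual⟩)
    (fun s hs => (W.triangleE hs s.w).2)
  zero := W.zero
  zeroM := W.zeroM
  zeroE := W.zeroE
  monoM := W.monoM
  monoE := W.monoE
  triangleM s hs := (W.triangleM hs s.w).2
  triangleE s hs := (W.triangleE hs s.w).2
  pullbackM s hs := W.pullbackM ⟨s.w, hs⟩
  pullbackE s hs := W.pullbackE ⟨s.w, hs⟩
  isIso_kerMap_iff := W.isIso_kerMap_iff
  exists_cok_sq := W.exists_cok_sq
  exists_ker_sq := W.exists_ker_sq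
  good_symmM _ _ _ _ := ⟨W.good_symmM, W.good_symmM⟩
  good_symmE _ _ _ _ := ⟨W.good_symmE, W.good_symmE⟩
  exists_starM _ _ _ _ := W.exists_starM
  starM_cok _ _ _ _ h := ⟨W.starM_cok h, W.starM_cok (W.star_symm h)⟩
  exists_starE _ _ _ _ := W.exists_starE
  starE_ker _ _ _ _ h := ⟨W.starE_ker h, W.starE_ker (W.transpose.star_symm h)⟩
  exists_good := exists_good
  pblM _ _ _ _ _ _ _ s t := W.pblM s.some t.some
  pblE _ _ _ _ _ _ _ s t := W.pblE s.some t.some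
  polM _ _ _ _ _ _ _ := W.polM
  polE _ _ _ _ _ _ _ := W.polE

variable {D : DoubleCategory.{u', v', w'}} {C : DoubleCategory.{u, v, w}} {S : StarCGW C}

section

variable {F G F' G' H P : DoubleFunctor D C}

theorem exists_homM_of_goodCubes {η : (functorDouble S D).HomE F F'}
    {η' : (functorDouble S D).HomE G G'} {μ' : (functorDouble S D).HomM F' G'}
    {m : (functorDouble S D).HomM ((functorKerCok D S).ker η) ((functorKerCok D S).ker η')}
    (h : GoodSq (functorKerCok D S).goodM ((functorKerCok D S).kerι η) m μ'
      ((functorKerCok D S).kerι η')) :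
    ∃ μ : (functorDouble S D).HomM F G, Nonempty ((functorDouble S D).Sq μ η η' μ') := by
  obtain ⟨μ, hμ, s⟩ := PreStarCGW.exists_isMNat_of_goodCubes (isENat_appE η) (isENat_appE η')
    (isMNat_appM μ') (fun a => S.toPre.shortExact_kerι _) (fun a => S.toPre.shortExact_kerι _)
    (goodSqM_iff.1 h)
  exact ⟨mkM hμ, ⟨Modif.mk' fun a => (s a).some⟩⟩

theorem exists_homE_of_goodCubes {μ : (functorDouble S D).HomM F G}
    {μ' : (functorDouble S D).HomM F' G'} {η' : (functorDouble S D).HomE G G'}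
    {e : (functorDouble S D).HomE ((functorKerCok D S).cok μ) ((functorKerCok D S).cok μ')}
    (h : GoodSq (functorKerCok D S).goodE ((functorKerCok D S).cokπ μ) e η'
      ((functorKerCok D S).cokπ μ')) :
    ∃ η : (functorDouble S D).HomE F F', Nonempty ((functorDouble S D).Sq μ η η' μ') := by
  obtain ⟨η, hη, s⟩ := PreStarCGW.exists_isMNat_of_goodCubes (W := S.toPre.transpose)
    (isENat_transpose_appM μ) (isENat_transpose_appM μ')
    (isENat_appE η') (fun a => S.toPre.transpose.shortExact_kerι _)
    (fun a => S.toPre.transpose.shortExact_kerι _) (goodSqE_iff.1 h)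
  exact ⟨mkE hη, ⟨Modif.mk' fun a => (s a).some⟩⟩

theorem exists_cok_isIso_of_star {μ : (functorDouble S D).HomM F G}
    {ν : (functorDouble S D).HomM F H} {i : (functorDouble S D).HomM G P}
    {j : (functorDouble S D).HomM H P} (hP : IsStarPushout (functorKerCok D S).goodM μ ν i j) :
    ∃ m : (functorDouble S D).HomM ((functorKerCok D S).cok μ) ((functorKerCok D S).cok j),
      IsIso m ∧ Nonempty ((functorDouble S D).Sq m ((functorKerCok D S).cokπ μ)
        ((functorKerCok D S).cokπ j) i) := by
  obtain ⟨m, hm, s⟩ := PreStarCGW.exists_isMNat_of_goodCubes (isENat_appE ((functorKerCok D S).cokπ μ))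
    (isENat_appE ((functorKerCok D S).cokπ j)) (isMNat_appM i)
    (fun a => S.toPre.shortExact_cokπ (appM μ a)) (fun a => S.toPre.shortExact_cokπ (appM j a))
    (goodSqM_iff.1 hP.good)
  exact ⟨mkM hm, isIsoM_of_app _ fun a => PreStarCGW.ShortExact.star_isIso
    (S.toPre.shortExact_cokπ (appM μ a)) (S.toPre.shortExact_cokπ (appM j a)) (s a).some
    (isStarPushoutM_app hP a), ⟨Modif.mk' fun a => (s a).some⟩⟩

theorem exists_ker_isIso_of_star {μ : (functorDouble S D).HomE F G}
    {ν : (functorDouble S D).HomE F H} {i : (functorDouble S D).HomE G P}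
    {j : (functorDouble S D).HomE H P} (hP : IsStarPushout (functorKerCok D S).goodE μ ν i j) :
    ∃ e : (functorDouble S D).HomE ((functorKerCok D S).ker μ) ((functorKerCok D S).ker j),
      IsIso e ∧ Nonempty ((functorDouble S D).Sq ((functorKerCok D S).kerι μ) e i
        ((functorKerCok D S).kerι j)) := by
  obtain ⟨m, hm, s⟩ := PreStarCGW.exists_isMNat_of_goodCubes (W := S.toPre.transpose)
    (isENat_transpose_appM ((functorKerCok D S).kerι μ))
    (isENat_transpose_appM ((functorKerCok D S).kerι j)) (isENat_appE i)
    (fun a => S.toPre.transpose.shortExact_cokπ (appE μ a))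
    (fun a => S.toPre.transpose.shortExact_cokπ (appE j a))
    (goodSqE_iff.1 hP.good)
  exact ⟨mkE hm, isIsoE_of_app _ fun a => PreStarCGW.ShortExact.star_isIso
    (W := S.toPre.transpose) (S.toPre.transpose.shortExact_cokπ (appE μ a))
    (S.toPre.transpose.shortExact_cokπ (appE j a)) (s a).some
    (isStarPushoutE_app hP a), ⟨Modif.mk' fun a => (s a).some⟩⟩

theorem isIso_functorKerMap_iff {μ : (functorDouble S D).HomM F G}
    {η : (functorDouble S D).HomE F F'} {η' : (functorDouble S D).HomE G G'}
    {μ' : (functorDouble S D).HomM F' G'} (s : (functorDouble S D).Sq μ η η' μ') :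
    IsIso ((functorKerCok D S).kerMap s) ↔ ∀ a, S.Distinguished (Modif.app s a) :=
  ⟨fun _ a => isIso_appM ((functorKerCok D S).kerMap s) a, fun h => isIsoM_of_app _ h⟩

theorem isIso_functorCokMap_iff {μ : (functorDouble S D).HomM F G}
    {η : (functorDouble S D).HomE F F'} {η' : (functorDouble S D).HomE G G'}
    {μ' : (functorDouble S D).HomM F' G'} (s : (functorDouble S D).Sq μ η η' μ') :
    IsIso ((functorKerCok D S).cokMap s) ↔ ∀ a, IsIso (S.cokMap (Modif.app s a)) :=
  ⟨fun _ a => isIso_appE ((functorKerCok D S).cokMap s) a, fun h => isIsoE_of_app _ h⟩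

end

variable (S D)

/-- The self-dual part of the ⋆-CGW structure on `C^D`. -/
noncomputable def functorPre : PreStarCGW (functorDouble S D) where
  toSharedIsos := functorSharedIsos D S
  toKerCok := functorKerCok D S
  sq_subsingleton _ _ _ _ :=
    ⟨fun _ _ => Modif.ext (funext fun _ => (S.subsingleton_sq _ _ _ _).elim _ _)⟩
  top_unique s t := functorDouble_homM_ext fun a =>
    S.toPre.top_unique (Modif.app s a) (Modif.app t a)
  left_unique s t := functorDouble_homE_ext fun a =>
    S.toPre.left_unique (Modif.app s a) (Modif.app t a)
  exists_sq_of_goodM := exists_homM_of_goodCubes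
  exists_sq_of_goodE := exists_homE_of_goodCubes
  zero := S.toPre.zeroFunctor D
  zeroM := isInitialM_zeroFunctor D S
  zeroE := isInitialE_zeroFunctor D S
  monoM f := ⟨fun x y e => functorDouble_homM_ext fun a =>
    (S.monoM (appM f a)).right_cancellation _ _ (appM_congr e a)⟩
  monoE f := ⟨fun x y e => functorDouble_homE_ext fun a =>
    (S.monoE (appE f a)).right_cancellation _ _ (appE_congr e a)⟩
  triangleM {_ _ _ _ f g h k} _ e := goodSqM_iff.2 (PreStarCGW.goodCubes_of_isIso (isMNat_appM f)
    (isMNat_appM g) (isMNat_appM h) (isMNat_appM k) (isIso_appM g) (appM_congr e))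
  triangleE {_ _ _ _ f g h k} _ e := goodSqE_iff.2 (PreStarCGW.goodCubes_of_isIso
    (W := S.toPre.transpose) (isENat_appE f)
    (isENat_appE g) (isENat_appE h) (isENat_appE k) (isIso_appE g) (appE_congr e))
  pullbackM H := isPullbackM_of_app H.1 fun a => S.toPre.pullbackM ((goodSqM_iff.1 H).good a)
  pullbackE H := isPullbackE_of_app H.1 fun a => S.toPre.pullbackE ((goodSqE_iff.1 H).good a)
  isIso_kerMap_iff s := (isIso_functorKerMap_iff s).trans
    ((forall_congr' fun a => S.isIso_kerMap_iff (Modif.app s a)).trans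
      (isIso_functorCokMap_iff s).symm)
  exists_cok_sq f := by
    choose s hs using fun a => S.exists_cok_sq (appM f a)
    exact ⟨Modif.mk' s, (isIso_functorKerMap_iff _).2 hs⟩
  exists_ker_sq g := by
    choose s hs using fun a => S.exists_ker_sq (appE g a)
    exact ⟨Modif.mk' s, (isIso_functorKerMap_iff _).2 hs⟩
  good_symmM H := goodSqM_iff.2 (goodSqM_iff.1 H).symm
  good_symmE H := goodSqE_iff.2 (goodSqE_iff.1 H).symm
  exists_starM {_ _ _ _ f g _ _} H := by
    obtain ⟨P, i, j, hP⟩ := exists_isStarPushoutM_app f g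
      fun a => ⟨_, _, _, (goodSqM_iff.1 H).good a⟩
    exact ⟨P, i, j, isStarPushoutM_of_app hP⟩
  starM_cok := exists_cok_isIso_of_star
  exists_starE {_ _ _ _ f g _ _} H := by
    obtain ⟨P, i, j, hP⟩ := exists_isStarPushoutE_app f g
      fun a => ⟨_, _, _, (goodSqE_iff.1 H).good a⟩
    exact ⟨P, i, j, isStarPushoutE_of_app hP⟩
  starE_ker := exists_ker_isIso_of_star
  pblM s t := ⟨Modif.mk' fun a => (S.toPre.pblM (Modif.app s a) (Modif.app t a)).some⟩
  pblE s t := ⟨Modif.mk' fun a => (S.toPre.pblE (Modif.app s a) (Modif.app t a)).some⟩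
  polM {_ _ _ _ _ _ f g i j p q r} H e Hc := goodSqM_iff.2 (PreStarCGW.goodCubes_pol
    (isMNat_appM i) (isMNat_appM j) (isMNat_appM p) (isMNat_appM r)
    (fun a => isStarPushoutM_app H a) (appM_congr e) (goodSqM_iff.1 Hc))
  polE {_ _ _ _ _ _ f g i j p q r} H e Hc := goodSqE_iff.2 (PreStarCGW.goodCubes_pol
    (W := S.toPre.transpose) (isENat_appE i) (isENat_appE j) (isENat_appE p) (isENat_appE r)
    (fun a => isStarPushoutE_app H a) (appE_congr e) (goodSqE_iff.1 Hc))

/-- The pointwise ⋆-CGW structure on `C^D`. -/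
noncomputable def functorStarCGW : StarCGW (functorDouble S D) :=
  (functorPre D S).toStarCGW fun f g => by
    -- (PO) in `C` is applied at each object, and the resulting ⋆-pushouts assemble to a completion
    -- in `C^D`.
    obtain ⟨P, i, j, hP⟩ := exists_isStarPushoutM_app f g fun a => S.exists_good _ _
    exact ⟨P, i, j, (isStarPushoutM_of_app hP).good⟩

theorem isPointwise_functorStarCGW : IsPointwise (functorStarCGW D S) where
  goodM _ _ _ _ := ⟨fun h => ⟨h.1, fun f => goodSqM_iff.1 h f⟩, fun h => ⟨h.1, fun _ _ f => h.2 f⟩⟩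
  goodE _ _ _ _ := ⟨fun h => ⟨h.1, fun f => goodSqE_iff.1 h f⟩, fun h => ⟨h.1, fun _ _ f => h.2 f⟩⟩
  ker _ _ := rfl
  cok _ _ := rfl
  starM _ _ _ _ h a := isStarPushoutM_app h a
  starE _ _ _ _ h a := isStarPushoutE_app h a

end CGW

namespace CGW

/-! ## ⋆-CGW subcategories -/

section FullSub

variable {X : DoubleCategory.{u, v, w}} {Q : X.Ob → Prop}

theorem isIso_inclM {A B : (X.fullSub Q).Ob} {f : (X.fullSub Q).HomM A B} (h : IsIso f) :
    IsIso (C := X.M) ((X.inclM Q).map f) :=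
  inferInstance

theorem isIso_inclE {A B : (X.fullSub Q).Ob} {f : (X.fullSub Q).HomE A B} (h : IsIso f) :
    IsIso (C := X.E) ((X.inclE Q).map f) :=
  inferInstance

theorem isIso_of_inclM {A B : (X.fullSub Q).Ob} {f : (X.fullSub Q).HomM A B}
    (h : IsIso (C := X.M) ((X.inclM Q).map f)) : IsIso f := by
  obtain ⟨g, h₁, h₂⟩ := h
  exact ⟨g, h₁, h₂⟩

theorem isIso_of_inclE {A B : (X.fullSub Q).Ob} {f : (X.fullSub Q).HomE A B}
    (h : IsIso (C := X.E) ((X.inclE Q).map f)) : IsIso f := by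
  obtain ⟨g, h₁, h₂⟩ := h
  exact ⟨g, h₁, h₂⟩

/-- Lift an isomorphism to a full double subcategory. -/
def liftIsoM {A B : (X.fullSub Q).Ob} (i : X.obM A.1 ≅ X.obM B.1) :
    (X.fullSub Q).obM A ≅ (X.fullSub Q).obM B :=
  ⟨i.hom, i.inv, i.hom_inv_id, i.inv_hom_id⟩

/-- Lift an isomorphism to a full double subcategory. -/
def liftIsoE {A B : (X.fullSub Q).Ob} (i : X.obE A.1 ≅ X.obE B.1) :
    (X.fullSub Q).obE A ≅ (X.fullSub Q).obE B :=
  ⟨i.hom, i.inv, i.hom_inv_id, i.inv_hom_id⟩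

/-- The image of an isomorphism in the ambient double category. -/
def inclIsoM {A B : (X.fullSub Q).Ob} (i : (X.fullSub Q).obM A ≅ (X.fullSub Q).obM B) :
    X.obM A.1 ≅ X.obM B.1 :=
  (X.inclM Q).mapIso i

/-- The image of an isomorphism in the ambient double category. -/
def inclIsoE {A B : (X.fullSub Q).Ob} (i : (X.fullSub Q).obE A ≅ (X.fullSub Q).obE B) :
    X.obE A.1 ≅ X.obE B.1 :=
  (X.inclE Q).mapIso i

/-- The restriction of shared isomorphisms to a full double subcategory. -/
def SharedIsos.restrict (I : SharedIsos X) (Q : X.Ob → Prop) : SharedIsos (X.fullSub Q) where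
  toE :=
    { toFun i := liftIsoE (I.toE (inclIsoM i))
      invFun i := liftIsoM (I.toE.symm (inclIsoE i))
      left_inv i := Iso.ext (by
        have h := congrArg Iso.hom (I.toE.symm_apply_apply (inclIsoM i))
        exact h)
      right_inv i := Iso.ext (by
        have h := congrArg Iso.hom (I.toE.apply_symm_apply (inclIsoE i))
        exact h) }
  toE_trans f f' := Iso.ext (by
    have h := congrArg Iso.hom (I.toE_trans (inclIsoM f) (inclIsoM f'))
    exact h)
  nonempty_sq_vert_iff g f f' g' := I.nonempty_sq_vert_iff g (inclIsoM f) (inclIsoM f') g'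
  subsingleton_sq_vert g f f' g' := I.subsingleton_sq_vert g (inclIsoM f) (inclIsoM f') g'
  nonempty_sq_horiz_iff f g g' f' := I.nonempty_sq_horiz_iff (inclIsoM f) g g' (inclIsoM f')
  subsingleton_sq_horiz f g g' f' := I.subsingleton_sq_horiz (inclIsoM f) g g' (inclIsoM f')

/-- The restriction of kernels, cokernels and good squares to a full double subcategory that is
closed under subobjects. -/
def KerCok.restrict (K : KerCok X) (hM : ∀ {A B : X.Ob}, X.HomM A B → Q B → Q A)
    (hE : ∀ {A B : X.Ob}, X.HomE A B → Q B → Q A) : KerCok (X.fullSub Q) where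
  goodM _ _ s := K.goodM ((X.inclM Q).mapArrow.map s)
  goodE _ _ s := K.goodE ((X.inclE Q).mapArrow.map s)
  mulM :=
    { id_mem f := K.mulM.id_mem ((X.inclM Q).mapArrow.obj f)
      comp_mem _ _ hs ht := K.mulM.comp_mem _ _ hs ht }
  mulE :=
    { id_mem f := K.mulE.id_mem ((X.inclE Q).mapArrow.obj f)
      comp_mem _ _ hs ht := K.mulE.comp_mem _ _ hs ht }
  ker {_ B} g := ⟨K.ker g, hM (K.kerι g) B.2⟩
  kerι g := K.kerι g
  kerMap s := K.kerMap s
  kerMap_good s := ⟨(K.kerMap_good s).1, (K.kerMap_good s).2⟩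
  kerMap_hid g := K.kerMap_hid g
  kerMap_hcomp s t := K.kerMap_hcomp s t
  cok {_ B} f := ⟨K.cok f, hE (K.cokπ f) B.2⟩
  cokπ f := K.cokπ f
  cokMap s := K.cokMap s
  cokMap_good s := ⟨(K.cokMap_good s).1, (K.cokMap_good s).2⟩
  cokMap_vid f := K.cokMap_vid f
  cokMap_vcomp s t := K.cokMap_vcomp s t

namespace PreStarCGW

variable (W : PreStarCGW X) (hM : ∀ {A B : X.Ob}, X.HomM A B → Q B → Q A)
  (hE : ∀ {A B : X.Ob}, X.HomE A B → Q B → Q A)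

section

variable {A B Y P : (X.fullSub Q).Ob}

theorem goodSq_restrictM {f : (X.fullSub Q).HomM A B} {g : (X.fullSub Q).HomM A Y}
    {h : (X.fullSub Q).HomM B P} {k : (X.fullSub Q).HomM Y P} :
    GoodSq (W.toKerCok.restrict hM hE).goodM f g h k ↔ GoodSq (𝒜 := X.M) W.goodM
      ((X.inclM Q).map f) ((X.inclM Q).map g) ((X.inclM Q).map h) ((X.inclM Q).map k) :=
  ⟨fun H => ⟨H.1, H.2⟩, fun H => ⟨H.1, H.2⟩⟩

theorem goodSq_restrictE {f : (X.fullSub Q).HomE A B} {g : (X.fullSub Q).HomE A Y}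
    {h : (X.fullSub Q).HomE B P} {k : (X.fullSub Q).HomE Y P} :
    GoodSq (W.toKerCok.restrict hM hE).goodE f g h k ↔ GoodSq (𝒜 := X.E) W.goodE
      ((X.inclE Q).map f) ((X.inclE Q).map g) ((X.inclE Q).map h) ((X.inclE Q).map k) :=
  ⟨fun H => ⟨H.1, H.2⟩, fun H => ⟨H.1, H.2⟩⟩

theorem isStarPushout_restrictM_of {f : (X.fullSub Q).HomM A B} {g : (X.fullSub Q).HomM A Y}
    {i : (X.fullSub Q).HomM B P} {j : (X.fullSub Q).HomM Y P}
    (H : IsStarPushout (𝒜 := X.M) W.goodM ((X.inclM Q).map f) ((X.inclM Q).map g)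
      ((X.inclM Q).map i) ((X.inclM Q).map j)) :
    IsStarPushout (W.toKerCok.restrict hM hE).goodM f g i j where
  good := (W.goodSq_restrictM hM hE).2 H.good
  desc i' j' h := H.desc ((X.inclM Q).map i') ((X.inclM Q).map j')
    ((W.goodSq_restrictM hM hE).1 h)

theorem isStarPushout_restrictE_of {f : (X.fullSub Q).HomE A B} {g : (X.fullSub Q).HomE A Y}
    {i : (X.fullSub Q).HomE B P} {j : (X.fullSub Q).HomE Y P}
    (H : IsStarPushout (𝒜 := X.E) W.goodE ((X.inclE Q).map f) ((X.inclE Q).map g)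
      ((X.inclE Q).map i) ((X.inclE Q).map j)) :
    IsStarPushout (W.toKerCok.restrict hM hE).goodE f g i j where
  good := (W.goodSq_restrictE hM hE).2 H.good
  desc i' j' h := H.desc ((X.inclE Q).map i') ((X.inclE Q).map j')
    ((W.goodSq_restrictE hM hE).1 h)

/-- The ambient ⋆-pushout maps to the given completion, which lies in the subcategory, so closure
under subobjects applies. -/
theorem exists_star_restrictM {f : (X.fullSub Q).HomM A B} {g : (X.fullSub Q).HomM A Y}
    {h : (X.fullSub Q).HomM B P} {k : (X.fullSub Q).HomM Y P}
    (H : GoodSq (W.toKerCok.restrict hM hE).goodM f g h k) :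
    ∃ (R : (X.fullSub Q).Ob) (i : (X.fullSub Q).HomM B R) (j : (X.fullSub Q).HomM Y R),
      IsStarPushout (𝒜 := X.M) W.goodM ((X.inclM Q).map f) ((X.inclM Q).map g)
        ((X.inclM Q).map i) ((X.inclM Q).map j) := by
  obtain ⟨R, i, j, HR⟩ := W.exists_starM ((W.goodSq_restrictM hM hE).1 H)
  obtain ⟨t, -⟩ := HR.desc _ _ ((W.goodSq_restrictM hM hE).1 H)
  exact ⟨⟨R, hM t P.2⟩, i, j, HR⟩

theorem exists_star_restrictE {f : (X.fullSub Q).HomE A B} {g : (X.fullSub Q).HomE A Y}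
    {h : (X.fullSub Q).HomE B P} {k : (X.fullSub Q).HomE Y P}
    (H : GoodSq (W.toKerCok.restrict hM hE).goodE f g h k) :
    ∃ (R : (X.fullSub Q).Ob) (i : (X.fullSub Q).HomE B R) (j : (X.fullSub Q).HomE Y R),
      IsStarPushout (𝒜 := X.E) W.goodE ((X.inclE Q).map f) ((X.inclE Q).map g)
        ((X.inclE Q).map i) ((X.inclE Q).map j) := by
  obtain ⟨R, i, j, HR⟩ := W.exists_starE ((W.goodSq_restrictE hM hE).1 H)
  obtain ⟨t, -⟩ := HR.desc _ _ ((W.goodSq_restrictE hM hE).1 H)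
  exact ⟨⟨R, hE t P.2⟩, i, j, HR⟩

/-- A ⋆-pushout in the subcategory is isomorphic to the ambient one, which also lies there. -/
theorem isStarPushout_restrictM {f : (X.fullSub Q).HomM A B} {g : (X.fullSub Q).HomM A Y}
    {i : (X.fullSub Q).HomM B P} {j : (X.fullSub Q).HomM Y P} :
    IsStarPushout (W.toKerCok.restrict hM hE).goodM f g i j ↔
      IsStarPushout (𝒜 := X.M) W.goodM ((X.inclM Q).map f) ((X.inclM Q).map g)
        ((X.inclM Q).map i) ((X.inclM Q).map j) := by
  refine ⟨fun H => ?_, W.isStarPushout_restrictM_of hM hE⟩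
  obtain ⟨R, i', j', HR⟩ := W.exists_star_restrictM hM hE H.good
  obtain ⟨m, hm, rfl, rfl⟩ := (W.isStarPushout_restrictM_of hM hE HR).exists_isIso H
  have := isIso_inclM hm
  exact W.star_of_isIso HR ((X.inclM Q).map m)

theorem isStarPushout_restrictE {f : (X.fullSub Q).HomE A B} {g : (X.fullSub Q).HomE A Y}
    {i : (X.fullSub Q).HomE B P} {j : (X.fullSub Q).HomE Y P} :
    IsStarPushout (W.toKerCok.restrict hM hE).goodE f g i j ↔
      IsStarPushout (𝒜 := X.E) W.goodE ((X.inclE Q).map f) ((X.inclE Q).map g)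
        ((X.inclE Q).map i) ((X.inclE Q).map j) := by
  refine ⟨fun H => ?_, W.isStarPushout_restrictE_of hM hE⟩
  obtain ⟨R, i', j', HR⟩ := W.exists_star_restrictE hM hE H.good
  obtain ⟨m, hm, rfl, rfl⟩ := (W.isStarPushout_restrictE_of hM hE HR).exists_isIso H
  have : IsIso (C := X.transpose.M) ((X.inclE Q).map m) := isIso_inclE hm
  exact PreStarCGW.star_of_isIso W.transpose HR ((X.inclE Q).map m)

end

/-- The restriction of the self-dual part of a ⋆-CGW structure to a full double subcategory that
is closed under subobjects and contains the zero object. -/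
def restrict (h₀ : Q W.zero) : PreStarCGW (X.fullSub Q) where
  toSharedIsos := W.toSharedIsos.restrict Q
  toKerCok := W.toKerCok.restrict hM hE
  sq_subsingleton f g g' f' := W.sq_subsingleton f g g' f'
  top_unique s t := W.top_unique s t
  left_unique s t := W.left_unique s t
  exists_sq_of_goodM H := W.exists_sq_of_goodM ((W.goodSq_restrictM hM hE).1 H)
  exists_sq_of_goodE H := W.exists_sq_of_goodE ((W.goodSq_restrictE hM hE).1 H)
  zero := ⟨W.zero, h₀⟩
  zeroM := IsInitial.ofUniqueHom (fun A => W.zeroM.to (X.obM (Subtype.val (p := Q) A)))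
    fun _ _ => W.zeroM.hom_ext _ _
  zeroE := IsInitial.ofUniqueHom (fun A => W.zeroE.to (X.obE (Subtype.val (p := Q) A)))
    fun _ _ => W.zeroE.hom_ext _ _
  monoM f := ⟨fun x y e => (W.monoM ((X.inclM Q).map f)).right_cancellation
    ((X.inclM Q).map x) ((X.inclM Q).map y) e⟩
  monoE f := ⟨fun x y e => (W.monoE ((X.inclE Q).map f)).right_cancellation
    ((X.inclE Q).map x) ((X.inclE Q).map y) e⟩
  triangleM h e := (W.goodSq_restrictM hM hE).2 (W.triangleM (isIso_inclM h) e)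
  triangleE h e := (W.goodSq_restrictE hM hE).2 (W.triangleE (isIso_inclE h) e)
  pullbackM H := by
    have pb := W.pullbackM ((W.goodSq_restrictM hM hE).1 H)
    exact ⟨⟨H.1⟩, ⟨PullbackCone.IsLimit.mk _
      (fun s => pb.lift ((X.inclM Q).map s.fst) ((X.inclM Q).map s.snd) s.condition)
      (fun s => pb.lift_fst _ _ _) (fun s => pb.lift_snd _ _ _)
      (fun s m h₁ h₂ => pb.hom_ext (h₁.trans (pb.lift_fst _ _ _).symm)
        (h₂.trans (pb.lift_snd _ _ _).symm))⟩⟩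
  pullbackE H := by
    have pb := W.pullbackE ((W.goodSq_restrictE hM hE).1 H)
    exact ⟨⟨H.1⟩, ⟨PullbackCone.IsLimit.mk _
      (fun s => pb.lift ((X.inclE Q).map s.fst) ((X.inclE Q).map s.snd) s.condition)
      (fun s => pb.lift_fst _ _ _) (fun s => pb.lift_snd _ _ _)
      (fun s m h₁ h₂ => pb.hom_ext (h₁.trans (pb.lift_fst _ _ _).symm)
        (h₂.trans (pb.lift_snd _ _ _).symm))⟩⟩
  isIso_kerMap_iff s :=
    ⟨fun h => isIso_of_inclE ((W.isIso_kerMap_iff s).1 (isIso_inclM h)),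
      fun h => isIso_of_inclM ((W.isIso_kerMap_iff s).2 (isIso_inclE h))⟩
  exists_cok_sq f := by
    obtain ⟨s, hs⟩ := W.exists_cok_sq ((X.inclM Q).map f)
    exact ⟨s, isIso_of_inclM hs⟩
  exists_ker_sq g := by
    obtain ⟨s, hs⟩ := W.exists_ker_sq ((X.inclE Q).map g)
    exact ⟨s, isIso_of_inclM hs⟩
  good_symmM H := (W.goodSq_restrictM hM hE).2 (W.good_symmM ((W.goodSq_restrictM hM hE).1 H))
  good_symmE H := (W.goodSq_restrictE hM hE).2 (W.good_symmE ((W.goodSq_restrictE hM hE).1 H))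
  exists_starM H := by
    obtain ⟨R, i, j, HR⟩ := W.exists_star_restrictM hM hE H
    exact ⟨R, i, j, W.isStarPushout_restrictM_of hM hE HR⟩
  starM_cok H := by
    obtain ⟨m, ⟨y, h₁, h₂⟩, s⟩ := W.starM_cok ((W.isStarPushout_restrictM hM hE).1 H)
    exact ⟨m, ⟨y, h₁, h₂⟩, s⟩
  exists_starE H := by
    obtain ⟨R, i, j, HR⟩ := W.exists_star_restrictE hM hE H
    exact ⟨R, i, j, W.isStarPushout_restrictE_of hM hE HR⟩
  starE_ker H := by
    obtain ⟨m, ⟨y, h₁, h₂⟩, s⟩ := W.starE_ker ((W.isStarPushout_restrictE hM hE).1 H)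
    exact ⟨m, ⟨y, h₁, h₂⟩, s⟩
  pblM s t := W.pblM s t
  pblE s t := W.pblE s t
  polM H e Hc := (W.goodSq_restrictM hM hE).2 (W.polM ((W.isStarPushout_restrictM hM hE).1 H) e
    ((W.goodSq_restrictM hM hE).1 Hc))
  polE H e Hc := (W.goodSq_restrictE hM hE).2 (W.polE ((W.isStarPushout_restrictE hM hE).1 H) e
    ((W.goodSq_restrictE hM hE).1 Hc))

end PreStarCGW

/-- The restriction of a ⋆-CGW structure to a full double subcategory that contains the zero
object, and is closed under subobjects and under some completion of spans to good squares. -/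
def StarCGW.restrict (T : StarCGW X) (hM : ∀ {A B : X.Ob}, X.HomM A B → Q B → Q A)
    (hE : ∀ {A B : X.Ob}, X.HomE A B → Q B → Q A) (h₀ : Q T.zero)
    (hPO : ∀ {A B Y : X.Ob} (f : X.HomM A B) (g : X.HomM A Y), Q A → Q B → Q Y →
      ∃ (R : X.Ob) (h : X.HomM B R) (k : X.HomM Y R), Q R ∧ GoodSq T.goodM f g h k) :
    StarCGW (X.fullSub Q) :=
  (T.toPre.restrict hM hE h₀).toStarCGW fun {A B Y} f g => by
    obtain ⟨R, h, k, hR, H⟩ := hPO ((X.inclM Q).map f) ((X.inclM Q).map g) A.2 B.2 Y.2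
    exact ⟨⟨R, hR⟩, h, k, (T.toPre.goodSq_restrictM (Q := Q) (A := A) (B := B) (Y := Y)
      (P := ⟨R, hR⟩) (f := f) (g := g) (h := h) (k := k) hM hE).2 H⟩

theorem StarCGW.inheritedFrom_restrict (T : StarCGW X)
    (hM : ∀ {A B : X.Ob}, X.HomM A B → Q B → Q A)
    (hE : ∀ {A B : X.Ob}, X.HomE A B → Q B → Q A) (h₀ : Q T.zero)
    (hPO : ∀ {A B Y : X.Ob} (f : X.HomM A B) (g : X.HomM A Y), Q A → Q B → Q Y →
      ∃ (R : X.Ob) (h : X.HomM B R) (k : X.HomM Y R), Q R ∧ GoodSq T.goodM f g h k) :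
    (T.restrict hM hE h₀ hPO).InheritedFrom T where
  iso _ := Iso.ext rfl
  goodM _ := Iff.rfl
  goodE _ := Iff.rfl
  ker _ := rfl
  cok _ := rfl
  zero := rfl
  starM _ _ _ _ := T.toPre.isStarPushout_restrictM hM hE
  starE _ _ _ _ := T.toPre.isStarPushout_restrictE hM hE

end FullSub

end CGW

namespace CGW

/-! ## Double functors with distinguished squares -/

namespace PreStarCGW

variable {D : DoubleCategory.{u', v', w'}} {C : DoubleCategory.{u, v, w}} {W : PreStarCGW C}

/-- The kernel square is a pullback, so a factorisation of the kernel of `g'` through `f'` gives a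
section of the monomorphism `kerMap s`. Distinguishedness becomes a containment, which is easy to
transport. -/
theorem isIso_kerMap_iff_exists {A B A' B' K : C.Ob} {f : C.HomM A B} {g : C.HomE A A'}
    {g' : C.HomE B B'} {f' : C.HomM A' B'} (s : C.Sq f g g' f') {κ : C.HomM K B'}
    (hκ : W.ShortExact κ g') : IsIso (W.kerMap s) ↔ ∃ t : C.HomM K A', t ≫ f' = κ := by
  obtain ⟨m, hm, e⟩ := hκ
  constructor
  · intro h
    refine ⟨inv m ≫ inv (W.kerMap s) ≫ W.kerι g, ?_⟩
    rw [Category.assoc, Category.assoc, ← W.kerMap_comm, IsIso.inv_hom_id_assoc, ← e,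
      IsIso.inv_hom_id_assoc]
  · rintro ⟨t, ht⟩
    have pb := W.pullbackM (W.kerMap_good s)
    have := W.monoM (W.kerMap s)
    have h : pb.lift (C.idM _) (m ≫ t) (by simp [ht, e]) ≫ W.kerMap s = C.idM _ :=
      pb.lift_fst _ _ _
    refine ⟨_, ?_, h⟩
    rw [← cancel_mono (W.kerMap s), Category.assoc, h]
    simp

variable (W) in
/-- The double functor `F` sends all squares to distinguished squares. -/
def IsDistinguished (F : DoubleFunctor D C) : Prop :=
  ∀ {a b a' b' : D.Ob} {f : D.HomM a b} {g : D.HomE a a'} {g' : D.HomE b b'} {f' : D.HomM a' b'}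
    (s : D.Sq f g g' f'), IsIso (W.kerMap (F.mapSq s))

variable {F G H P : DoubleFunctor D C}

theorem IsDistinguished.transpose (h : W.IsDistinguished F) :
    W.transpose.IsDistinguished F.transpose :=
  fun s => (W.isIso_kerMap_iff (F.mapSq s)).1 (h s)

/-- The kernel in `F` maps to the kernel in `G`, which lies in `G a'`. The naturality square at `f'`
is good, hence a pullback, so the factorisation descends to `F a'`. -/
theorem IsDistinguished.of_isMNat {μ : ∀ a : D.Ob, C.HomM (F.obj a) (G.obj a)}
    (hG : W.IsDistinguished G) (hμ : W.IsMNat F G μ) : W.IsDistinguished F := by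
  intro a b a' b' f g g' f' s
  rw [isIso_kerMap_iff_exists _ (W.shortExact_kerι _)]
  obtain ⟨t, ht⟩ := (isIso_kerMap_iff_exists _ (W.shortExact_kerι _)).1 (hG s)
  obtain ⟨σ⟩ := hμ.sq g'
  have pb := W.pullbackM (hμ.good f')
  have e : (W.kerMap σ ≫ t) ≫ G.mapM f' = W.kerι (F.mapE g') ≫ μ b' := by
    rw [Category.assoc, ht, W.kerMap_comm]
  exact ⟨pb.lift _ _ e, pb.lift_snd _ _ _⟩

theorem IsDistinguished.of_isENat {η : ∀ a : D.Ob, C.HomE (F.obj a) (G.obj a)}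
    (hG : W.IsDistinguished G) (hη : W.IsENat F G η) : W.IsDistinguished F := fun s =>
  (W.isIso_kerMap_iff (F.mapSq s)).2
    (IsDistinguished.of_isMNat (W := W.transpose) hG.transpose hη s)

theorem isDistinguished_zeroFunctor : W.IsDistinguished (W.zeroFunctor D) := by
  intro a b a' b' f g g' f' s
  have : IsIso ((W.zeroFunctor D).mapE g) := inferInstanceAs (IsIso (C.idE W.zero))
  have : IsIso ((W.zeroFunctor D).mapE g') := inferInstanceAs (IsIso (C.idE W.zero))
  exact W.isIso_kerMap_of_isIso _

/-- The kernel for `P` is the ⋆-pushout of the kernels, so the factorisations for `G` and `H` glue;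
that they form a good square is tested by `good_reflect`. -/
theorem IsDistinguished.star {μ : ∀ a : D.Ob, C.HomM (F.obj a) (G.obj a)}
    {ν : ∀ a : D.Ob, C.HomM (F.obj a) (H.obj a)} {i : ∀ a : D.Ob, C.HomM (G.obj a) (P.obj a)}
    {j : ∀ a : D.Ob, C.HomM (H.obj a) (P.obj a)} (hμ : W.IsMNat F G μ) (hν : W.IsMNat F H ν)
    (hi : W.IsMNat G P i) (hj : W.IsMNat H P j)
    (hP : ∀ a, IsStarPushout W.goodM (μ a) (ν a) (i a) (j a))
    (hG : W.IsDistinguished G) (hH : W.IsDistinguished H) : W.IsDistinguished P := by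
  intro a b a' b' f g g' f' s
  have eF := W.shortExact_kerι (F.mapE g')
  have eG := W.shortExact_kerι (G.mapE g')
  have eH := W.shortExact_kerι (H.mapE g')
  obtain ⟨KP, p, q, α, β, κP, hp, hq, HK, hα, hβ, -⟩ :=
    exists_star_ker (hP b') eF eG eH (hμ.sq g').some (hν.sq g').some
  have eP := quotient_star_shortExact (hP b') (hP b) HK eF eG eH (hμ.sq g').some hp hq hα hβ
    (hi.sq g').some (hj.sq g').some
  obtain ⟨t, ht⟩ := (isIso_kerMap_iff_exists _ eG).1 (hG s)
  obtain ⟨u, hu⟩ := (isIso_kerMap_iff_exists _ eH).1 (hH s)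
  have e₁ : (t ≫ i a') ≫ P.mapM f' = α ≫ κP := by
    rw [Category.assoc, (hi.good f').1, reassoc_of% ht, hα]
  have e₂ : (u ≫ j a') ≫ P.mapM f' = β ≫ κP := by
    rw [Category.assoc, (hj.good f').1, reassoc_of% hu, hβ]
  have hgood := W.good_enlarge HK.good κP
  rw [← e₁, ← e₂] at hgood
  obtain ⟨x, ⟨h₁, h₂⟩, -⟩ := HK.desc _ _ (W.good_reflect hgood)
  refine (isIso_kerMap_iff_exists _ eP).2 ⟨x, W.star_hom_ext HK ?_ ?_⟩
  · rw [reassoc_of% h₁, ← e₁, Category.assoc]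
  · rw [reassoc_of% h₂, ← e₂, Category.assoc]

theorem isInitial_of_homM (W : PreStarCGW C) {A B : C.Ob} (f : C.HomM A B) (hB : IsInitial (C.obM B)) :
    Nonempty (IsInitial (C.obM A)) := by
  have := W.monoM f
  have := isIso_of_mono_of_isInitial hB f
  exact ⟨hB.ofIso (asIso f).symm⟩

theorem isInitial_of_homE (W : PreStarCGW C) {A B : C.Ob} (g : C.HomE A B) (hB : IsInitial (C.obM B)) :
    Nonempty (IsInitial (C.obM A)) := by
  obtain ⟨hB'⟩ := W.isInitialE hB
  obtain ⟨hA⟩ := isInitial_of_homM W.transpose g hB'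
  exact W.isInitialM hA

/-- Here `f` is invertible, so its cokernel is initial. By (⋆) the cokernel of `j` is initial too,
whence `j` is invertible. -/
theorem isInitial_star {A B X P : C.Ob} {f : C.HomM A B} {g : C.HomM A X} {i : C.HomM B P}
    {j : C.HomM X P} (H : IsStarPushout W.goodM f g i j) (hB : IsInitial (C.obM B))
    (hX : IsInitial (C.obM X)) : Nonempty (IsInitial (C.obM P)) := by
  have := W.monoM f
  have hf : IsIso f := isIso_of_mono_of_isInitial hB f
  obtain ⟨h₁⟩ := W.cok_isInitial f hf
  obtain ⟨h₂⟩ := W.isInitialM h₁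
  obtain ⟨m, hm, -⟩ := W.starM_cok H
  obtain ⟨h₃⟩ := W.isInitialE (h₂.ofIso (asIso m))
  have := W.isIso_of_cok_isInitial j h₃
  exact ⟨hX.ofIso (asIso j)⟩

end PreStarCGW

/-! ## The S-construction -/

section

variable {C : DoubleCategory.{u, v, w}} (S : ECGW C) (n : ℕ)

theorem IsStaircase.of_homM {F G : (functorDouble S.toStarCGW (staircase n)).Ob}
    (μ : (functorDouble S.toStarCGW (staircase n)).HomM F G)
    (hG : IsStaircase S.toStarCGW n G) : IsStaircase S.toStarCGW n F :=
  ⟨fun i => PreStarCGW.isInitial_of_homM S.toPre (appM μ _) (hG.1 i).some,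
    PreStarCGW.IsDistinguished.of_isMNat (W := S.toPre) hG.2 (isMNat_appM μ)⟩

theorem IsStaircase.of_homE {F G : (functorDouble S.toStarCGW (staircase n)).Ob}
    (η : (functorDouble S.toStarCGW (staircase n)).HomE F G)
    (hG : IsStaircase S.toStarCGW n G) : IsStaircase S.toStarCGW n F :=
  ⟨fun i => PreStarCGW.isInitial_of_homE S.toPre (appE η _) (hG.1 i).some,
    PreStarCGW.IsDistinguished.of_isENat (W := S.toPre) hG.2 (isENat_appE η)⟩

theorem isStaircase_zeroFunctor :
    IsStaircase S.toStarCGW n (S.toPre.zeroFunctor (staircase n)) :=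
  ⟨fun _ => ⟨S.zeroM⟩, PreStarCGW.isDistinguished_zeroFunctor (W := S.toPre)⟩

/-- Closure under subobjects does not give (PO), as the completion is larger than the span; this is
where ⋆-pushouts of staircases are needed. -/
theorem IsStaircase.exists_good {F G H : (functorDouble S.toStarCGW (staircase n)).Ob}
    (μ : (functorDouble S.toStarCGW (staircase n)).HomM F G)
    (ν : (functorDouble S.toStarCGW (staircase n)).HomM F H)
    (hG : IsStaircase S.toStarCGW n G) (hH : IsStaircase S.toStarCGW n H) :
    ∃ (P : (functorDouble S.toStarCGW (staircase n)).Ob)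
      (i : (functorDouble S.toStarCGW (staircase n)).HomM G P)
      (j : (functorDouble S.toStarCGW (staircase n)).HomM H P),
      IsStaircase S.toStarCGW n P ∧
        GoodSq (functorStarCGW (staircase n) S.toStarCGW).goodM μ ν i j := by
  obtain ⟨P, i, j, hP⟩ := exists_isStarPushoutM_app μ ν fun a => S.exists_good _ _
  exact ⟨P, i, j, ⟨fun k => PreStarCGW.isInitial_star (W := S.toPre) (hP _) (hG.1 k).some
    (hH.1 k).some, PreStarCGW.IsDistinguished.star (W := S.toPre) (isMNat_appM μ) (isMNat_appM ν)
    (isMNat_appM i) (isMNat_appM j) hP hG.2 hH.2⟩, (isStarPushoutM_of_app hP).good⟩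

/-- The ⋆-CGW structure on `S_n C`. -/
noncomputable def sDotStarCGW : StarCGW (sDot S.toStarCGW n) :=
  (functorStarCGW (staircase n) S.toStarCGW).restrict (IsStaircase.of_homM S n)
    (IsStaircase.of_homE S n) (isStaircase_zeroFunctor S n)
    fun μ ν _ hG hH => IsStaircase.exists_good S n μ ν hG hH

theorem sDotStarCGW_inheritedFrom :
    (sDotStarCGW S n).InheritedFrom (P := IsStaircase S.toStarCGW n)
      (functorStarCGW (staircase n) S.toStarCGW) :=
  StarCGW.inheritedFrom_restrict _ (IsStaircase.of_homM S n) (IsStaircase.of_homE S n)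
    (isStaircase_zeroFunctor S n) fun μ ν _ hG hH => IsStaircase.exists_good S n μ ν hG hH

/-- Evaluating the zero double functor gives `∅`, and initiality identifies the components of its
universal maps with the maps in the definition of a kernel-cokernel pair. -/
theorem GCGW.isKerCokPair_of_sq {A B Z : C.Ob} {f : C.HomM A B} {g : C.HomE Z B}
    {m : C.HomM S.zero Z} {e : C.HomE S.zero A} (s : C.Sq m e g f) (hs : S.Distinguished s) :
    S.toGCGW.IsKerCokPair f g := by
  obtain rfl := S.zeroM.hom_ext m (S.zeroM.to _)
  obtain rfl := S.zeroE.hom_ext e (S.zeroE.to _)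
  exact ⟨s, hs⟩

theorem isKerCokPair_app {F G Z : (sDot S.toStarCGW n).Ob} {f : (sDot S.toStarCGW n).HomM F G}
    {g : (sDot S.toStarCGW n).HomE Z G} (h : (sDotStarCGW S n).IsKerCokPair f g)
    (a : (staircase n).Ob) : S.toGCGW.IsKerCokPair (MNat.app f a) (ENat.app g a) := by
  obtain ⟨s, hs⟩ := h
  exact GCGW.isKerCokPair_of_sq S (Modif.app s a)
    ((isIso_functorKerMap_iff s).1 (isIso_inclM hs) a)

theorem isInitial_app {F : (sDot S.toStarCGW n).Ob}
    (h : IsInitial ((sDot S.toStarCGW n).obM F)) (a : (staircase n).Ob) :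
    Nonempty (IsInitial (C.obM (F.1.obj a))) :=
  ⟨S.zeroM.ofIso (appIsoM (inclIsoM ((sDotStarCGW S n).zeroM.uniqueUpToIso h)) a)⟩

/-- The ECGW structure on `S_n C`. -/
noncomputable def sDotECGW : ECGW (sDot S.toStarCGW n) where
  toStarCGW := sDotStarCGW S n
  acyclic F := ∀ a : (staircase n).Ob, S.acyclic (F.1.obj a)
  acyclic_of_isInitial _ h a := S.acyclic_of_isInitial _ (isInitial_app S n h.some a)
  acyclic_mid _ _ h hA hZ a := S.acyclic_mid _ _ (isKerCokPair_app S n h a) (hA a) (hZ a)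
  acyclic_ker _ _ h hB hZ a := S.acyclic_ker _ _ (isKerCokPair_app S n h a) (hB a) (hZ a)
  acyclic_cok _ _ h hA hB a := S.acyclic_cok _ _ (isKerCokPair_app S n h a) (hA a) (hB a)

end

end CGW

theorem mainTheorem9 {C : CGW.DoubleCategory.{u, v, w}} (S : CGW.ECGW C) (n : ℕ) :
    ∃ T : CGW.StarCGW (CGW.functorDouble S.toStarCGW (CGW.staircase n)),
      CGW.IsPointwise T ∧
      ∃ U : CGW.ECGW (CGW.sDot S.toStarCGW n),
        CGW.StarCGW.InheritedFrom (P := CGW.IsStaircase S.toStarCGW n) U.toStarCGW T ∧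
        ∀ F : (CGW.sDot S.toStarCGW n).Ob,
          U.acyclic F ↔ ∀ a : (CGW.staircase n).Ob, S.acyclic (F.1.obj a) :=
  ⟨CGW.functorStarCGW (CGW.staircase n) S.toStarCGW, CGW.isPointwise_functorStarCGW _ _,
    CGW.sDotECGW S n, CGW.sDotStarCGW_inheritedFrom S n, fun _ => Iff.rfl⟩
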